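/- Let $k$ be an algebraically closed field and let $K_0(\mathrm{Var}_k)$ be the Grothendieck ring of varieties over $k$: the commutative ring generated by the classes $[Y]$ of separated $k$-schemes $Y$ of finite type, with the relations $[Y]=[Y']$ if $Y\cong Y'$ over $k$, $[Y]=[Z]+[Y\setminus Z]$ for $Z\subset Y$ a closed subscheme, $[Y\times_k Y']=[Y][Y']$ and $[\operatorname{Spec}k]=1$. Let $X$ be a reduced curve over $k$ and $0\in X$ a closed point, or more generally let $X$ be a reduced scheme locally of finite type over $k$ and $0\in X$ a closed point with $\dim\mathcal O_{X,0}=1$. Let $s$ be the number of branches of $X$ at $0$, that is, the number of maximal ideals of the integral closure of $\mathcal O_{X,0}$ in its total ring of fractions. For $d\ge 0$ let $\operatorname{Hilb}^d(X,0)$ be the punctual Hilbert scheme, which parametrizes the closed subschemes of $X$ of length $d$ supported at $0$; with its reduced structure it is the projective variety of ideals of colength $d$ in $\mathcal O_{X,0}$ (equivalently in $\mathcal O_{X,0}/\mathfrak m^d$), a closed subvariety of the Grassmannian of $d$-dimensional quotients of the vector space $\mathcal O_{X,0}/\mathfrak m^d$. Then the punctual Hilbert zeta function $$Z^{\mathrm{Hilb}}_{0\subset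 X}(t)=\sum_{d\ge 0}[\operatorname{Hilb}^d(X,0)]\,t^d\in K_0(\mathrm{Var}_k)[[t]]$$ is a rational function of $t$ with denominator $(1-t)^s$: there is a polynomial $P\in K_0(\mathrm{Var}_k)[t]$ such that $(1-t)^s\,Z^{\mathrm{Hilb}}_{0\subset X}(t)=P(t)$. -/

import Mathlib

universe u

open CategoryTheory AlgebraicGeometry

noncomputable section

namespace HilbZeta

/-! ### The Grothendieck ring of varieties -/

/-- Varieties over `k`: separated schemes of finite type over `Spec k`. Non-reduced schemes are
allowed; the scissor relation below identifies the class of `X` with that of `X_red`. -/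
structure Variety (k : Type u) [Field k] where
  /-- the underlying scheme with its structure morphism -/
  toOver : Over (Spec (CommRingCat.of k))
  locallyOfFiniteType : LocallyOfFiniteType toOver.hom
  quasiCompact : QuasiCompact toOver.hom
  isSeparated : IsSeparated toOver.hom

/-- The relators of the Grothendieck ring, in the polynomial ring on one variable for every
variety. -/
inductive K0Relator (k : Type u) [Field k] : MvPolynomial (Variety k) ℤ → Prop
  /-- isomorphic varieties have the same class -/
  | iso (X Y : Variety k) (e : X.toOver ≅ Y.toOver) :
      K0Relator k (MvPolynomial.X X - MvPolynomial.X Y)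
  /-- `[X] = [Z] + [U]` for a closed subscheme `Z` with open complement `U` -/
  | scissor (X Z U : Variety k) (i : Z.toOver ⟶ X.toOver) (j : U.toOver ⟶ X.toOver)
      (hi : IsClosedImmersion i.left) (hj : IsOpenImmersion j.left)
      (hij : IsCompl (Set.range i.left) (Set.range j.left)) :
      K0Relator k (MvPolynomial.X X - (MvPolynomial.X Z + MvPolynomial.X U))
  /-- `[X ×ₖ Y] = [X] [Y]` -/
  | prod (P X Y : Variety k) (p : P.toOver.left ⟶ X.toOver.left) (q : P.toOver.left ⟶ Y.toOver.left)
      (hp : p ≫ X.toOver.hom = P.toOver.hom) (hq : q ≫ Y.toOver.hom = P.toOver.hom)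
      (h : IsPullback p q X.toOver.hom Y.toOver.hom) :
      K0Relator k (MvPolynomial.X P - MvPolynomial.X X * MvPolynomial.X Y)
  /-- `[Spec k] = 1` -/
  | point (X : Variety k) (h : IsIso X.toOver.hom) :
      K0Relator k (MvPolynomial.X X - 1)

/-- The Grothendieck ring of varieties `K₀(Var_k)`, presented by generators and relations. -/
abbrev K0 (k : Type u) [Field k] : Type (u + 1) :=
  MvPolynomial (Variety k) ℤ ⧸ Ideal.span {r | K0Relator k r}

/-- The class `[X]` of a variety in `K₀(Var_k)`. -/
def Variety.cls {k : Type u} [Field k] (X : Variety k) : K0 k :=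
  Ideal.Quotient.mk _ (MvPolynomial.X X)

/-! ### The variety of ideals of colength `d` in a finite-dimensional algebra -/

section Ideals

attribute [local instance] MvPolynomial.gradedAlgebra

/-- Projective space over `k` with homogeneous coordinates indexed by `ι`. -/
abbrev projSpace (k : Type u) [Field k] (ι : Type) : Scheme.{u} :=
  Proj (MvPolynomial.homogeneousSubmodule ι k)

/-- The structure morphism of projective space. -/
def projSpaceHom (k : Type u) [Field k] (ι : Type) : projSpace k ι ⟶ Spec (CommRingCat.of k) :=
  Proj.toSpecZero (MvPolynomial.homogeneousSubmodule ι k) ≫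
    Spec.map (CommRingCat.ofHom (algebraMap k (MvPolynomial.homogeneousSubmodule ι k 0)))

lemma finiteType_zero (k : Type u) [Field k] (ι : Type) :
    (algebraMap k (MvPolynomial.homogeneousSubmodule ι k 0)).FiniteType := by
  refine RingHom.FiniteType.of_surjective _ ?_
  rintro ⟨p, hp⟩
  have hp' : p.IsHomogeneous 0 := hp
  obtain ⟨c, hc⟩ : ∃ c, p = MvPolynomial.C c :=
    ⟨_, MvPolynomial.totalDegree_eq_zero_iff_eq_C.mp (Nat.le_zero.mp hp'.totalDegree_le)⟩
  exact ⟨c, Subtype.ext hc.symm⟩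

instance (k : Type u) [Field k] (ι : Type) : IsSeparated (projSpaceHom k ι) := by
  unfold projSpaceHom; infer_instance

instance (k : Type u) [Field k] (ι : Type) [Finite ι] :
    Algebra.FiniteType (MvPolynomial.homogeneousSubmodule ι k 0) (MvPolynomial ι k) :=
  haveI : IsScalarTower k (MvPolynomial.homogeneousSubmodule ι k 0) (MvPolynomial ι k) :=
    ⟨fun a b c => smul_mul_assoc a (b : MvPolynomial ι k) c⟩
  Algebra.FiniteType.of_restrictScalars_finiteType k _ _

instance (k : Type u) [Field k] (ι : Type) [Finite ι] : QuasiCompact (projSpaceHom k ι) := by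
  unfold projSpaceHom; infer_instance

instance (k : Type u) [Field k] (ι : Type) [Finite ι] :
    LocallyOfFiniteType (projSpaceHom k ι) := by
  have : LocallyOfFiniteType
      (Spec.map (CommRingCat.ofHom (algebraMap k (MvPolynomial.homogeneousSubmodule ι k 0)))) := by
    rw [HasRingHomProperty.Spec_iff (P := @LocallyOfFiniteType)]
    exact finiteType_zero k ι
  unfold projSpaceHom; infer_instance

variable (k : Type u) [Field k] (A : Type u) [CommRing A] [Algebra k A] [Module.Finite k A]

/-- Indices of the Plücker coordinates of `d`-dimensional quotients of `A`. -/
abbrev PluckerIndex (d : ℕ) : Type := Fin d → Fin (Module.finrank k A)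

/-- The Plücker vectors of all ideals `J` of `A` with `dim A ⧸ J = d`: the coordinates, in a basis
of `A`, of the alternating `d`-forms on `A` that factor through `A ⧸ J`. For a given `J` these
forms are a line, which is the point of the quotient `A → A ⧸ J` in the Plücker embedding of the
Grassmannian of `d`-dimensional quotients of `A`. The set is thus the affine cone over the set of
ideals of colength `d`. -/
def pluckerCone (d : ℕ) : Set (PluckerIndex k A d → k) :=
  {p | ∃ J : Ideal A, Module.finrank k (A ⧸ J) = d ∧
    ∃ ω : A [⋀^Fin d]→ₗ[k] k, (∀ v : Fin d → A, (∃ i, v i ∈ J) → ω v = 0) ∧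
      p = fun σ => ω fun i => Module.finBasis k A (σ i)}

/-- The closed subset of projective space cut out by all polynomials that vanish on the Plücker
vectors of the ideals of colength `d`. -/
def idealLocus (d : ℕ) : TopologicalSpace.Closeds (projSpace k (PluckerIndex k A d)) :=
  ⟨ProjectiveSpectrum.zeroLocus (MvPolynomial.homogeneousSubmodule (PluckerIndex k A d) k)
      {F | ∀ p ∈ pluckerCone k A d, MvPolynomial.eval p F = 0},
    ProjectiveSpectrum.isClosed_zeroLocus _ _⟩

/-- The projective variety, with its reduced structure, that parametrizes the ideals of colength
`d` of the finite-dimensional algebra `A` over an algebraically closed field. -/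
def idealVariety (d : ℕ) : Variety k where
  toOver := Over.mk
    ((Scheme.IdealSheafData.vanishingIdeal (idealLocus k A d)).subschemeι ≫ projSpaceHom k _)
  locallyOfFiniteType := by dsimp; infer_instance
  quasiCompact := by dsimp; infer_instance
  isSeparated := by dsimp; infer_instance

end Ideals

/-! ### Punctual Hilbert schemes -/

section Germ

variable {k : Type u} [Field k] {X : Scheme.{u}} (f : X ⟶ Spec (CommRingCat.of k)) (x : X)

/-- The local ring `𝒪_{X,x}` of a `k`-scheme `f : X ⟶ Spec k`, as a `k`-algebra. -/
def LocalRingAt {k : Type u} [Field k] {X : Scheme.{u}} (_f : X ⟶ Spec (CommRingCat.of k))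
    (x : X) : Type u :=
  X.presheaf.stalk x

instance : CommRing (LocalRingAt f x) := inferInstanceAs (CommRing (X.presheaf.stalk x))

instance : IsLocalRing (LocalRingAt f x) := inferInstanceAs (IsLocalRing (X.presheaf.stalk x))

/-- The structure of `k`-algebra given by `Spec 𝒪_{X,x} ⟶ X ⟶ Spec k`. -/
instance : Algebra k (LocalRingAt f x) :=
  RingHom.toAlgebra (S := LocalRingAt f x) (Spec.preimage (X.fromSpecStalk x ≫ f)).hom

/-- The ring `𝒪_{X,x} ⧸ 𝔪 ^ d` of the `d`-th infinitesimal neighbourhood of `x`. -/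
abbrev Neighbourhood (d : ℕ) : Type u :=
  LocalRingAt f x ⧸ IsLocalRing.maximalIdeal (LocalRingAt f x) ^ d

lemma algebraMap_localRingAt_residue_surjective [IsAlgClosed k] [LocallyOfFiniteType f]
    (hx : IsClosed {x}) :
    Function.Surjective fun c : k =>
      IsLocalRing.residue (LocalRingAt f x) (algebraMap k (LocalRingAt f x) c) := by
  have h : (residueFieldIsoBase f x hx).inv =
      Spec.preimage (X.fromSpecStalk x ≫ f) ≫ X.residue x := by
    apply Spec.map_injective
    rw [SpecMap_residueFieldIsoBase_inv, Spec.map_comp, Spec.map_preimage, ← Category.assoc]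
    rfl
  have hs : Function.Surjective (residueFieldIsoBase f x hx).inv.hom :=
    ((ConcreteCategory.isIso_iff_bijective _).mp inferInstance).2
  rw [h] at hs
  exact hs

lemma finite_neighbourhood [IsAlgClosed k] [LocallyOfFiniteType f] (hx : IsClosed {x}) (d : ℕ) :
    Module.Finite k (Neighbourhood f x d) := by
  have : IsLocallyNoetherian X := LocallyOfFiniteType.isLocallyNoetherian f
  have : IsNoetherianRing (LocalRingAt f x) :=
    inferInstanceAs (IsNoetherianRing (X.presheaf.stalk x))
  set m := IsLocalRing.maximalIdeal (LocalRingAt f x) with hm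
  rcases Nat.eq_zero_or_pos d with rfl | hd
  · have : Subsingleton (Neighbourhood f x 0) :=
      Ideal.Quotient.subsingleton_iff.mpr (by simp [Ideal.one_eq_top])
    infer_instance
  have hfin : Module.Finite k (LocalRingAt f x ⧸ m) := by
    refine Module.Finite.of_surjective (Algebra.linearMap k (LocalRingAt f x ⧸ m)) ?_
    exact algebraMap_localRingAt_residue_surjective f x hx
  have hle : m ^ d ≤ m := Ideal.pow_le_self hd.ne'
  refine Module.finite_of_surjective_of_ker_le_nilradical
    (T := LocalRingAt f x ⧸ m) ((Ideal.Quotient.factorₐ k hle))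
    (Ideal.Quotient.factor_surjective hle) ?_ (IsNoetherian.noetherian _)
  intro y hy
  obtain ⟨y, rfl⟩ := Ideal.Quotient.mk_surjective y
  have hy' : y ∈ m := Ideal.Quotient.eq_zero_iff_mem.mp hy
  refine ⟨d, ?_⟩
  rw [← map_pow]
  exact Ideal.Quotient.eq_zero_iff_mem.mpr (Ideal.pow_mem_pow hy' d)

/-- The punctual Hilbert scheme `Hilb^d(X, x)` at a closed point `x`, with its reduced structure.
A closed subscheme of length `d` supported at `x` is given by an ideal of colength `d` of
`𝒪_{X,x}`; such an ideal contains `𝔪 ^ d`, so it is an ideal of colength `d` of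
`𝒪_{X,x} ⧸ 𝔪 ^ d`. -/
def punctualHilb [IsAlgClosed k] [LocallyOfFiniteType f] (hx : IsClosed {x}) (d : ℕ) :
    Variety k :=
  haveI := finite_neighbourhood f x hx d
  idealVariety k (Neighbourhood f x d) d

/-- The punctual Hilbert zeta function `∑ [Hilb^d(X, x)] t^d`. -/
def punctualHilbertZeta [IsAlgClosed k] [LocallyOfFiniteType f] (hx : IsClosed {x}) :
    PowerSeries (K0 k) :=
  PowerSeries.mk fun d => (punctualHilb f x hx d).cls

/-- The number of branches of `X` at `x`: the number of maximal ideals of the normalization of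
`𝒪_{X,x}` (its integral closure in its total ring of fractions), that is, of points of the
normalization of `X` over `x`. -/
def numBranches {X : Scheme.{u}} (x : X) : ℕ :=
  Nat.card (MaximalSpectrum
    (integralClosure (X.presheaf.stalk x) (FractionRing (X.presheaf.stalk x))))

end Germ

end HilbZeta

end

noncomputable section

namespace HilbZeta

/-! ### Classes of affine varieties -/

section AffineClass

variable (k : Type u) [Field k]

/-! Let `A` be the local ring at the point and `B` its normalization. `B` is finite over `A` and has
one maximal ideal per branch, each generated by a regular element `t i`. Every ideal `I` of finite
colength in `A` satisfies `I B = (t ^ a)` for a unique exponent `a`, so the ideals of colength `d`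
split into strata indexed by `a`. Some monomial `t ^ γ` lies in the conductor, and the `t i` can be
chosen with `t i - 1` divisible by the part of `t ^ γ` prime to `t i`. If `γ i ≤ a i` and `I` lies
in the stratum of `a`, then `(t i - 1) I ⊆ (t i - 1) t ^ a B ⊆ t ^ γ B ⊆ A`, so `t i I` is again an
ideal of `A`. Division by `t i` works in the same way, and the colength changes by one. Hence the
strata of `(a, d)` and `(a + e_i, d + 1)` correspond (`IsUniformizing.stratumCls_add_single`).

The inclusions `t ^ γ I B ⊆ I ⊆ I B` give `∑ a ≤ d + δ ≤ ∑ a + ∑ γ` with `δ` the length of `B / A`.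
Multiplying the zeta function by `1 - t` once per branch takes differences in all directions. Only
exponents `a ≤ γ` survive, and these meet finitely many `d` (`IsShiftArray.exists_polynomial`).

Equality of the classes of two corresponding strata needs more than a bijection of points.
Constructible sets are described by algebras of `k`-valued functions on sets of points. Adjoining
the pointwise inverse of `g`, with `0⁻¹ = 0`, cuts an affine variety into `V(g)` and `D(g)`. So the
class depends only on the closure of the algebra under inversion, and piecewise regular
correspondences preserve it (`HasCls.unique`, `HasCls.eq_of_bijection`). A projective variety has
the class of its set of normalized vectors (`hasCls_coneVariety`), and ideals form a closed cone in
Plücker coordinates (`isClosedCone_pluckerCone`). Plücker coordinates and spanning vectors determine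
each other by piecewise rational formulas. Therefore a correspondence `I' = L I` with a fixed
`k`-linear `L`, and a linear inverse, preserves classes (`HasCls.eq_of_linear`). Multiplication by
`t i`, followed by a linear retraction of `B` onto `A`, is such an `L`.

The structure of `B` rests on its finiteness over `A` (`finite_integralClosure_fractionRing`), on
normality, which makes maximal ideals principal (`IsNormalization.exists_mul_mem`), and on the
Chinese remainder theorem for the congruences (`IsNormalization.exists_isUniformizing`). -/

lemma cls_eq_of_iso {X Y : Variety k} (e : X.toOver ≅ Y.toOver) : X.cls = Y.cls :=
  Ideal.Quotient.eq.mpr (Ideal.subset_span (K0Relator.iso X Y e))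

lemma cls_eq_add {X Z U : Variety k} (i : Z.toOver ⟶ X.toOver) (j : U.toOver ⟶ X.toOver)
    (hi : IsClosedImmersion i.left) (hj : IsOpenImmersion j.left)
    (hij : IsCompl (Set.range i.left) (Set.range j.left)) : X.cls = Z.cls + U.cls := by
  rw [Variety.cls, Variety.cls, Variety.cls, ← map_add]
  exact Ideal.Quotient.eq.mpr (Ideal.subset_span (K0Relator.scissor X Z U i j hi hj hij))

/-- For empty `X` the identity is both a closed immersion and its open complement, so `[X] = [X] +
[X]`. -/
lemma cls_eq_zero_of_isEmpty {X : Variety k} (h : IsEmpty X.toOver.left) : X.cls = 0 := by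
  have := cls_eq_add k (𝟙 X.toOver) (𝟙 X.toOver)
    (by dsimp; infer_instance) (by dsimp; infer_instance)
    ⟨by rw [Set.range_eq_empty]; exact disjoint_bot_left,
      by rw [codisjoint_iff_le_sup]; intro x; exact h.elim x⟩
  simpa using this

/-- The spectrum of a finitely generated `k`-algebra as a variety. -/
def affVariety (S : Type u) [CommRing S] [Algebra k S] [Algebra.FiniteType k S] : Variety k where
  toOver := Over.mk (Spec.map (CommRingCat.ofHom (algebraMap k S)))
  locallyOfFiniteType := by
    dsimp
    rw [HasRingHomProperty.Spec_iff (P := @LocallyOfFiniteType)]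
    exact RingHom.finiteType_algebraMap.mpr inferInstance
  quasiCompact := by dsimp; infer_instance
  isSeparated := by dsimp; infer_instance

variable {k}

lemma affVariety_cls_congr {S T : Type u} [CommRing S] [Algebra k S] [Algebra.FiniteType k S]
    [CommRing T] [Algebra k T] [Algebra.FiniteType k T] (e : S ≃ₐ[k] T) :
    (affVariety k S).cls = (affVariety k T).cls := by
  refine cls_eq_of_iso k (Over.isoMk (Scheme.Spec.mapIso e.symm.toRingEquiv.toCommRingCatIso.op) ?_)
  dsimp [affVariety]
  rw [← Spec.map_comp]
  congr 1
  ext x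
  exact e.symm.commutes x

lemma affVariety_cls_of_subsingleton {S : Type u} [CommRing S] [Algebra k S]
    [Algebra.FiniteType k S] [Subsingleton S] : (affVariety k S).cls = 0 := by
  refine cls_eq_zero_of_isEmpty k ?_
  change IsEmpty (PrimeSpectrum S)
  infer_instance

/-- The class of `Spec S` is the sum of the classes of `V(g)` and `D(g)`. -/
lemma affVariety_cls_eq_add {S T U : Type u} [CommRing S] [Algebra k S] [Algebra.FiniteType k S]
    [CommRing T] [Algebra k T] [Algebra.FiniteType k T]
    [CommRing U] [Algebra k U] [Algebra.FiniteType k U] (g : S)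
    (φ : S →ₐ[k] T) (hφ : Function.Surjective φ) (hker : RingHom.ker φ = (Ideal.span {g}).radical)
    (ψ : S →ₐ[k] U) (hψ : @IsLocalization.Away S _ g U _ ψ.toRingHom.toAlgebra) :
    (affVariety k S).cls = (affVariety k T).cls + (affVariety k U).cls := by
  refine cls_eq_add k
    (Over.homMk (U := (affVariety k T).toOver) (V := (affVariety k S).toOver)
      (Spec.map (CommRingCat.ofHom φ.toRingHom)) ?_)
    (Over.homMk (U := (affVariety k U).toOver) (V := (affVariety k S).toOver)
      (Spec.map (CommRingCat.ofHom ψ.toRingHom)) ?_) ?_ ?_ ?_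
  · dsimp [affVariety]
    rw [← Spec.map_comp]; congr 1; ext x; simp
  · dsimp [affVariety]
    rw [← Spec.map_comp]; congr 1; ext x; simp
  · exact IsClosedImmersion.spec_of_surjective _ hφ
  · let := ψ.toRingHom.toAlgebra
    exact IsOpenImmersion.of_isLocalization g
  · let := ψ.toRingHom.toAlgebra
    have h1 : Set.range (PrimeSpectrum.comap φ.toRingHom) = PrimeSpectrum.zeroLocus {g} := by
      rw [range_comap_of_surjective _ _ hφ]
      change PrimeSpectrum.zeroLocus (RingHom.ker φ : Set S) = _
      rw [hker, PrimeSpectrum.zeroLocus_radical, PrimeSpectrum.zeroLocus_span]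
    have h2 : Set.range (PrimeSpectrum.comap ψ.toRingHom) = PrimeSpectrum.basicOpen g :=
      PrimeSpectrum.localization_away_comap_range U g
    change IsCompl (Set.range (PrimeSpectrum.comap φ.toRingHom))
      (Set.range (PrimeSpectrum.comap ψ.toRingHom))
    rw [h1, h2, PrimeSpectrum.basicOpen_eq_zeroLocus_compl]
    exact isCompl_compl

end AffineClass

/-! ### Algebras of functions closed under pointwise inversion -/

section Functions

variable {k : Type u} [Field k] {Ω : Type u}

/-- Pullback of `k`-valued functions. -/
def pull {Ω Ω' : Type u} (i : Ω' → Ω) : (Ω → k) →ₐ[k] (Ω' → k) :=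
  AlgHom.pi fun x => Pi.evalAlgHom k _ (i x)

/-- The indicator function of a set. -/
def charFn (k : Type u) [Field k] (P : Set Ω) : Ω → k := P.indicator 1

lemma charFn_of_mem {P : Set Ω} {x : Ω} (h : x ∈ P) : charFn k P x = 1 := by simp [charFn, h]

lemma charFn_of_notMem {P : Set Ω} {x : Ω} (h : x ∉ P) : charFn k P x = 0 := by simp [charFn, h]

lemma charFn_inv (P : Set Ω) : (charFn k P)⁻¹ = charFn k P := by
  ext x; by_cases h : x ∈ P <;> simp [charFn, h]

lemma charFn_inter (P Q : Set Ω) : charFn k (P ∩ Q) = charFn k P * charFn k Q := by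
  ext x; by_cases h : x ∈ P <;> by_cases h' : x ∈ Q <;> simp [charFn, h, h']

lemma charFn_compl (P : Set Ω) : charFn k Pᶜ = 1 - charFn k P := by
  ext x; by_cases h : x ∈ P <;> simp [charFn, h]

lemma charFn_ne_zero (g : Ω → k) : charFn k {x | g x ≠ 0} = g * g⁻¹ := by
  ext x; by_cases h : g x = 0 <;> simp [charFn, h]

lemma charFn_eq_zero (g : Ω → k) : charFn k {x | g x = 0} = 1 - g * g⁻¹ := by
  ext x; by_cases h : g x = 0 <;> simp [charFn, h]

/-- The smallest subalgebra that contains `R` and is closed under pointwise inversion, with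
`0⁻¹ = 0`. -/
def invClosure (R : Subalgebra k (Ω → k)) : Subalgebra k (Ω → k) :=
  sInf {T | R ≤ T ∧ ∀ f ∈ T, f⁻¹ ∈ T}

lemma le_invClosure (R : Subalgebra k (Ω → k)) : R ≤ invClosure R :=
  le_sInf fun _ h => h.1

lemma inv_mem_invClosure {R : Subalgebra k (Ω → k)} {f : Ω → k} (hf : f ∈ invClosure R) :
    f⁻¹ ∈ invClosure R := by
  rw [invClosure, Algebra.mem_sInf] at hf ⊢
  exact fun T hT => hT.2 _ (hf T hT)

lemma invClosure_le {R T : Subalgebra k (Ω → k)} (h : R ≤ T) (hinv : ∀ f ∈ T, f⁻¹ ∈ T) :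
    invClosure R ≤ T :=
  sInf_le ⟨h, hinv⟩

/-- Adjoining inverses of functions, one after the other. -/
def Ext : Subalgebra k (Ω → k) → Subalgebra k (Ω → k) → Prop :=
  Relation.ReflTransGen fun R R' => ∃ g ∈ R, R' = R ⊔ Algebra.adjoin k {g⁻¹}

lemma Ext.le {R R' : Subalgebra k (Ω → k)} (h : Ext R R') : R ≤ R' := by
  induction h with
  | refl => exact le_rfl
  | tail _ h ih => obtain ⟨g, -, rfl⟩ := h; exact ih.trans le_sup_left

lemma Ext.sup {R R' : Subalgebra k (Ω → k)} (h : Ext R R') (S : Subalgebra k (Ω → k)) :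
    Ext (R ⊔ S) (R' ⊔ S) := by
  induction h with
  | refl => exact .refl
  | tail _ h ih =>
    obtain ⟨g, hg, rfl⟩ := h
    exact ih.tail ⟨g, Algebra.mem_sup_left hg, by rw [sup_right_comm]⟩

/-- The inverses adjoined to reach `R₂` can equally be adjoined to `R₁`. Any two extensions thus
have a common one, as needed for common refinements. -/
lemma Ext.sup_of_ext {R R₁ R₂ : Subalgebra k (Ω → k)} (h₁ : Ext R R₁) (h₂ : Ext R R₂) :
    Ext R₁ (R₁ ⊔ R₂) := by
  have := h₂.sup R₁
  rwa [sup_eq_right.mpr h₁.le, sup_comm] at this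

lemma Ext.step {R : Subalgebra k (Ω → k)} {g : Ω → k} (hg : g ∈ R) :
    Ext R (R ⊔ Algebra.adjoin k {g⁻¹}) := .single ⟨g, hg, rfl⟩

/-- The functions reached after finitely many steps form a subalgebra closed under inversion,
because two towers of steps have a common extension. -/
lemma exists_ext_of_mem {R : Subalgebra k (Ω → k)} {f : Ω → k} (hf : f ∈ invClosure R) :
    ∃ R', Ext R R' ∧ f ∈ R' := by
  let T : Subalgebra k (Ω → k) :=
    { carrier := {f | ∃ R', Ext R R' ∧ f ∈ R'}
      mul_mem' := by
        rintro a b ⟨R₁, h₁, ha⟩ ⟨R₂, h₂, hb⟩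
        exact ⟨R₁ ⊔ R₂, h₁.trans (h₁.sup_of_ext h₂),
          mul_mem (le_sup_left (a := R₁) ha) (le_sup_right (b := R₂) hb)⟩
      add_mem' := by
        rintro a b ⟨R₁, h₁, ha⟩ ⟨R₂, h₂, hb⟩
        exact ⟨R₁ ⊔ R₂, h₁.trans (h₁.sup_of_ext h₂),
          add_mem (le_sup_left (a := R₁) ha) (le_sup_right (b := R₂) hb)⟩
      algebraMap_mem' := fun c => ⟨R, .refl, R.algebraMap_mem c⟩ }
  refine invClosure_le (T := T) (fun f hf => ⟨R, .refl, hf⟩) ?_ hf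
  rintro f ⟨R', h, hf⟩
  exact ⟨_, h.trans (Ext.step hf), le_sup_right (b := Algebra.adjoin k {f⁻¹})
    (Algebra.self_mem_adjoin_singleton k _)⟩

lemma exists_ext_of_fg {R S : Subalgebra k (Ω → k)} (hS : S.FG) (h : S ≤ invClosure R) :
    ∃ R', Ext R R' ∧ S ≤ R' := by
  obtain ⟨t, rfl⟩ := hS
  rw [Algebra.adjoin_le_iff] at h
  suffices ∃ R', Ext R R' ∧ (t : Set (Ω → k)) ⊆ R' by
    obtain ⟨R', h, h'⟩ := this
    exact ⟨R', h, Algebra.adjoin_le h'⟩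
  classical
  induction t using Finset.induction_on with
  | empty => exact ⟨R, .refl, by simp⟩
  | insert a t _ ih =>
    rw [Finset.coe_insert, Set.insert_subset_iff] at h
    obtain ⟨R₁, h₁, h₁'⟩ := exists_ext_of_mem h.1
    obtain ⟨R₂, h₂, h₂'⟩ := ih h.2
    refine ⟨R₁ ⊔ R₂, h₁.trans (h₁.sup_of_ext h₂), ?_⟩
    rw [Finset.coe_insert, Set.insert_subset_iff]
    exact ⟨le_sup_left (a := R₁) h₁', h₂'.trans (le_sup_right (b := R₂))⟩

lemma pull_inv {Ω' : Type u} (i : Ω' → Ω) (f : Ω → k) : pull i f⁻¹ = (pull i f)⁻¹ := rfl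

lemma Ext.map_pull {Ω' : Type u} (i : Ω' → Ω) {R R' : Subalgebra k (Ω → k)} (h : Ext R R') :
    Ext (R.map (pull i)) (R'.map (pull i)) := by
  induction h with
  | refl => exact .refl
  | tail _ h ih =>
    obtain ⟨g, hg, rfl⟩ := h
    refine ih.tail ⟨pull i g, ⟨g, hg, rfl⟩, ?_⟩
    rw [Algebra.map_sup, AlgHom.map_adjoin, Set.image_singleton, pull_inv]

end Functions

/-! ### Affine structures on sets and classes of constructible sets -/

/-- A maximal ideal of a finitely generated algebra over an algebraically closed field is the
kernel of a `k`-point. -/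
lemma exists_algHom_of_isMaximal {k : Type*} [Field k] [IsAlgClosed k] {S : Type*} [CommRing S]
    [Algebra k S] [Algebra.FiniteType k S] (M : Ideal S) (hM : M.IsMaximal) :
    ∃ χ : S →ₐ[k] k, ∀ f, f ∈ M ↔ χ f = 0 := by
  let := Ideal.Quotient.field M
  have : Module.Finite k (S ⧸ M) := finite_of_finite_type_of_isJacobsonRing k _
  have hbij : Function.Bijective (algebraMap k (S ⧸ M)) :=
    IsAlgClosed.algebraMap_bijective_of_isIntegral
  let e : k ≃ₐ[k] (S ⧸ M) := AlgEquiv.ofBijective (Algebra.ofId _ _) hbij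
  refine ⟨e.symm.toAlgHom.comp (Ideal.Quotient.mkₐ k M), fun f => ?_⟩
  rw [← Ideal.Quotient.eq_zero_iff_mem]
  exact (map_eq_zero_iff e.symm e.symm.injective).symm

/-! ### Affine pieces of a set of points, and how they are cut by a function -/

section AffinePieces

variable {k : Type u} [Field k] {Ω : Type u}

/-- The algebra of functions on `P` that are restrictions of functions in `R`. -/
abbrev restr (P : Set Ω) (R : Subalgebra k (Ω → k)) : Subalgebra k (P → k) :=
  R.map (pull (Subtype.val : P → Ω))

/-- `R` restricts to the coordinate ring of an affine variety with set of points `P`. -/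
structure IsAff (P : Set Ω) (R : Subalgebra k (Ω → k)) : Prop where
  fg : (restr P R).FG
  exists_point : ∀ χ : restr P R →ₐ[k] k, ∃ p : P, ∀ f, χ f = f.1 p

open Classical in
/-- The class of the spectrum of an algebra of functions. -/
def algCls (S : Subalgebra k (Ω → k)) : K0 k :=
  if h : S.FG then
    haveI : Algebra.FiniteType k S := ⟨(Subalgebra.fg_top S).mpr h⟩
    (affVariety k S).cls
  else 0

/-- The class of the affine variety with set of points `P` and coordinate ring `R|_P`. -/
def affCls (P : Set Ω) (R : Subalgebra k (Ω → k)) : K0 k := algCls (restr P R)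

lemma finiteType_of_fg {S : Subalgebra k (Ω → k)} (h : S.FG) : Algebra.FiniteType k S :=
  ⟨(Subalgebra.fg_top S).mpr h⟩

lemma algCls_eq {S : Subalgebra k (Ω → k)} (h : S.FG) :
    algCls S = (haveI := finiteType_of_fg h; (affVariety k S).cls) := dif_pos h

lemma algCls_congr {Ω' : Type u} {S : Subalgebra k (Ω → k)} {S' : Subalgebra k (Ω' → k)}
    (h : S.FG) (h' : S'.FG) (e : S ≃ₐ[k] S') : algCls S = algCls S' := by
  have := finiteType_of_fg h
  have := finiteType_of_fg h'
  rw [algCls_eq h, algCls_eq h']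
  exact affVariety_cls_congr e

lemma affCls_empty (R : Subalgebra k (Ω → k)) : affCls ∅ R = 0 := by
  have : Subsingleton (restr ∅ R) := inferInstance
  have h : (restr ∅ R).FG := ⟨∅, Subsingleton.elim _ _⟩
  have := finiteType_of_fg h
  rw [affCls, algCls_eq h]
  exact affVariety_cls_of_subsingleton

/-- Restriction to a smaller set, into a larger algebra. -/
def restrHom {P Q : Set Ω} (hPQ : P ⊆ Q) {R R' : Subalgebra k (Ω → k)} (hR : R ≤ R') :
    restr Q R →ₐ[k] restr P R' :=
  ((pull (Set.inclusion hPQ)).comp (restr Q R).val).codRestrict _ (by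
    rintro ⟨_, f, hf, rfl⟩
    exact ⟨f, hR hf, rfl⟩)

/-- The restriction of an element of `R` to `P`. -/
def restrMk (P : Set Ω) {R : Subalgebra k (Ω → k)} {g : Ω → k} (hg : g ∈ R) : restr P R :=
  ⟨pull Subtype.val g, g, hg, rfl⟩

variable {P : Set Ω} {R : Subalgebra k (Ω → k)} {g : Ω → k}

/-- Where `g ≠ 0` the pointwise inverse is a true inverse, so denominators can be cleared by powers
of `g`. This makes the algebra on `D(g)` a localization. -/
lemma exists_pow_mul_eq (hg : g ∈ R) {f : Ω → k} (hf : f ∈ R ⊔ Algebra.adjoin k {g⁻¹}) :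
    ∃ n : ℕ, ∃ r ∈ R, ∀ x, g x ≠ 0 → g x ^ n * f x = r x := by
  rw [← Algebra.adjoin_eq R, ← Algebra.adjoin_union] at hf
  induction hf using Algebra.adjoin_induction with
  | mem f hf =>
    rcases hf with hf | hf
    · exact ⟨0, f, hf, fun x _ => by simp⟩
    · obtain rfl : f = g⁻¹ := hf
      exact ⟨1, 1, one_mem R, fun x hx => by simp [hx]⟩
  | algebraMap c => exact ⟨0, _, R.algebraMap_mem c, fun x _ => by simp⟩
  | add a b _ _ ha hb =>
    obtain ⟨n, r, hr, h⟩ := ha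
    obtain ⟨n', r', hr', h'⟩ := hb
    refine ⟨n + n', g ^ n' * r + g ^ n * r',
      add_mem (mul_mem (pow_mem hg _) hr) (mul_mem (pow_mem hg _) hr'), fun x hx => ?_⟩
    simp only [Pi.add_apply, Pi.mul_apply, Pi.pow_apply, ← h x hx, ← h' x hx]
    ring
  | mul a b _ _ ha hb =>
    obtain ⟨n, r, hr, h⟩ := ha
    obtain ⟨n', r', hr', h'⟩ := hb
    refine ⟨n + n', r * r', mul_mem hr hr', fun x hx => ?_⟩
    simp only [Pi.mul_apply, ← h x hx, ← h' x hx]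
    ring

/-- By the convention `0⁻¹ = 0` the new generator vanishes on `V(g)`, so adjoining it adds no
function there. -/
lemma exists_eq_on_zero {f : Ω → k} (hf : f ∈ R ⊔ Algebra.adjoin k {g⁻¹}) :
    ∃ r ∈ R, ∀ x, g x = 0 → f x = r x := by
  rw [← Algebra.adjoin_eq R, ← Algebra.adjoin_union] at hf
  induction hf using Algebra.adjoin_induction with
  | mem f hf =>
    rcases hf with hf | hf
    · exact ⟨f, hf, fun x _ => rfl⟩
    · obtain rfl : f = g⁻¹ := hf
      exact ⟨0, zero_mem R, fun x hx => by simp [hx]⟩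
  | algebraMap c => exact ⟨_, R.algebraMap_mem c, fun x _ => rfl⟩
  | add a b _ _ ha hb =>
    obtain ⟨r, hr, h⟩ := ha
    obtain ⟨r', hr', h'⟩ := hb
    exact ⟨r + r', add_mem hr hr', fun x hx => by simp [h x hx, h' x hx]⟩
  | mul a b _ _ ha hb =>
    obtain ⟨r, hr, h⟩ := ha
    obtain ⟨r', hr', h'⟩ := hb
    exact ⟨r * r', mul_mem hr hr', fun x hx => by simp [h x hx, h' x hx]⟩

lemma restrHom_zero_surjective :
    Function.Surjective (restrHom (P := P ∩ {x | g x = 0}) (Q := P) Set.inter_subset_left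
      (le_sup_left : R ≤ R ⊔ Algebra.adjoin k {g⁻¹})) := by
  rintro ⟨_, f, hf, rfl⟩
  obtain ⟨r, hr, h⟩ := exists_eq_on_zero hf
  exact ⟨restrMk P hr, Subtype.ext (funext fun x => (h x.1 x.2.2).symm)⟩

/-- A character of the restricted algebra pulls back to a character of `R|_P`, hence to evaluation
at a point of `P`. It kills `g`, so this point lies in `V(g)`. -/
lemma IsAff.inter_zero (h : IsAff P R) (hg : g ∈ R) :
    IsAff (P ∩ {x | g x = 0}) (R ⊔ Algebra.adjoin k {g⁻¹}) := by
  have hsurj := restrHom_zero_surjective (P := P) (R := R) (g := g)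
  refine ⟨?_, fun χ => ?_⟩
  · have := finiteType_of_fg h.fg
    exact (Subalgebra.fg_top _).mp (Algebra.FiniteType.of_surjective _ hsurj).out
  · obtain ⟨p, hp⟩ := h.exists_point (χ.comp (restrHom Set.inter_subset_left le_sup_left))
    have hp0 : g p.1 = 0 := by
      refine (hp (restrMk P hg)).symm.trans ?_
      rw [AlgHom.comp_apply]
      convert map_zero χ
      exact Subtype.ext (funext fun x => x.2.2)
    refine ⟨⟨p.1, p.2, hp0⟩, fun f => ?_⟩
    obtain ⟨f, rfl⟩ := hsurj f
    exact hp f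

/-- A character pulls back to evaluation at a point of `P`, where `g` cannot vanish because it has
become a unit. Clearing denominators then gives the value on every function. -/
lemma IsAff.inter_ne_zero (h : IsAff P R) (hg : g ∈ R) :
    IsAff (P ∩ {x | g x ≠ 0}) (R ⊔ Algebra.adjoin k {g⁻¹}) := by
  refine ⟨?_, fun χ => ?_⟩
  · have := (h.fg.map (pull (Set.inclusion (Set.inter_subset_left (s := P) (t := {x | g x ≠ 0})))))
    rw [restr, Algebra.map_sup, AlgHom.map_adjoin, Set.image_singleton]
    refine Subalgebra.FG.sup ?_ ⟨{pull Subtype.val g⁻¹}, by simp⟩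
    rwa [Subalgebra.map_map] at this
  · set ψ := restrHom (P := P ∩ {x | g x ≠ 0}) (Q := P) Set.inter_subset_left
      (le_sup_left : R ≤ R ⊔ Algebra.adjoin k {g⁻¹}) with hψ
    obtain ⟨p, hp⟩ := h.exists_point (χ.comp ψ)
    have hinv : ψ (restrMk P hg) * restrMk _ (Algebra.mem_sup_right
        (Algebra.self_mem_adjoin_singleton k g⁻¹)) = 1 :=
      Subtype.ext (funext fun x => mul_inv_cancel₀ x.2.2)
    have hp0 : g p.1 ≠ 0 := by
      intro h0
      have h1 := congrArg χ hinv
      rw [map_mul, map_one, ← AlgHom.comp_apply χ ψ, hp] at h1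
      change g p.1 * _ = 1 at h1
      simp [h0] at h1
    refine ⟨⟨p.1, p.2, hp0⟩, ?_⟩
    rintro ⟨_, f, hf, rfl⟩
    obtain ⟨n, r, hr, hfr⟩ := exists_pow_mul_eq hg hf
    have h1 : ψ (restrMk P hg) ^ n * restrMk _ hf = ψ (restrMk P hr) :=
      Subtype.ext (funext fun x => hfr x.1 x.2.2)
    have h2 := congrArg χ h1
    rw [map_mul, map_pow, ← AlgHom.comp_apply χ ψ, ← AlgHom.comp_apply χ ψ, hp, hp] at h2
    change g p.1 ^ n * χ (restrMk _ hf) = r p.1 at h2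
    rw [← hfr p.1 hp0] at h2
    exact mul_left_cancel₀ (pow_ne_zero n hp0) h2

/-- This is the Nullstellensatz: `R|_P` is a Jacobson ring, and by `IsAff` its maximal ideals are
the points of `P`. The radical is needed because functions see only the reduced structure of `V(g)`.
-/
lemma ker_restrHom_zero [IsAlgClosed k] (h : IsAff P R) (hg : g ∈ R) :
    RingHom.ker (restrHom (P := P ∩ {x | g x = 0}) (Q := P) Set.inter_subset_left
      (le_sup_left : R ≤ R ⊔ Algebra.adjoin k {g⁻¹})) =
    (Ideal.span {restrMk P hg}).radical := by
  have := finiteType_of_fg h.fg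
  have : IsJacobsonRing (restr P R) := isJacobsonRing_of_finiteType (A := k)
  refine le_antisymm ?_ ?_
  · intro f hf
    rw [Ideal.radical_eq_jacobson, Ideal.mem_jacobson_iff, ← Ideal.mem_jacobson_iff,
      Ideal.jacobson, Ideal.mem_sInf]
    rintro M ⟨hM, hmax⟩
    obtain ⟨χ, hχ⟩ := exists_algHom_of_isMaximal (k := k) M hmax
    obtain ⟨p, hp⟩ := h.exists_point χ
    have key : ∀ f, f ∈ M ↔ f.1 p = 0 := fun f => by rw [← hp, hχ]
    have hgp : g p.1 = 0 := (key (restrMk P hg)).mp (hM (Ideal.mem_span_singleton_self _))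
    rw [key]
    exact congrFun (congrArg Subtype.val hf) ⟨p.1, p.2, hgp⟩
  · rintro f ⟨n, hn⟩
    obtain ⟨r, hr⟩ := Ideal.mem_span_singleton'.mp hn
    refine Subtype.ext (funext fun x => ?_)
    have := congrFun (congrArg Subtype.val hr) ⟨x.1, x.2.1⟩
    change r.1 _ * g x.1 = f.1 _ ^ n at this
    rw [x.2.2, mul_zero] at this
    exact eq_zero_of_pow_eq_zero this.symm

/-- Cutting an affine piece along a function. -/
lemma affCls_cut [IsAlgClosed k] (h : IsAff P R) (hg : g ∈ R) :
    affCls P R = affCls (P ∩ {x | g x = 0}) (R ⊔ Algebra.adjoin k {g⁻¹}) +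
      affCls (P ∩ {x | g x ≠ 0}) (R ⊔ Algebra.adjoin k {g⁻¹}) := by
  have h0 := h.inter_zero hg
  have h1 := h.inter_ne_zero hg
  have := finiteType_of_fg h.fg
  have := finiteType_of_fg h0.fg
  have := finiteType_of_fg h1.fg
  rw [affCls, affCls, affCls, algCls_eq h.fg, algCls_eq h0.fg, algCls_eq h1.fg]
  refine affVariety_cls_eq_add (restrMk P hg) _ (restrHom_zero_surjective)
    (ker_restrHom_zero h hg) (restrHom Set.inter_subset_left le_sup_left) ?_
  let ψ := restrHom (P := P ∩ {x | g x ≠ 0}) (Q := P) Set.inter_subset_left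
      (le_sup_left : R ≤ R ⊔ Algebra.adjoin k {g⁻¹})
  let := ψ.toRingHom.toAlgebra
  have hinv : ψ (restrMk P hg) * restrMk _ (Algebra.mem_sup_right
        (Algebra.self_mem_adjoin_singleton k g⁻¹)) = 1 :=
      Subtype.ext (funext fun x => mul_inv_cancel₀ x.2.2)
  refine IsLocalization.Away.mk (restrMk P hg) (IsUnit.of_mul_eq_one _ hinv) ?_ ?_
  · rintro ⟨_, f, hf, rfl⟩
    obtain ⟨n, r, hr, hfr⟩ := exists_pow_mul_eq hg hf
    exact ⟨n, restrMk P hr, Subtype.ext (funext fun x => (mul_comm _ _).trans (hfr x.1 x.2.2))⟩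
  -- The first power of `g` suffices: `g a` and `g b` agree on `D(g)` by assumption and both vanish
  -- on `V(g)`.
  · intro a b hab
    refine ⟨1, Subtype.ext (funext fun x => ?_)⟩
    change g x.1 ^ 1 * a.1 x = g x.1 ^ 1 * b.1 x
    by_cases hx : g x.1 = 0
    · simp [hx]
    · congr 1
      exact congrFun (congrArg Subtype.val hab) ⟨x.1, x.2, hx⟩

end AffinePieces

/-! ### Finite affine decompositions and the class of a constructible set -/

section Decompositions

variable {k : Type u} [Field k] {Ω : Type u}

/-- `Decomp R Q m`: the set `Q` is a finite disjoint union of affine pieces for `R`, with indicator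
functions in `R`, whose classes add up to `m`. -/
inductive Decomp (R : Subalgebra k (Ω → k)) : Set Ω → K0 k → Prop
  | empty : Decomp R ∅ 0
  | union {P Q : Set Ω} {m : K0 k} : IsAff P R → charFn k P ∈ R → Disjoint P Q → Decomp R Q m →
      Decomp R (P ∪ Q) (affCls P R + m)

variable {R R' : Subalgebra k (Ω → k)} {P Q : Set Ω} {m m' : K0 k}

lemma Decomp.of_isAff (h : IsAff P R) (hP : charFn k P ∈ R) : Decomp R P (affCls P R) := by
  simpa using Decomp.union h hP (Set.disjoint_empty P) .empty

lemma Decomp.add (h : Decomp R P m) (h' : Decomp R Q m') (hd : Disjoint P Q) :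
    Decomp R (P ∪ Q) (m + m') := by
  induction h with
  | empty => simpa using h'
  | union h1 h2 h3 _ ih =>
    rw [Set.disjoint_union_left] at hd
    rw [Set.union_assoc, add_assoc]
    exact .union h1 h2 (Set.disjoint_union_right.mpr ⟨h3, hd.1⟩) (ih hd.2)

lemma inter_union_inter_ne (P : Set Ω) (g : Ω → k) :
    P ∩ {x | g x = 0} ∪ P ∩ {x | g x ≠ 0} = P := by
  rw [← Set.inter_union_distrib_left]
  refine Set.inter_eq_left.mpr fun x _ => ?_
  exact em (g x = 0)

lemma disjoint_inter_inter_ne (P : Set Ω) (g : Ω → k) :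
    Disjoint (P ∩ {x | g x = 0}) (P ∩ {x | g x ≠ 0}) :=
  Set.disjoint_left.mpr fun _ h h' => h'.2 h.2

/-- Each adjoined inverse `g⁻¹` cuts the piece into two affine pieces whose classes add up to the
old one. Their indicators are products with `g * g⁻¹` or `1 - g * g⁻¹`, which lie in the final
algebra. -/
lemma Decomp.of_isAff_of_ext [IsAlgClosed k] (h : IsAff P R) (hR : Ext R R') (hP : charFn k P ∈ R') :
    Decomp R' P (affCls P R) := by
  induction hR using Relation.ReflTransGen.head_induction_on generalizing P with
  | refl => exact .of_isAff h hP
  | head hs hR ih =>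
    obtain ⟨g, hg, rfl⟩ := hs
    have hR := Ext.le hR
    have hg1 : g ∈ R' := hR (Algebra.mem_sup_left hg)
    have hg2 : g⁻¹ ∈ R' := hR (Algebra.mem_sup_right (Algebra.self_mem_adjoin_singleton k _))
    have h0 := ih (h.inter_zero hg) (by
      rw [charFn_inter, charFn_eq_zero]
      exact mul_mem hP (sub_mem (one_mem _) (mul_mem hg1 hg2)))
    have h1 := ih (h.inter_ne_zero hg) (by
      rw [charFn_inter, charFn_ne_zero]
      exact mul_mem hP (mul_mem hg1 hg2))
    have := h0.add h1 (disjoint_inter_inter_ne P g)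
    rwa [inter_union_inter_ne, ← affCls_cut h hg] at this

lemma Decomp.ext [IsAlgClosed k] (h : Decomp R Q m) (hR : Ext R R') : Decomp R' Q m := by
  induction h with
  | empty => exact .empty
  | union h1 h2 h3 _ ih => exact (Decomp.of_isAff_of_ext h1 hR (hR.le h2)).add ih h3

/-- An indicator is its own pointwise inverse, so cutting along it leaves the algebra unchanged. The
next lemmas use this to refine decompositions inside a fixed algebra. -/
lemma sup_adjoin_charFn {T : Set Ω} (hT : charFn k T ∈ R) :
    R ⊔ Algebra.adjoin k {(charFn k T)⁻¹} = R := by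
  rw [charFn_inv, sup_eq_left]
  exact Algebra.adjoin_le (by simpa using hT)

lemma IsAff.inter_of_charFn (h : IsAff P R) {T : Set Ω} (hT : charFn k T ∈ R) :
    IsAff (P ∩ T) R := by
  have := h.inter_ne_zero hT
  rw [sup_adjoin_charFn hT] at this
  convert this using 2
  ext x; by_cases h : x ∈ T <;> simp [charFn, h]

lemma IsAff.diff_of_charFn (h : IsAff P R) {T : Set Ω} (hT : charFn k T ∈ R) :
    IsAff (P \ T) R := by
  have := h.inter_zero hT
  rw [sup_adjoin_charFn hT] at this
  convert this using 1
  ext x; by_cases h : x ∈ T <;> simp [charFn, h]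

lemma affCls_cut_charFn [IsAlgClosed k] (h : IsAff P R) {T : Set Ω} (hT : charFn k T ∈ R) :
    affCls P R = affCls (P ∩ T) R + affCls (P \ T) R := by
  have := affCls_cut h hT
  rw [sup_adjoin_charFn hT] at this
  rw [this, add_comm]
  congr 2 <;> ext x <;> by_cases h : x ∈ T <;> simp [charFn, h]

lemma charFn_diff_mem {T : Set Ω} (hP : charFn k P ∈ R) (hT : charFn k T ∈ R) :
    charFn k (P \ T) ∈ R := by
  rw [Set.sdiff_eq, charFn_inter, charFn_compl]
  exact mul_mem hP (sub_mem (one_mem R) hT)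

lemma charFn_inter_mem {T : Set Ω} (hP : charFn k P ∈ R) (hT : charFn k T ∈ R) :
    charFn k (P ∩ T) ∈ R := by
  rw [charFn_inter]
  exact mul_mem hP hT

lemma Decomp.split [IsAlgClosed k] (h : Decomp R Q m) {T : Set Ω} (hT : charFn k T ∈ R) :
    ∃ m₁ m₂, Decomp R (Q ∩ T) m₁ ∧ Decomp R (Q \ T) m₂ ∧ m = m₁ + m₂ := by
  induction h with
  | empty => exact ⟨0, 0, by simpa using .empty, by simpa using .empty, by simp⟩
  | @union P' Q' m h1 h2 h3 _ ih =>
    obtain ⟨m₁, m₂, ih1, ih2, rfl⟩ := ih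
    refine ⟨affCls (P' ∩ T) R + m₁, affCls (P' \ T) R + m₂, ?_, ?_, ?_⟩
    · rw [Set.union_inter_distrib_right]
      exact .union (h1.inter_of_charFn hT) (charFn_inter_mem h2 hT)
        (h3.mono Set.inter_subset_left Set.inter_subset_left) ih1
    · rw [Set.union_sdiff_distrib]
      exact .union (h1.diff_of_charFn hT) (charFn_diff_mem h2 hT)
        (h3.mono Set.sdiff_subset Set.sdiff_subset) ih2
    · rw [affCls_cut_charFn h1 hT, add_add_add_comm]

lemma Decomp.eq_affCls [IsAlgClosed k] (h : Decomp R P m) (hP : IsAff P R) : m = affCls P R := by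
  induction h with
  | empty => rw [affCls_empty]
  | @union P' Q' m h1 h2 h3 _ ih =>
    have h4 : (P' ∪ Q') \ P' = Q' := by
      rw [Set.union_sdiff_left]; exact h3.symm.sdiff_eq_left
    have h5 := hP.diff_of_charFn h2
    rw [affCls_cut_charFn hP h2, h4, Set.union_inter_cancel_left]
    rw [h4] at h5
    rw [ih h5]

/-- The indicators of the pieces of the first decomposition lie in `R`, so the second one can be
split along them. Each part of the refinement is then compared with a single affine piece. -/
lemma Decomp.unique [IsAlgClosed k] (h : Decomp R Q m) (h' : Decomp R Q m') : m = m' := by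
  induction h generalizing m' with
  | empty =>
    -- The zero ring has no characters to `k`, so the condition on points is vacuous.
    have h0 : IsAff (∅ : Set Ω) R := by
      have : Subsingleton (restr ∅ R) := inferInstance
      refine ⟨⟨∅, Subsingleton.elim _ _⟩, fun χ => ?_⟩
      have := congrArg χ (Subsingleton.elim (0 : restr ∅ R) 1)
      simp at this
    rw [h'.eq_affCls h0, affCls_empty]
  | @union P' Q' m h1 h2 h3 _ ih =>
    obtain ⟨m₁, m₂, h4, h5, rfl⟩ := h'.split h2
    rw [Set.union_inter_cancel_left] at h4
    rw [Set.union_sdiff_left, h3.symm.sdiff_eq_left] at h5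
    rw [ih h5, h4.eq_affCls h1]

/-- `HasCls R Q m`: the set `Q`, which is constructible for the structure defined by `R`, has the
class `m` in the Grothendieck ring. -/
def HasCls (R : Subalgebra k (Ω → k)) (Q : Set Ω) (m : K0 k) : Prop :=
  ∃ R', Ext R R' ∧ Decomp R' Q m

lemma HasCls.of_isAff [IsAlgClosed k] (h : IsAff P R) (hP : charFn k P ∈ invClosure R) :
    HasCls R P (affCls P R) := by
  obtain ⟨R', hR, hP'⟩ := exists_ext_of_mem hP
  exact ⟨R', hR, .of_isAff_of_ext h hR hP'⟩

lemma HasCls.empty (R : Subalgebra k (Ω → k)) : HasCls R ∅ 0 := ⟨R, .refl, .empty⟩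

lemma HasCls.add [IsAlgClosed k] (h : HasCls R P m) (h' : HasCls R Q m') (hd : Disjoint P Q) :
    HasCls R (P ∪ Q) (m + m') := by
  obtain ⟨R₁, h₁, h₁'⟩ := h
  obtain ⟨R₂, h₂, h₂'⟩ := h'
  refine ⟨R₁ ⊔ R₂, h₁.trans (h₁.sup_of_ext h₂), ?_⟩
  refine (h₁'.ext (h₁.sup_of_ext h₂)).add (h₂'.ext ?_) hd
  rw [sup_comm]
  exact h₂.sup_of_ext h₁

lemma HasCls.split [IsAlgClosed k] (h : HasCls R Q m) {T : Set Ω} (hT : charFn k T ∈ invClosure R) :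
    ∃ m₁ m₂, HasCls R (Q ∩ T) m₁ ∧ HasCls R (Q \ T) m₂ ∧ m = m₁ + m₂ := by
  obtain ⟨R₁, h₁, h₁'⟩ := h
  obtain ⟨R₂, h₂, h₂'⟩ := exists_ext_of_mem hT
  obtain ⟨m₁, m₂, h3, h4, h5⟩ := (h₁'.ext (h₁.sup_of_ext h₂)).split
    (T := T) (Algebra.mem_sup_right h₂')
  have := h₁.trans (h₁.sup_of_ext h₂)
  exact ⟨m₁, m₂, ⟨_, this, h3⟩, ⟨_, this, h4⟩, h5⟩

/-- The class of a constructible set depends on the algebra of functions only through its closure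
under inversion. -/
lemma HasCls.unique [IsAlgClosed k] (h : HasCls R Q m) (h' : HasCls R' Q m') (hR : R.FG) (hR' : R'.FG)
    (h₁ : R ≤ invClosure R') (h₂ : R' ≤ invClosure R) : m = m' := by
  obtain ⟨R₁, e₁, d₁⟩ := h
  obtain ⟨R₂, e₂, d₂⟩ := h'
  obtain ⟨E₁, f₁, g₁⟩ := exists_ext_of_fg hR' h₂
  obtain ⟨E₂, f₂, g₂⟩ := exists_ext_of_fg hR h₁
  have a₁ := e₁.sup_of_ext f₁
  have a₂ := e₂.sup_of_ext f₂
  -- Since `R ≤ E₂`, the tower from `R` to `R₁ ⊔ E₁` becomes, after joining with `R₂ ⊔ E₂`, a tower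
  -- that starts at `R₂ ⊔ E₂`. Symmetrically for `b₂`, so both decompositions live over one algebra.
  have b₁ : Ext (R₂ ⊔ E₂) ((R₁ ⊔ E₁) ⊔ (R₂ ⊔ E₂)) := by
    have := Ext.sup (e₁.trans a₁) (R₂ ⊔ E₂)
    rwa [sup_eq_right.mpr (g₂.trans le_sup_right)] at this
  have b₂ : Ext (R₁ ⊔ E₁) ((R₁ ⊔ E₁) ⊔ (R₂ ⊔ E₂)) := by
    have := Ext.sup (e₂.trans a₂) (R₁ ⊔ E₁)
    rwa [sup_eq_right.mpr (g₁.trans le_sup_right), sup_comm (R₂ ⊔ E₂)] at this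
  exact (d₁.ext (a₁.trans b₂)).unique (d₂.ext (a₂.trans b₁))

lemma eq_zero_of_pull_eq_zero {Ω' : Type u} {i : Ω' → Ω} (hP : P ⊆ Set.range i) :
    ∀ f : restr P R, pull (fun x : i ⁻¹' P => (⟨i x.1, x.2⟩ : P)) f.1 = 0 → f = 0 := by
  intro f hf
  refine Subtype.ext (funext fun x => ?_)
  obtain ⟨y, hy⟩ := hP x.2
  have := congrFun hf ⟨y, by rw [Set.mem_preimage, hy]; exact x.2⟩
  have hx : x = ⟨i y, by rw [hy]; exact x.2⟩ := Subtype.ext hy.symm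
  rw [hx]
  exact this

/-- The restriction of `R` to `P` is the restriction of its pullback to the preimage of `P`. -/
def restrPullEquiv {Ω' : Type u} (i : Ω' → Ω) (R : Subalgebra k (Ω → k)) {P : Set Ω}
    (hP : P ⊆ Set.range i) : restr P R ≃ₐ[k] restr (i ⁻¹' P) (R.map (pull i)) :=
  AlgEquiv.ofBijective
    (((pull (fun x : i ⁻¹' P => (⟨i x.1, x.2⟩ : P))).comp (restr P R).val).codRestrict _ (by
      rintro ⟨_, f, hf, rfl⟩
      exact ⟨pull i f, ⟨f, hf, rfl⟩, rfl⟩))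
    ⟨(injective_iff_map_eq_zero _).mpr fun f hf =>
      eq_zero_of_pull_eq_zero hP f (congrArg Subtype.val hf), by
      rintro ⟨_, _, ⟨f, hf, rfl⟩, rfl⟩
      exact ⟨restrMk P hf, rfl⟩⟩

lemma IsAff.preimage {Ω' : Type u} {i : Ω' → Ω} (hP : P ⊆ Set.range i) (h : IsAff P R) :
    IsAff (i ⁻¹' P) (R.map (pull i)) ∧ affCls (i ⁻¹' P) (R.map (pull i)) = affCls P R := by
  let e := restrPullEquiv i R hP
  have hfg : (restr (i ⁻¹' P) (R.map (pull i))).FG := by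
    have := finiteType_of_fg h.fg
    exact (Subalgebra.fg_top _).mp (Algebra.FiniteType.of_surjective e.toAlgHom e.surjective).out
  refine ⟨⟨hfg, fun χ => ?_⟩, (algCls_congr h.fg hfg e).symm⟩
  obtain ⟨p, hp⟩ := h.exists_point (χ.comp e.toAlgHom)
  obtain ⟨y, hy⟩ := hP p.2
  refine ⟨⟨y, by rw [Set.mem_preimage, hy]; exact p.2⟩, fun f => ?_⟩
  obtain ⟨f, rfl⟩ := e.surjective f
  refine (hp f).trans ?_
  have hx : p = ⟨i y, by rw [hy]; exact p.2⟩ := Subtype.ext hy.symm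
  exact congrArg f.1 hx

lemma Decomp.preimage {Ω' : Type u} {i : Ω' → Ω} (h : Decomp R Q m) (hQ : Q ⊆ Set.range i) :
    Decomp (R.map (pull i)) (i ⁻¹' Q) m := by
  induction h with
  | empty => exact .empty
  | union h1 h2 h3 _ ih =>
    rw [Set.union_subset_iff] at hQ
    obtain ⟨h4, h5⟩ := h1.preimage hQ.1
    rw [Set.preimage_union, ← h5]
    exact .union h4 ⟨_, h2, rfl⟩ (h3.preimage i) (ih hQ.2)

lemma HasCls.preimage {Ω' : Type u} {i : Ω' → Ω} (h : HasCls R Q m) (hQ : Q ⊆ Set.range i) :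
    HasCls (R.map (pull i)) (i ⁻¹' Q) m := by
  obtain ⟨R', h1, h2⟩ := h
  exact ⟨_, h1.map_pull i, h2.preimage hQ⟩

/-- Constructible sets in bijection by piecewise regular maps have the same class. -/
theorem HasCls.eq_of_bijection [IsAlgClosed k] {Ω' E : Type u} {R' : Subalgebra k (Ω' → k)} {Q' : Set Ω'}
    (h : HasCls R Q m) (h' : HasCls R' Q' m') (hR : R.FG) (hR' : R'.FG)
    (i : E → Ω) (i' : E → Ω') (hi : Set.range i = Q) (hi' : Set.range i' = Q')
    (h₁ : R.map (pull i) ≤ invClosure (R'.map (pull i')))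
    (h₂ : R'.map (pull i') ≤ invClosure (R.map (pull i))) : m = m' := by
  -- Surjectivity of `i` and `i'` onto the two sets is what matters: pullback is then injective on
  -- the functions of every affine piece, so coordinate rings and classes are unchanged. Both sets
  -- become all of `E`, with comparable algebras.
  have a := h.preimage hi.ge
  have b := h'.preimage hi'.ge
  rw [← hi, Set.preimage_range] at a
  rw [← hi', Set.preimage_range] at b
  exact a.unique b (hR.map _) (hR'.map _) h₁ h₂

/-- Classes of the parts of a finite partition add up. -/
lemma HasCls.sum_partition [IsAlgClosed k] {α : Type*} (s : Finset α) (T : α → Set Ω)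
    (h : HasCls R Q m) (hT : ∀ a ∈ s, charFn k (T a) ∈ invClosure R)
    (hd : (s : Set α).PairwiseDisjoint T) (hQ : Q = ⋃ a ∈ s, T a) :
    ∃ c : α → K0 k, (∀ a ∈ s, HasCls R (T a) (c a)) ∧ m = ∑ a ∈ s, c a := by
  classical
  induction s using Finset.induction_on generalizing Q m with
  | empty =>
    refine ⟨0, by simp, ?_⟩
    simp only [Finset.notMem_empty, Set.iUnion_of_empty, Set.iUnion_empty] at hQ
    subst hQ
    obtain ⟨R', _, h2⟩ := h
    simpa using h2.unique .empty
  | insert a s ha ih =>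
    obtain ⟨m₁, m₂, h1, h2, rfl⟩ := h.split (hT a (Finset.mem_insert_self a s))
    rw [Finset.coe_insert, Set.pairwiseDisjoint_insert_of_notMem (by simpa using ha)] at hd
    have hdis : Disjoint (⋃ b ∈ s, T b) (T a) := by
      simp only [Set.disjoint_iUnion_left]
      exact fun b hb => (hd.2 b hb).symm
    rw [Finset.set_biUnion_insert] at hQ
    have hQ1 : Q ∩ T a = T a := by rw [hQ, Set.union_inter_cancel_left]
    have hQ2 : Q \ T a = ⋃ b ∈ s, T b := by
      rw [hQ, Set.union_sdiff_left, hdis.sdiff_eq_left]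
    obtain ⟨c, hc, rfl⟩ := ih h2 (fun b hb => hT b (Finset.mem_insert_of_mem hb)) hd.1 hQ2
    rw [hQ1] at h1
    refine ⟨Function.update c a m₁, fun b hb => ?_, ?_⟩
    · rcases Finset.mem_insert.mp hb with rfl | hb
      · simpa using h1
      · rw [Function.update_of_ne (ne_of_mem_of_not_mem hb ha)]
        exact hc b hb
    · rw [Finset.sum_insert ha, Function.update_self]
      congr 1
      exact Finset.sum_congr rfl fun b hb => by
        rw [Function.update_of_ne (ne_of_mem_of_not_mem hb ha)]

end Decompositions

/-! ### Projective varieties as unions of affine pieces -/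

section ReducedSubscheme

/-- An affine open of a reduced closed subscheme, given by its coordinate ring. -/
lemma exists_openImmersion_subscheme {X : Scheme.{u}} (T : TopologicalSpace.Closeds X)
    (U : X.affineOpens) {S : CommRingCat.{u}} (χ : Γ(X, U.1) ⟶ S)
    (hχ : Function.Surjective χ.hom)
    (hker : RingHom.ker χ.hom = (Scheme.IdealSheafData.vanishingIdeal T).ideal U) :
    ∃ j : Spec S ⟶ (Scheme.IdealSheafData.vanishingIdeal T).subscheme,
      IsOpenImmersion j ∧
      Set.range j = (Scheme.IdealSheafData.vanishingIdeal T).subschemeι ⁻¹' U.1 ∧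
      j ≫ (Scheme.IdealSheafData.vanishingIdeal T).subschemeι = Spec.map χ ≫ U.2.fromSpec := by
  set I := Scheme.IdealSheafData.vanishingIdeal T
  let e : (Γ(X, U.1) ⧸ I.ideal U) ≃+* S :=
    (Ideal.quotEquivOfEq hker.symm).trans (RingHom.quotientKerEquivOfSurjective hχ)
  let i : CommRingCat.of (Γ(X, U.1) ⧸ I.ideal U) ≅ S := e.toCommRingCatIso
  have hi : CommRingCat.ofHom (Ideal.Quotient.mk (I.ideal U)) ≫ i.hom = χ := by
    ext x; rfl
  let φ : Spec (CommRingCat.of (Γ(X, U.1) ⧸ I.ideal U)) ⟶ I.subscheme := I.subschemeCover.f U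
  have hφ : IsOpenImmersion φ := I.subschemeCover.map_prop U
  have hφ' : φ ≫ I.subschemeι =
      Spec.map (CommRingCat.ofHom (Ideal.Quotient.mk (I.ideal U))) ≫ U.2.fromSpec :=
    (I.subschemeCover_map_subschemeι U).trans (I.glueDataObjι_ι U)
  refine ⟨Spec.map i.hom ≫ φ, inferInstance, ?_, ?_⟩
  · have h := I.opensRange_subschemeCover_map U
    have h' := congrArg (fun V : I.subscheme.Opens => (V : Set I.subscheme)) h
    refine Eq.trans ?_ h'
    change Set.range (φ ∘ Spec.map i.hom) = Set.range φ
    refine Function.Surjective.range_comp ?_ _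
    exact (Spec.map i.hom).surjective
  · rw [Category.assoc, hφ', ← Spec.map_comp_assoc, hi]

lemma isCompl_range_inclusion {X : Scheme.{u}} {T T' : TopologicalSpace.Closeds X}
    (h : T' ≤ T) (U : X.Opens) (hU : (T : Set X) ∩ (U : Set X)ᶜ = T') :
    IsCompl (Set.range (Scheme.IdealSheafData.inclusion
        (Scheme.IdealSheafData.vanishingIdeal_antimono h)))
      ((Scheme.IdealSheafData.vanishingIdeal T).subschemeι ⁻¹' U) := by
  set i := Scheme.IdealSheafData.inclusion (Scheme.IdealSheafData.vanishingIdeal_antimono h)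
  set ι := (Scheme.IdealSheafData.vanishingIdeal T).subschemeι
  have hι : i ≫ ι = (Scheme.IdealSheafData.vanishingIdeal T').subschemeι :=
    Scheme.IdealSheafData.inclusion_subschemeι _
  have hr : Set.range ι = T := by
    rw [Scheme.IdealSheafData.range_subschemeι, Scheme.IdealSheafData.coe_support_vanishingIdeal]
  have hr' : Set.range (Scheme.IdealSheafData.vanishingIdeal T').subschemeι = T' := by
    rw [Scheme.IdealSheafData.range_subschemeι, Scheme.IdealSheafData.coe_support_vanishingIdeal]
  have hinj : Function.Injective ι := ι.isEmbedding.injective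
  have key : Set.range i = (ι ⁻¹' U)ᶜ := by
    ext y
    rw [Set.mem_compl_iff, Set.mem_preimage]
    constructor
    · rintro ⟨z, rfl⟩ hz
      have : ι (i z) ∈ (T' : Set X) := by
        rw [← hr', ← hι]
        exact ⟨z, rfl⟩
      rw [← hU] at this
      exact this.2 hz
    · intro hy
      have : ι y ∈ (T' : Set X) := by
        rw [← hU]
        exact ⟨hr ▸ Set.mem_range_self y, hy⟩
      rw [← hr', ← hι] at this
      obtain ⟨z, hz⟩ := this
      exact ⟨z, hinj hz⟩
  rw [key]
  exact isCompl_compl.symm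

end ReducedSubscheme

/-! ### Closed cones and their projective varieties -/

section Cones

attribute [local instance] MvPolynomial.gradedAlgebra

variable {k : Type u} [Field k] {ι : Type}

/-- The closed subset of projective space defined by the equations of a set of vectors. -/
def coneLocus (C : Set (ι → k)) : TopologicalSpace.Closeds (projSpace k ι) :=
  ⟨ProjectiveSpectrum.zeroLocus (MvPolynomial.homogeneousSubmodule ι k)
      {F | ∀ p ∈ C, MvPolynomial.eval p F = 0},
    ProjectiveSpectrum.isClosed_zeroLocus _ _⟩

/-- The projective variety of a cone. -/
def coneVariety [Finite ι] (C : Set (ι → k)) : Variety k where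
  toOver := Over.mk
    ((Scheme.IdealSheafData.vanishingIdeal (coneLocus C)).subschemeι ≫ projSpaceHom k _)
  locallyOfFiniteType := by dsimp; infer_instance
  quasiCompact := by dsimp; infer_instance
  isSeparated := by dsimp; infer_instance

/-- A Zariski closed cone. -/
structure IsClosedCone (C : Set (ι → k)) : Prop where
  smul_mem : ∀ p ∈ C, ∀ c : k, c • p ∈ C
  closed : ∀ p, (∀ F : MvPolynomial ι k, (∀ q ∈ C, MvPolynomial.eval q F = 0) →
    MvPolynomial.eval p F = 0) → p ∈ C

lemma IsClosedCone.inter_zero {C : Set (ι → k)} (h : IsClosedCone C) (σ : ι) :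
    IsClosedCone (C ∩ {p | p σ = 0}) where
  smul_mem p hp c := ⟨h.smul_mem p hp.1 c, by simp [show p σ = 0 from hp.2]⟩
  closed p hp := ⟨h.closed p fun F hF => hp F fun q hq => hF q hq.1, by
    simpa using hp (MvPolynomial.X σ) fun q hq => by simpa using hq.2⟩

/-- By the Nullstellensatz and closedness of `C`, a polynomial vanishing on `C ∩ {p σ = 0}` lies in
the radical of the ideal generated by the equations of `C` and by `X σ`. A prime that contains these
contains the polynomial. -/
lemma coneLocus_inter_zero [IsAlgClosed k] [Finite ι] {C : Set (ι → k)} (h : IsClosedCone C)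
    (σ : ι) : (coneLocus C : Set (projSpace k ι)) ∩
      ((Proj.basicOpen (MvPolynomial.homogeneousSubmodule ι k) (MvPolynomial.X σ) :
        (projSpace k ι).Opens) : Set (projSpace k ι))ᶜ = coneLocus (C ∩ {p | p σ = 0}) := by
  ext x
  have hx : x ∈ ((Proj.basicOpen (MvPolynomial.homogeneousSubmodule ι k) (MvPolynomial.X σ) :
        (projSpace k ι).Opens) : Set (projSpace k ι))ᶜ ↔
      MvPolynomial.X σ ∈ x.asHomogeneousIdeal := by
    rw [Set.mem_compl_iff, SetLike.mem_coe, Proj.mem_basicOpen, not_not]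
  rw [Set.mem_inter_iff, hx]
  constructor
  · rintro ⟨h1, h2⟩ F hF
    have h1 : ({F | ∀ p ∈ C, MvPolynomial.eval p F = 0} : Set (MvPolynomial ι k)) ⊆
      x.asHomogeneousIdeal := h1
    let I : Ideal (MvPolynomial ι k) := MvPolynomial.vanishingIdeal k C ⊔ Ideal.span {.X σ}
    have hI : I ≤ x.asHomogeneousIdeal.toIdeal := by
      refine sup_le (fun F hF => h1 fun p hp => ?_) ?_
      · simpa [MvPolynomial.aeval_eq_eval] using hF p hp
      · rw [Ideal.span_singleton_le_iff_mem]; exact h2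
    have hF' : F ∈ I.radical := by
      rw [← MvPolynomial.vanishingIdeal_zeroLocus_eq_radical (K := k)]
      intro p hp
      rw [MvPolynomial.aeval_eq_eval]
      refine hF p ⟨h.closed p fun G hG => ?_, ?_⟩
      · have := hp G (Ideal.mem_sup_left fun q hq => by
          rw [MvPolynomial.aeval_eq_eval]; exact hG q hq)
        rwa [MvPolynomial.aeval_eq_eval] at this
      · have := hp (.X σ) (Ideal.mem_sup_right (Ideal.mem_span_singleton_self _))
        simpa using this
    exact (x.isPrime.radical_le_iff.mpr hI) hF'
  · intro h1
    have h1 : ({F | ∀ p ∈ C ∩ {p | p σ = 0}, MvPolynomial.eval p F = 0} :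
      Set (MvPolynomial ι k)) ⊆ x.asHomogeneousIdeal := h1
    exact ⟨fun F hF => h1 fun p hp => hF p hp.1, h1 fun p hp => by simpa using hp.2⟩

end Cones

/-! ### Coordinate rings of the affine parts of a cone -/

section ConePieces

attribute [local instance] MvPolynomial.gradedAlgebra

variable {k : Type u} [Field k] {ι : Type}

/-- The algebra of polynomial functions on `ι → k`. -/
def coordAlg (k : Type u) [Field k] (ι : Type) : Subalgebra k ((ι → k) → k) :=
  (MvPolynomial.aeval fun (i : ι) (p : ι → k) => p i).range

lemma aeval_coord_apply (F : MvPolynomial ι k) (p : ι → k) :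
    MvPolynomial.aeval (fun (i : ι) (p : ι → k) => p i) F p = MvPolynomial.eval p F := by
  have : (Pi.evalAlgHom k (fun _ => k) p).comp
      (MvPolynomial.aeval fun (i : ι) (p : ι → k) => p i) = MvPolynomial.aeval p := by
    ext i; simp
  exact (DFunLike.congr_fun this F).trans (by rw [MvPolynomial.aeval_eq_eval])

lemma eval_mem_coordAlg (F : MvPolynomial ι k) :
    (fun p => MvPolynomial.eval p F) ∈ coordAlg k ι :=
  ⟨F, funext fun p => aeval_coord_apply F p⟩

lemma coord_mem_coordAlg (i : ι) : (fun p => p i) ∈ coordAlg k ι := by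
  simpa using eval_mem_coordAlg (k := k) (.X i)

lemma coordAlg_fg [Finite ι] : (coordAlg k ι).FG := by
  have : Algebra.FiniteType k (MvPolynomial ι k) := inferInstance
  have := (this.out).map (MvPolynomial.aeval fun (i : ι) (p : ι → k) => p i)
  rwa [Algebra.map_top] at this

/-- Restriction of polynomials to a set of points. -/
def evalOn (P : Set (ι → k)) : MvPolynomial ι k →ₐ[k] restr P (coordAlg k ι) :=
  ((pull (Subtype.val : P → ι → k)).comp
    (MvPolynomial.aeval fun (i : ι) (p : ι → k) => p i)).codRestrict _
    fun F => ⟨_, ⟨F, rfl⟩, rfl⟩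

lemma evalOn_apply (P : Set (ι → k)) (F : MvPolynomial ι k) (p : P) :
    (evalOn P F).1 p = MvPolynomial.eval p.1 F := aeval_coord_apply F p.1

lemma evalOn_surjective (P : Set (ι → k)) : Function.Surjective (evalOn P) := by
  rintro ⟨_, _, ⟨F, rfl⟩, rfl⟩
  exact ⟨F, rfl⟩

/-- A Zariski closed set is an affine piece. -/
lemma isAff_of_closed [Finite ι] {P : Set (ι → k)}
    (h : ∀ p, (∀ F : MvPolynomial ι k, (∀ q ∈ P, MvPolynomial.eval q F = 0) →
      MvPolynomial.eval p F = 0) → p ∈ P) : IsAff P (coordAlg k ι) := by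
  refine ⟨coordAlg_fg.map _, fun χ => ?_⟩
  set p : ι → k := fun i => χ (evalOn P (.X i)) with hp
  have hχ : ∀ F, χ (evalOn P F) = MvPolynomial.eval p F := by
    intro F
    have : χ.comp (evalOn P) = MvPolynomial.aeval p := by ext i; simp [hp]
    exact (DFunLike.congr_fun this F).trans (by rw [MvPolynomial.aeval_eq_eval])
  refine ⟨⟨p, h p fun F hF => ?_⟩, fun f => ?_⟩
  · rw [← hχ]
    convert map_zero χ
    exact Subtype.ext (funext fun q => (evalOn_apply P F q).trans (hF q.1 q.2))
  · obtain ⟨F, rfl⟩ := evalOn_surjective P f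
    rw [hχ, evalOn_apply]

lemma IsHomogeneous.eval_smul {F : MvPolynomial ι k} {n : ℕ} (hF : F.IsHomogeneous n)
    (p : ι → k) (c : k) : MvPolynomial.eval (c • p) F = c ^ n * MvPolynomial.eval p F := by
  rw [MvPolynomial.eval_eq, MvPolynomial.eval_eq, Finset.mul_sum]
  refine Finset.sum_congr rfl fun d hd => ?_
  have h : ∑ i ∈ d.support, d i = n := by
    exact (DFunLike.congr_fun Finsupp.degree_eq_weight_one d).trans
      (hF (MvPolynomial.mem_support_iff.mp hd))
  simp only [Pi.smul_apply, smul_eq_mul, mul_pow, Finset.prod_mul_distrib, Finset.prod_pow_eq_pow_sum,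
    h]
  ring

lemma eval_smul_eq (F : MvPolynomial ι k) (p : ι → k) (c : k) :
    MvPolynomial.eval (c • p) F = ∑ i ∈ Finset.range (F.totalDegree + 1),
      c ^ i * MvPolynomial.eval p (MvPolynomial.homogeneousComponent i F) := by
  conv_lhs => rw [← MvPolynomial.sum_homogeneousComponent F]
  rw [map_sum]
  refine Finset.sum_congr rfl fun i _ => ?_
  exact IsHomogeneous.eval_smul (MvPolynomial.homogeneousComponent_isHomogeneous i F) p c

/-- On the line through `p`, the polynomial `F` is a one-variable polynomial in `c` whose
coefficients are the values of its components. It vanishes on an infinite field. The lemma is needed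
because `coneLocus` also uses inhomogeneous equations. -/
lemma eval_homogeneousComponent_eq_zero [Infinite k] (F : MvPolynomial ι k) (p : ι → k)
    (h : ∀ c : k, MvPolynomial.eval (c • p) F = 0) (i : ℕ) :
    MvPolynomial.eval p (MvPolynomial.homogeneousComponent i F) = 0 := by
  by_cases hi : i ∈ Finset.range (F.totalDegree + 1)
  · have : (∑ i ∈ Finset.range (F.totalDegree + 1), Polynomial.monomial i
        (MvPolynomial.eval p (MvPolynomial.homogeneousComponent i F))) = 0 := by
      refine Polynomial.funext fun c => ?_
      rw [Polynomial.eval_zero, ← h c, eval_smul_eq, Polynomial.eval_finsetSum]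
      exact Finset.sum_congr rfl fun i _ => by rw [Polynomial.eval_monomial, mul_comm]
    have := congrArg (fun q => Polynomial.coeff q i) this
    simpa [Polynomial.finsetSum_coeff, Polynomial.coeff_monomial, hi] using this
  · rw [MvPolynomial.homogeneousComponent_eq_zero, map_zero]
    simpa using hi

variable (C : Set (ι → k)) (σ : ι)

lemma evalOn_X_eq_one : evalOn (C ∩ {p | p σ = 1}) (MvPolynomial.X σ) = 1 :=
  Subtype.ext (funext fun p => by rw [evalOn_apply]; simpa using p.2.2)

/-- Evaluation of fractions `F / X_σ ^ n` on the part of a cone where `X_σ = 1`. -/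
def awayEval : HomogeneousLocalization.Away (MvPolynomial.homogeneousSubmodule ι k)
    (MvPolynomial.X σ) →+* restr (C ∩ {p | p σ = 1}) (coordAlg k ι) :=
  (Localization.awayLift (evalOn (C ∩ {p | p σ = 1})).toRingHom (MvPolynomial.X σ) (by
    change IsUnit (evalOn _ _)
    rw [evalOn_X_eq_one]; exact isUnit_one)).comp (algebraMap _ _)

lemma X_mem (σ : ι) :
    (MvPolynomial.X σ : MvPolynomial ι k) ∈ MvPolynomial.homogeneousSubmodule ι k 1 :=
  MvPolynomial.isHomogeneous_X k σ

lemma awayEval_mk (n : ℕ) (F : MvPolynomial ι k)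
    (hF : F ∈ MvPolynomial.homogeneousSubmodule ι k (n • 1)) :
    awayEval C σ (.mk _ (X_mem σ) n F hF) = evalOn _ F := by
  rw [awayEval, RingHom.comp_apply, HomogeneousLocalization.algebraMap_apply,
    HomogeneousLocalization.Away.val_mk,
    Localization.awayLift_mk (v := 1) (hv := by
      change evalOn _ _ * 1 = 1
      rw [evalOn_X_eq_one, mul_one])]
  simp

lemma awayEval_surjective : Function.Surjective (awayEval C σ) := by
  intro f
  obtain ⟨F, rfl⟩ := evalOn_surjective _ f
  induction F using MvPolynomial.induction_on with
  | C a =>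
    exact ⟨.mk _ (X_mem σ) 0 (.C a) (by simp),
      awayEval_mk ..⟩
  | add p q hp hq =>
    obtain ⟨a, ha⟩ := hp
    obtain ⟨b, hb⟩ := hq
    exact ⟨a + b, by rw [map_add, map_add, ha, hb]⟩
  | mul_X p i hp =>
    obtain ⟨a, ha⟩ := hp
    exact ⟨a * .mk _ (X_mem σ) 1 (.X i) (by simpa using MvPolynomial.isHomogeneous_X k i),
      by rw [map_mul, map_mul, ha, awayEval_mk]⟩

lemma awayEval_comp_algebraMap :
    (awayEval C σ).comp ((HomogeneousLocalization.fromZeroRingHom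
      (MvPolynomial.homogeneousSubmodule ι k) (Submonoid.powers (MvPolynomial.X σ))).comp
      (algebraMap k (MvPolynomial.homogeneousSubmodule ι k 0))) = algebraMap k _ := by
  ext a : 1
  have : (HomogeneousLocalization.fromZeroRingHom
      (MvPolynomial.homogeneousSubmodule ι k) (Submonoid.powers (MvPolynomial.X σ)))
      (algebraMap k (MvPolynomial.homogeneousSubmodule ι k 0) a) =
      HomogeneousLocalization.Away.mk _ (X_mem σ) 0 (.C a)
        (by simp) := by
    ext
    simp [HomogeneousLocalization.fromZeroRingHom]
    rfl
  rw [RingHom.comp_apply, RingHom.comp_apply, this, awayEval_mk]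
  exact (evalOn _).commutes a

end ConePieces

/-! ### Cutting a projective variety by a coordinate hyperplane -/

section ConeCut

attribute [local instance] MvPolynomial.gradedAlgebra

variable {k : Type u} [Field k] {ι : Type}

lemma fromSpec_basicOpen {A : Type u} {τ : Type*} [CommRing A] [SetLike τ A]
    [AddSubgroupClass τ A] (𝒜 : ℕ → τ) [GradedRing 𝒜] (f : A) {m : ℕ} (hf : f ∈ 𝒜 m) (hm : 0 < m) :
    Spec.map (Proj.awayToSection 𝒜 f) ≫ Proj.awayι 𝒜 f hf hm =
      (Proj.isAffineOpen_basicOpen 𝒜 f hf hm).fromSpec := by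
  rw [← cancel_epi (Proj.isAffineOpen_basicOpen 𝒜 f hf hm).isoSpec.hom, IsAffineOpen.isoSpec_hom,
    ← Category.assoc]
  change Proj.basicOpenToSpec 𝒜 f ≫ (Proj.basicOpenIsoSpec 𝒜 f hf hm).inv ≫ _ = _
  rw [← Proj.basicOpenIsoSpec_hom 𝒜 f hf hm, Iso.hom_inv_id_assoc, IsAffineOpen.fromSpec,
    ← IsAffineOpen.isoSpec_hom (Proj.isAffineOpen_basicOpen 𝒜 f hf hm), Iso.hom_inv_id_assoc]

lemma mem_awayι_iff {σ : ι} {n : ℕ} (hn : 0 < n) {G : MvPolynomial ι k}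
    (hG : G ∈ MvPolynomial.homogeneousSubmodule ι k n)
    (y : PrimeSpectrum (HomogeneousLocalization.Away (MvPolynomial.homogeneousSubmodule ι k)
      (MvPolynomial.X σ))) :
    G ∈ (Proj.awayι (MvPolynomial.homogeneousSubmodule ι k) _ (X_mem σ) one_pos y).asHomogeneousIdeal
      ↔ HomogeneousLocalization.Away.mk _ (X_mem σ) n G (by simpa using hG) ∈ y.asIdeal := by
  have h := Proj.awayι_preimage_basicOpen (MvPolynomial.homogeneousSubmodule ι k) (X_mem σ)
    one_pos hG hn
  have h' : Proj.awayι (MvPolynomial.homogeneousSubmodule ι k) _ (X_mem σ) one_pos y ∈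
      Proj.basicOpen (MvPolynomial.homogeneousSubmodule ι k) G ↔
      y ∈ PrimeSpectrum.basicOpen
        (HomogeneousLocalization.Away.isLocalizationElem (X_mem σ) hG) := by
    rw [← h]; rfl
  rw [Proj.mem_basicOpen, PrimeSpectrum.mem_basicOpen, not_iff_not] at h'
  rw [h']
  simp only [HomogeneousLocalization.Away.isLocalizationElem, pow_one]

/-- The functions on `D₊(X_σ)` that vanish on a cone are the kernel of evaluation. -/
lemma awayEval_eq_zero_iff [Infinite k] {C : Set (ι → k)} (hC : ∀ p ∈ C, ∀ c : k, c • p ∈ C) (σ : ι)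
    (z : HomogeneousLocalization.Away (MvPolynomial.homogeneousSubmodule ι k)
      (MvPolynomial.X σ)) :
    awayEval C σ z = 0 ↔ ∀ y : PrimeSpectrum (HomogeneousLocalization.Away
      (MvPolynomial.homogeneousSubmodule ι k) (MvPolynomial.X σ)),
      Proj.awayι (MvPolynomial.homogeneousSubmodule ι k) _ (X_mem σ) one_pos y ∈
        (coneLocus C : Set (projSpace k ι)) → z ∈ y.asIdeal := by
  obtain ⟨n, F, hF, rfl⟩ := HomogeneousLocalization.Away.mk_surjective _ (X_mem σ) z
  have hF' : F ∈ MvPolynomial.homogeneousSubmodule ι k n := by simpa using hF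
  constructor
  · intro h y hy
    rw [awayEval_mk] at h
    -- The extra factor `X σ` makes the numerator vanish also at the points of `C` with `p σ = 0`,
    -- and makes its degree positive, as `mem_awayι_iff` requires.
    have hG : F * MvPolynomial.X σ ∈ MvPolynomial.homogeneousSubmodule ι k (n + 1) :=
      MvPolynomial.IsHomogeneous.mul hF' (X_mem σ)
    have h1 : HomogeneousLocalization.Away.mk _ (X_mem σ) n F hF =
        HomogeneousLocalization.Away.mk _ (X_mem σ) (n + 1) (F * MvPolynomial.X σ)
          (by simpa using hG) := by
      ext
      rw [HomogeneousLocalization.Away.val_mk, HomogeneousLocalization.Away.val_mk,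
        Localization.mk_eq_mk_iff, Localization.r_iff_exists]
      exact ⟨1, by simp; ring⟩
    rw [h1, ← mem_awayι_iff n.succ_pos hG]
    refine hy fun p hp => ?_
    rw [map_mul, MvPolynomial.eval_X]
    by_cases hpσ : p σ = 0
    · rw [hpσ, mul_zero]
    · have h2 : (p σ)⁻¹ • p ∈ C ∩ {p | p σ = 1} := ⟨hC p hp _, by simp [hpσ]⟩
      have h3 := congrFun (congrArg Subtype.val h) ⟨_, h2⟩
      rw [evalOn_apply, IsHomogeneous.eval_smul hF'] at h3
      have h4 : MvPolynomial.eval p F = 0 := by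
        simpa [hpσ] using h3
      rw [h4, zero_mul]
  · intro h
    rw [awayEval_mk]
    refine Subtype.ext (funext fun p => ?_)
    rw [evalOn_apply]
    let ev : restr (C ∩ {p | p σ = 1}) (coordAlg k ι) →+* k :=
      (Pi.evalRingHom (fun _ => k) p).comp (restr (C ∩ {p | p σ = 1}) (coordAlg k ι)).val.toRingHom
    let y : PrimeSpectrum (HomogeneousLocalization.Away
      (MvPolynomial.homogeneousSubmodule ι k) (MvPolynomial.X σ)) :=
      ⟨RingHom.ker (ev.comp (awayEval C σ)), RingHom.ker_isPrime _⟩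
    have hy : ∀ (n : ℕ) (G) (hG), HomogeneousLocalization.Away.mk _ (X_mem σ) n G hG ∈ y.asIdeal ↔
        MvPolynomial.eval p.1 G = 0 := by
      intro n G hG
      change ev (awayEval C σ _) = 0 ↔ _
      rw [awayEval_mk]
      change (evalOn _ G).1 p = 0 ↔ _
      rw [evalOn_apply]
    refine (hy n F hF).mp (h y ?_)
    intro H hH
    have hcomp := eval_homogeneousComponent_eq_zero H p.1 fun c => hH _ (hC _ p.2.1 c)
    change H ∈ (Proj.awayι (MvPolynomial.homogeneousSubmodule ι k) _ (X_mem σ)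
      one_pos y).asHomogeneousIdeal.toIdeal
    rw [← MvPolynomial.sum_homogeneousComponent H]
    refine Ideal.sum_mem _ fun i _ => ?_
    -- `mem_awayι_iff` covers positive degrees only. In degree zero the component is a constant
    -- whose value at `p` is zero.
    rcases Nat.eq_zero_or_pos i with rfl | hi
    · have h0 := hcomp 0
      rw [MvPolynomial.homogeneousComponent_zero, MvPolynomial.eval_C] at h0
      rw [MvPolynomial.homogeneousComponent_zero, h0, map_zero]
      exact zero_mem _
    · exact (mem_awayι_iff hi (MvPolynomial.homogeneousComponent_isHomogeneous i H) y).mpr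
        ((hy _ _ _).mpr (hcomp i))

/-- An affine open of a reduced closed subscheme, given by its coordinate ring. -/
lemma exists_openImmersion_subscheme_of_iso {X : Scheme.{u}} (T : TopologicalSpace.Closeds X)
    (U : X.affineOpens) {R S : CommRingCat.{u}} (e : R ≅ Γ(X, U.1)) (a : Spec R ⟶ X)
    (ha : Spec.map e.hom ≫ a = U.2.fromSpec) (χ : R ⟶ S) (hχ : Function.Surjective χ.hom)
    (hker : ∀ z, χ.hom z = 0 ↔ ∀ y : Spec R, a y ∈ (T : Set X) → z ∈ y.asIdeal) :
    ∃ j : Spec S ⟶ (Scheme.IdealSheafData.vanishingIdeal T).subscheme,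
      IsOpenImmersion j ∧
      Set.range j = (Scheme.IdealSheafData.vanishingIdeal T).subschemeι ⁻¹' U.1 ∧
      j ≫ (Scheme.IdealSheafData.vanishingIdeal T).subschemeι = Spec.map χ ≫ a := by
  have ha' : Spec.map e.inv ≫ U.2.fromSpec = a := by
    rw [← ha, ← Spec.map_comp_assoc, e.hom_inv_id, Spec.map_id, Category.id_comp]
  have he (z) : e.inv.hom (e.hom.hom z) = z := by
    change (e.hom ≫ e.inv).hom z = _
    rw [e.hom_inv_id]; rfl
  have he' (z) : e.hom.hom (e.inv.hom z) = z := by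
    change (e.inv ≫ e.hom).hom z = _
    rw [e.inv_hom_id]; rfl
  have hs : Function.Surjective (e.inv ≫ χ).hom := by
    intro f
    obtain ⟨z, hz⟩ := hχ f
    exact ⟨e.hom.hom z, (congrArg χ.hom (he z)).trans hz⟩
  have hk : RingHom.ker (e.inv ≫ χ).hom =
      (Scheme.IdealSheafData.vanishingIdeal T).ideal U := by
    rw [Scheme.IdealSheafData.vanishingIdeal_ideal]
    ext w
    rw [RingHom.mem_ker, PrimeSpectrum.mem_vanishingIdeal]
    refine (hker (e.inv.hom w)).trans ⟨fun h y hy => ?_, fun h y hy => ?_⟩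
    · have h2 := h (Spec.map e.hom y) (by rw [← ha] at hy; exact hy)
      change e.hom.hom (e.inv.hom w) ∈ y.asIdeal at h2
      rwa [he'] at h2
    · exact h (Spec.map e.inv y) (by rw [← ha'] at hy; exact hy)
  obtain ⟨j, hj, hj', hj''⟩ := exists_openImmersion_subscheme T U (e.inv ≫ χ) hs hk
  refine ⟨j, hj, hj', ?_⟩
  rw [hj'', Spec.map_comp, Category.assoc, ha']

/-- The affine part of a projective variety, as the spectrum of an algebra of functions. -/
lemma exists_openImmersion_cone [Infinite k] {C : Set (ι → k)} (hC : ∀ p ∈ C, ∀ c : k, c • p ∈ C)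
    (σ : ι) : ∃ j : Spec (CommRingCat.of (restr (C ∩ {p | p σ = 1}) (coordAlg k ι))) ⟶
      (Scheme.IdealSheafData.vanishingIdeal (coneLocus C)).subscheme,
      IsOpenImmersion j ∧
      Set.range j = (Scheme.IdealSheafData.vanishingIdeal (coneLocus C)).subschemeι ⁻¹'
        (Proj.basicOpen (MvPolynomial.homogeneousSubmodule ι k) (MvPolynomial.X σ) :
          (projSpace k ι).Opens) ∧
      j ≫ (Scheme.IdealSheafData.vanishingIdeal (coneLocus C)).subschemeι =
        Spec.map (CommRingCat.ofHom (awayEval C σ)) ≫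
          Proj.awayι (MvPolynomial.homogeneousSubmodule ι k) _ (X_mem σ) one_pos :=
  exists_openImmersion_subscheme_of_iso (coneLocus C)
    ⟨_, Proj.isAffineOpen_basicOpen (MvPolynomial.homogeneousSubmodule ι k) _ (X_mem σ) one_pos⟩
    (Proj.basicOpenIsoAway _ _ (X_mem σ) one_pos) _
    (by rw [Proj.basicOpenIsoAway_hom]; exact fromSpec_basicOpen ..)
    (CommRingCat.ofHom (awayEval C σ)) (awayEval_surjective C σ) (awayEval_eq_zero_iff hC σ)

lemma coneVariety_hom [Finite ι] (C : Set (ι → k)) : (coneVariety C).toOver.hom =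
    (Scheme.IdealSheafData.vanishingIdeal (coneLocus C)).subschemeι ≫ projSpaceHom k ι := rfl

lemma specMap_awayEval_projSpaceHom (C : Set (ι → k)) (σ : ι) :
    Spec.map (CommRingCat.ofHom (awayEval C σ)) ≫
      Proj.awayι (MvPolynomial.homogeneousSubmodule ι k) _ (X_mem σ) one_pos ≫ projSpaceHom k ι =
    Spec.map (CommRingCat.ofHom (algebraMap k _)) := by
  rw [projSpaceHom, Proj.awayι_toSpecZero_assoc, ← Spec.map_comp, ← Spec.map_comp,
    ← CommRingCat.ofHom_comp, ← CommRingCat.ofHom_comp, awayEval_comp_algebraMap]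

/-- The class of a projective variety is the sum of the classes of a hyperplane section and of its
affine complement. -/
lemma coneVariety_cls_cut [IsAlgClosed k] [Finite ι] {C : Set (ι → k)} (hC : IsClosedCone C)
    (σ : ι) : (coneVariety C).cls = (coneVariety (C ∩ {p | p σ = 0})).cls +
      affCls (C ∩ {p | p σ = 1}) (coordAlg k ι) := by
  have hfg : (restr (C ∩ {p | p σ = 1}) (coordAlg k ι)).FG := coordAlg_fg.map _
  have := finiteType_of_fg hfg
  rw [affCls, algCls_eq hfg]
  have hle : coneLocus (C ∩ {p | p σ = 0}) ≤ coneLocus C := by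
    intro x hx
    rw [← SetLike.mem_coe, ← coneLocus_inter_zero hC σ] at hx
    exact hx.1
  obtain ⟨j, hj, hj', hj''⟩ := exists_openImmersion_cone hC.smul_mem σ
  let i := Scheme.IdealSheafData.inclusion (Scheme.IdealSheafData.vanishingIdeal_antimono hle)
  have hi : i ≫ (Scheme.IdealSheafData.vanishingIdeal (coneLocus C)).subschemeι =
      (Scheme.IdealSheafData.vanishingIdeal (coneLocus (C ∩ {p | p σ = 0}))).subschemeι :=
    Scheme.IdealSheafData.inclusion_subschemeι _
  have hi' : IsClosedImmersion i := by
    have : IsClosedImmersion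
        (i ≫ (Scheme.IdealSheafData.vanishingIdeal (coneLocus C)).subschemeι) := by
      rw [hi]; infer_instance
    exact IsClosedImmersion.of_comp _
      (Scheme.IdealSheafData.vanishingIdeal (coneLocus C)).subschemeι
  have hcompl : IsCompl (Set.range i) (Set.range j) := by
    rw [hj']
    exact isCompl_range_inclusion hle _ (coneLocus_inter_zero hC σ)
  have hoi : i ≫ (coneVariety C).toOver.hom = (coneVariety (C ∩ {p | p σ = 0})).toOver.hom := by
    rw [coneVariety_hom, coneVariety_hom, ← hi, Category.assoc]
  have hoj : j ≫ (coneVariety C).toOver.hom = (affVariety k _).toOver.hom := by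
    rw [coneVariety_hom, ← Category.assoc, hj'', Category.assoc]
    exact specMap_awayEval_projSpaceHom C σ
  exact cls_eq_add k (Over.homMk i hoi) (Over.homMk j hoj) hi' hj hcompl

end ConeCut

/-! ### Normalized vectors as points of a projective variety -/

section Normalization

variable {k : Type u} [Field k] {ι : Type}

/-- Vectors whose first nonzero coordinate, in the order of the list, is `1`. -/
def normSet (k : Type u) [Field k] : List ι → Set (ι → k)
  | [] => ∅
  | σ :: l => {p | p σ = 1} ∪ ({p | p σ = 0} ∩ normSet k l)

open Classical in
/-- The multiple of a vector whose first nonzero coordinate, in the order of the list, is `1`. -/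
def normVec : List ι → (ι → k) → ι → k
  | [], p => p
  | σ :: l, p => if p σ = 0 then normVec l p else (p σ)⁻¹ • p

lemma normVec_mem_normSet {l : List ι} {p : ι → k} (h : ∃ σ ∈ l, p σ ≠ 0) :
    normVec l p ∈ normSet k l ∧ ∃ c : k, c ≠ 0 ∧ normVec l p = c • p := by
  induction l with
  | nil => simp at h
  | cons σ l ih =>
    by_cases hσ : p σ = 0
    · have h' : ∃ τ ∈ l, p τ ≠ 0 := by
        obtain ⟨τ, hτ, hτ'⟩ := h
        rcases List.mem_cons.mp hτ with rfl | hτ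
        · exact absurd hσ hτ'
        · exact ⟨τ, hτ, hτ'⟩
      obtain ⟨h1, c, hc, h2⟩ := ih h'
      rw [normVec, if_pos hσ]
      exact ⟨Or.inr ⟨by simp [h2, hσ], h1⟩, c, hc, h2⟩
    · rw [normVec, if_neg hσ]
      exact ⟨Or.inl (by simp [hσ]), _, inv_ne_zero hσ, rfl⟩

lemma normVec_smul_of_mem {l : List ι} {p : ι → k} (h : p ∈ normSet k l) {c : k} (hc : c ≠ 0) :
    normVec l (c • p) = p := by
  induction l with
  | nil => exact h.elim
  | cons σ l ih =>
    rcases h with h | ⟨h, h'⟩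
    · have h : p σ = 1 := h
      rw [normVec, if_neg (by simp [h, hc])]
      simp [h, hc, smul_smul]
    · have h : p σ = 0 := h
      rw [normVec, if_pos (by simp [h]), ih h']

lemma ne_zero_of_mem_normSet {l : List ι} {p : ι → k} (h : p ∈ normSet k l) : p ≠ 0 := by
  rintro rfl
  induction l with
  | nil => exact h
  | cons σ l ih =>
    rcases h with h | ⟨h, h'⟩
    · simp at h
    · exact ih h'

variable {Ω : Type u} {T : Subalgebra k (Ω → k)}

open Classical in
lemma ite_mem (hT : ∀ f ∈ T, f⁻¹ ∈ T) {g f₁ f₂ : Ω → k} (hg : g ∈ T) (h₁ : f₁ ∈ T)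
    (h₂ : f₂ ∈ T) : (fun x => if g x = 0 then f₁ x else f₂ x) ∈ T := by
  have : (fun x => if g x = 0 then f₁ x else f₂ x) = (1 - g * g⁻¹) * f₁ + g * g⁻¹ * f₂ := by
    ext x
    by_cases h : g x = 0 <;> simp [h]
  rw [this]
  exact add_mem (mul_mem (sub_mem (one_mem T) (mul_mem hg (hT g hg))) h₁)
    (mul_mem (mul_mem hg (hT g hg)) h₂)

lemma normVec_mem (hT : ∀ f ∈ T, f⁻¹ ∈ T) (l : List ι) {p : Ω → ι → k}
    (hp : ∀ i, (fun x => p x i) ∈ T) (i : ι) : (fun x => normVec l (p x) i) ∈ T := by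
  classical
  induction l with
  | nil => exact hp i
  | cons σ l ih =>
    have : (fun x => normVec (σ :: l) (p x) i) =
        fun x => if p x σ = 0 then normVec l (p x) i else (fun x => p x σ)⁻¹ x * p x i := by
      ext x
      by_cases h : p x σ = 0 <;> simp [normVec, h]
    rw [this]
    exact ite_mem hT (hp σ) ih (mul_mem (hT _ (hp σ)) (hp i))

lemma charFn_biInter_mem {α : Type*} (s : Finset α) {E : α → Set Ω}
    (h : ∀ a ∈ s, charFn k (E a) ∈ T) : charFn k (⋂ a ∈ s, E a) ∈ T := by
  classical
  induction s using Finset.induction_on with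
  | empty =>
    have : charFn k (Set.univ : Set Ω) = 1 := funext fun x => charFn_of_mem trivial
    simp [this]
  | insert a s _ ih =>
    rw [Finset.set_biInter_insert]
    exact charFn_inter_mem (h a (Finset.mem_insert_self a s))
      (ih fun b hb => h b (Finset.mem_insert_of_mem hb))

lemma charFn_eq_zero_mem (hT : ∀ f ∈ T, f⁻¹ ∈ T) {g : Ω → k} (hg : g ∈ T) :
    charFn k {x | g x = 0} ∈ T := by
  rw [charFn_eq_zero]
  exact sub_mem (one_mem T) (mul_mem hg (hT g hg))

/-- By the Hilbert basis theorem `C` is cut out by finitely many equations, and each zero set has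
indicator `1 - g * g⁻¹`. -/
lemma charFn_closed_mem [Finite ι] {C : Set (ι → k)}
    (h : ∀ p, (∀ F : MvPolynomial ι k, (∀ q ∈ C, MvPolynomial.eval q F = 0) →
      MvPolynomial.eval p F = 0) → p ∈ C) : charFn k C ∈ invClosure (coordAlg k ι) := by
  obtain ⟨s, hs⟩ := (isNoetherianRing_iff_ideal_fg (MvPolynomial ι k)).mp inferInstance
    (MvPolynomial.vanishingIdeal k C)
  have hC : C = ⋂ F ∈ s, {p | MvPolynomial.eval p F = 0} := by
    ext p
    simp only [Set.mem_iInter, Set.mem_ofPred_eq]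
    constructor
    · intro hp F hF
      have : F ∈ MvPolynomial.vanishingIdeal k C := hs ▸ Ideal.subset_span hF
      simpa [MvPolynomial.aeval_eq_eval] using this p hp
    · intro hp
      refine h p fun F hF => ?_
      have hF' : F ∈ Ideal.span (s : Set (MvPolynomial ι k)) := by
        rw [hs]; intro q hq; rw [MvPolynomial.aeval_eq_eval]; exact hF q hq
      have hle : Ideal.span (s : Set (MvPolynomial ι k)) ≤ RingHom.ker (MvPolynomial.eval p) :=
        Ideal.span_le.mpr fun G hG => hp G hG
      exact hle hF'
  rw [hC]
  exact charFn_biInter_mem s fun F _ => charFn_eq_zero_mem (fun _ => inv_mem_invClosure)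
    (le_invClosure _ (eval_mem_coordAlg F))

attribute [local instance] MvPolynomial.gradedAlgebra in
-- Every polynomial without constant term vanishes on `C`, so a point of the locus would contain the
-- irrelevant ideal. The variety is therefore empty.
lemma coneVariety_cls_eq_zero [Finite ι] {C : Set (ι → k)} (hC : C ⊆ {0}) :
    (coneVariety C).cls = 0 := by
  refine cls_eq_zero_of_isEmpty k ⟨fun y => ?_⟩
  have hy : (Scheme.IdealSheafData.vanishingIdeal (coneLocus C)).subschemeι y ∈
      (coneLocus C : Set (projSpace k ι)) := by
    rw [← Scheme.IdealSheafData.coe_support_vanishingIdeal,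
      ← Scheme.IdealSheafData.range_subschemeι]
    exact ⟨y, rfl⟩
  set x := (Scheme.IdealSheafData.vanishingIdeal (coneLocus C)).subschemeι y
  refine x.not_irrelevant_le fun F hF => hy fun p hp => ?_
  rw [hC hp, MvPolynomial.eval_zero]
  have : GradedRing.proj (MvPolynomial.homogeneousSubmodule ι k) 0 F = 0 := hF
  have h2 : MvPolynomial.homogeneousComponent 0 F = 0 := by
    rw [← this, GradedRing.proj_apply]
    exact (MvPolynomial.decomposition.decompose'_apply F 0).symm
  rw [MvPolynomial.homogeneousComponent_zero] at h2
  simpa [MvPolynomial.constantCoeff_eq] using h2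

/-- The class of a projective variety is that of its set of normalized vectors. -/
theorem hasCls_coneVariety [IsAlgClosed k] [Finite ι] (l : List ι) {C : Set (ι → k)}
    (hC : IsClosedCone C) (hl : ∀ p ∈ C, (∀ σ ∈ l, p σ = 0) → p = 0) :
    HasCls (coordAlg k ι) (C ∩ normSet k l) (coneVariety C).cls := by
  induction l generalizing C with
  | nil =>
    rw [coneVariety_cls_eq_zero fun p hp => hl p hp (by simp), normSet, Set.inter_empty]
    exact HasCls.empty _
  | cons σ l ih =>
    have h1 := ih (hC.inter_zero σ) fun p hp h => hl p hp.1 fun τ hτ => by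
      rcases List.mem_cons.mp hτ with rfl | hτ
      · exact hp.2
      · exact h τ hτ
    have hcl : ∀ p, (∀ F : MvPolynomial ι k, (∀ q ∈ C ∩ {p | p σ = 1},
        MvPolynomial.eval q F = 0) → MvPolynomial.eval p F = 0) → p ∈ C ∩ {p | p σ = 1} := by
      refine fun p hp => ⟨hC.closed p fun F hF => hp F fun q hq => hF q hq.1, ?_⟩
      have := hp (.X σ - 1) fun q hq => by simp [show q σ = 1 from hq.2]
      simpa [sub_eq_zero] using this
    have h2 := HasCls.of_isAff (isAff_of_closed hcl) (charFn_closed_mem hcl)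
    have h3 : Disjoint (C ∩ {p : ι → k | p σ = 0} ∩ normSet k l) (C ∩ {p | p σ = 1}) := by
      refine Set.disjoint_left.mpr fun p hp hp' => ?_
      have e1 : p σ = 0 := hp.1.2
      have e2 : p σ = 1 := hp'.2
      exact zero_ne_one (e1.symm.trans e2)
    have h4 := h1.add h2 h3
    rw [← coneVariety_cls_cut hC σ] at h4
    convert h4 using 1
    rw [normSet, Set.inter_union_distrib_left, Set.union_comm, Set.inter_assoc]

end Normalization

/-! ### Plücker coordinates -/

section Plucker

variable {k : Type*} [Field k] {V : Type*} [AddCommGroup V] [Module k V] {d : ℕ}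
  {J : Submodule k V}

/-- An alternating form that vanishes whenever one of its arguments is in `J`. -/
def FormMod (J : Submodule k V) (ω : V [⋀^Fin d]→ₗ[k] k) : Prop :=
  ∀ v : Fin d → V, (∃ i, v i ∈ J) → ω v = 0

lemma FormMod.update_add {ω : V [⋀^Fin d]→ₗ[k] k} (h : FormMod J ω) (v : Fin d → V) (i : Fin d)
    {x y : V} (hxy : x - y ∈ J) : ω (Function.update v i x) = ω (Function.update v i y) := by
  rw [← sub_eq_zero, ← ω.map_update_sub]
  exact h _ ⟨i, by simpa using hxy⟩

lemma FormMod.congr {ω : V [⋀^Fin d]→ₗ[k] k} (h : FormMod J ω) {v w : Fin d → V}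
    (hvw : ∀ i, v i - w i ∈ J) : ω v = ω w := by
  classical
  have key : ∀ s : Finset (Fin d), ω (s.piecewise v w) = ω w := by
    intro s
    induction s using Finset.induction_on with
    | empty => simp
    | insert i s hi ih =>
      rw [Finset.piecewise_insert, h.update_add _ i (hvw i), ← ih]
      congr 1
      rw [Function.update_eq_self_iff, Finset.piecewise_eq_of_notMem _ _ _ hi]
  simpa using key Finset.univ

lemma FormMod.exists_descend {ω : V [⋀^Fin d]→ₗ[k] k} (h : FormMod J ω) :
    ∃ ω' : (V ⧸ J) [⋀^Fin d]→ₗ[k] k, ∀ v, ω v = ω' fun i => J.mkQ (v i) := by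
  obtain ⟨s, hs⟩ := J.mkQ.exists_rightInverse_of_surjective J.range_mkQ
  refine ⟨ω.compLinearMap s, fun v => h.congr fun i => ?_⟩
  rw [← Submodule.Quotient.mk_eq_zero, Submodule.Quotient.mk_sub, sub_eq_zero]
  exact (DFunLike.congr_fun hs (J.mkQ (v i))).symm

/-- Two alternating forms of top degree on the quotient are proportional. -/
lemma FormMod.mul_eq_mul [Module.Finite k (V ⧸ J)] (hJ : Module.finrank k (V ⧸ J) = d)
    {ω₁ ω₂ : V [⋀^Fin d]→ₗ[k] k} (h₁ : FormMod J ω₁) (h₂ : FormMod J ω₂) (v b : Fin d → V) :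
    ω₂ v * ω₁ b = ω₁ v * ω₂ b := by
  obtain ⟨η₁, e₁⟩ := h₁.exists_descend
  obtain ⟨η₂, e₂⟩ := h₂.exists_descend
  let B := (Module.finBasis k (V ⧸ J)).reindex (finCongr hJ)
  rw [e₁, e₁, e₂, e₂, η₁.eq_smul_basis_det B, η₂.eq_smul_basis_det B]
  simp only [AlternatingMap.smul_apply, smul_eq_mul]
  ring

/-- This is Cramer's rule: replacing `b i` by a combination of the `b j` leaves only the `i`-th
term, since the other terms have a repeated argument. -/
lemma FormMod.update_sum {ω : V [⋀^Fin d]→ₗ[k] k} (h : FormMod J ω) {b : Fin d → V} {x : V}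
    {c : Fin d → k} (hx : x - ∑ j, c j • b j ∈ J) (i : Fin d) :
    ω (Function.update b i x) = c i * ω b := by
  classical
  rw [h.update_add b i hx, ω.map_update_sum, Finset.sum_eq_single i]
  · rw [ω.map_update_smul, Function.update_eq_self, smul_eq_mul]
  · intro j _ hj
    rw [ω.map_update_smul, ω.map_update_self _ hj.symm, smul_zero]
  · simp

lemma FormMod.exists_basis [Module.Finite k (V ⧸ J)] (hJ : Module.finrank k (V ⧸ J) = d)
    {ω : V [⋀^Fin d]→ₗ[k] k} (h : FormMod J ω) {b : Fin d → V} (hb : ω b ≠ 0) :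
    ∃ B : Module.Basis (Fin d) k (V ⧸ J), ∀ i, B i = J.mkQ (b i) := by
  obtain ⟨η, e⟩ := h.exists_descend
  have hli : LinearIndependent k fun i => J.mkQ (b i) := by
    by_contra hli
    exact hb ((e b).trans (η.map_linearDependent _ hli))
  refine ⟨Module.Basis.mk hli ?_, fun i => Module.Basis.mk_apply ..⟩
  rw [hli.span_eq_top_of_card_eq_finrank' (by simp [hJ])]

lemma FormMod.repr_mul [Module.Finite k (V ⧸ J)] {ω : V [⋀^Fin d]→ₗ[k] k} (h : FormMod J ω)
    {b : Fin d → V} (B : Module.Basis (Fin d) k (V ⧸ J)) (hB : ∀ i, B i = J.mkQ (b i)) (x : V)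
    (i : Fin d) : ω (Function.update b i x) = B.repr (J.mkQ x) i * ω b := by
  refine h.update_sum (c := fun i => B.repr (J.mkQ x) i) ?_ i
  rw [← Submodule.Quotient.mk_eq_zero]
  change J.mkQ _ = 0
  rw [map_sub, map_sum, sub_eq_zero]
  conv_lhs => rw [← B.sum_repr (J.mkQ x)]
  exact Finset.sum_congr rfl fun j _ => by rw [map_smul, hB]

lemma FormMod.mem_iff [Module.Finite k (V ⧸ J)] (hJ : Module.finrank k (V ⧸ J) = d)
    {ω : V [⋀^Fin d]→ₗ[k] k} (h : FormMod J ω) {b : Fin d → V} (hb : ω b ≠ 0) (x : V) :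
    x ∈ J ↔ ∀ i, ω (Function.update b i x) = 0 := by
  obtain ⟨B, hB⟩ := h.exists_basis hJ hb
  refine ⟨fun hx i => h _ ⟨i, by simpa using hx⟩, fun hx => ?_⟩
  rw [← Submodule.Quotient.mk_eq_zero]
  change J.mkQ x = 0
  rw [← B.repr.map_eq_zero_iff]
  ext i
  have := hx i
  rw [h.repr_mul B hB] at this
  simpa [hb] using this

/-- By Cramer's rule the matrix is `ω b` times the coordinate matrix of `v` in the basis given by
`b`. The factor `ω b` on the right avoids the exponent `d - 1` and so includes `d = 0`. -/
lemma FormMod.mul_pow_eq [Module.Finite k (V ⧸ J)] (hJ : Module.finrank k (V ⧸ J) = d)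
    {ω : V [⋀^Fin d]→ₗ[k] k} (h : FormMod J ω) {b : Fin d → V} (hb : ω b ≠ 0) (v : Fin d → V) :
    ω v * ω b ^ d = ω b * Matrix.det (Matrix.of fun i j => ω (Function.update b i (v j))) := by
  obtain ⟨B, hB⟩ := h.exists_basis hJ hb
  obtain ⟨η, e⟩ := h.exists_descend
  have h1 : Matrix.of (fun i j => ω (Function.update b i (v j))) =
      ω b • B.toMatrix fun j => J.mkQ (v j) := by
    ext i j
    rw [Matrix.of_apply, h.repr_mul B hB, Matrix.smul_apply, Module.Basis.toMatrix_apply,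
      smul_eq_mul, mul_comm]
  have h2 : η B = ω b := by
    rw [e]; congr 1; exact funext hB
  rw [h1, Matrix.det_smul, e v, η.eq_smul_basis_det B, AlternatingMap.smul_apply, h2,
    Module.Basis.det_apply, smul_eq_mul, Fintype.card_fin]
  ring

variable {n : ℕ} (e : Module.Basis (Fin n) k V)

/-- `p` is a vector of Plücker coordinates of the quotient by `J`. -/
def IsPl (J : Submodule k V) (p : (Fin d → Fin n) → k) : Prop :=
  ∃ ω : V [⋀^Fin d]→ₗ[k] k, FormMod J ω ∧ p = fun σ => ω fun i => e (σ i)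

/-- The equations of the quotient map in the chart of `σ`. -/
def chartMap (p : (Fin d → Fin n) → k) (σ : Fin d → Fin n) : V →ₗ[k] (Fin d → k) :=
  e.constr k fun j i => p (Function.update σ i j)

@[simp] lemma chartMap_basis (p : (Fin d → Fin n) → k) (σ : Fin d → Fin n) (j : Fin n)
    (i : Fin d) : chartMap e p σ (e j) i = p (Function.update σ i j) := by
  rw [chartMap, Module.Basis.constr_basis]

lemma chartMap_apply (ω : V [⋀^Fin d]→ₗ[k] k) (σ : Fin d → Fin n) (x : V) (i : Fin d) :
    chartMap e (fun σ => ω fun i => e (σ i)) σ x i =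
      ω (Function.update (fun i => e (σ i)) i x) := by
  have : (LinearMap.proj i).comp (chartMap e (fun σ => ω fun i => e (σ i)) σ) =
      ω.toMultilinearMap.toLinearMap (fun i => e (σ i)) i := by
    refine e.ext fun j => ?_
    rw [LinearMap.comp_apply, LinearMap.proj_apply, chartMap_basis]
    exact congrArg ω (Function.comp_update e σ i j)
  exact DFunLike.congr_fun this x

lemma chartMap_eq_sum (p : (Fin d → Fin n) → k) (σ : Fin d → Fin n) (x : V)
    (i : Fin d) : chartMap e p σ x i = ∑ j, e.repr x j * p (Function.update σ i j) := by
  conv_lhs => rw [← e.sum_repr x, map_sum, Finset.sum_apply]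
  simp

/-- Spanning vectors of `J` in the chart of `σ`. -/
def chartSpan (p : (Fin d → Fin n) → k) (σ : Fin d → Fin n) (j : Fin n) : V :=
  p σ • e j - ∑ i, p (Function.update σ i j) • e (σ i)

variable {e}

lemma IsPl.ker_chartMap [Module.Finite k (V ⧸ J)] (hJ : Module.finrank k (V ⧸ J) = d)
    {p : (Fin d → Fin n) → k} (hp : IsPl e J p) {σ : Fin d → Fin n} (hσ : p σ ≠ 0) :
    LinearMap.ker (chartMap e p σ) = J := by
  obtain ⟨ω, h, rfl⟩ := hp
  ext x
  rw [LinearMap.mem_ker, h.mem_iff hJ hσ, funext_iff]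
  simp only [chartMap_apply, Pi.zero_apply]

lemma IsPl.mul_pow_eq [Module.Finite k (V ⧸ J)] (hJ : Module.finrank k (V ⧸ J) = d)
    {p : (Fin d → Fin n) → k} (hp : IsPl e J p) {σ : Fin d → Fin n} (hσ : p σ ≠ 0)
    (τ : Fin d → Fin n) :
    p τ * p σ ^ d = p σ * Matrix.det (Matrix.of fun i j => p (Function.update σ i (τ j))) := by
  obtain ⟨ω, h, rfl⟩ := hp
  rw [h.mul_pow_eq hJ hσ]
  congr 3
  ext i j
  exact congrArg ω (Function.comp_update e σ i (τ j)).symm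

lemma IsPl.smul {p : (Fin d → Fin n) → k} (hp : IsPl e J p) (c : k) : IsPl e J (c • p) := by
  obtain ⟨ω, h, rfl⟩ := hp
  exact ⟨c • ω, fun v hv => by simp [h v hv], rfl⟩

lemma IsPl.exists_smul [Module.Finite k (V ⧸ J)] (hJ : Module.finrank k (V ⧸ J) = d)
    {p p' : (Fin d → Fin n) → k} (hp : IsPl e J p) (hp' : IsPl e J p') (h0 : p ≠ 0) (h0' : p' ≠ 0) :
    ∃ c : k, c ≠ 0 ∧ p' = c • p := by
  obtain ⟨σ, hσ⟩ := Function.ne_iff.mp h0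
  obtain ⟨ω, h, rfl⟩ := hp
  obtain ⟨ω', h', rfl⟩ := hp'
  have key : (fun σ : Fin d → Fin n => ω' fun i => e (σ i)) =
      ((ω' fun i => e (σ i)) / (ω fun i => e (σ i))) •
        fun σ : Fin d → Fin n => ω fun i => e (σ i) := by
    ext τ
    have := h.mul_eq_mul hJ h' (fun i => e (τ i)) (fun i => e (σ i))
    simp only [Pi.zero_apply] at hσ
    simp only [Pi.smul_apply, smul_eq_mul]
    field_simp
    linear_combination this
  refine ⟨_, ?_, key⟩
  intro hc
  rw [hc, zero_smul] at key
  exact h0' key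

lemma exists_isPl [Module.Finite k (V ⧸ J)] (hJ : Module.finrank k (V ⧸ J) = d) :
    ∃ p : (Fin d → Fin n) → k, IsPl e J p ∧ p ≠ 0 := by
  let B := (Module.finBasis k (V ⧸ J)).reindex (finCongr hJ)
  let ω : V [⋀^Fin d]→ₗ[k] k := B.det.compLinearMap J.mkQ
  refine ⟨_, ⟨ω, fun v ⟨i, hi⟩ => ?_, rfl⟩, fun h0 => ?_⟩
  · exact B.det.map_coord_zero i ((Submodule.Quotient.mk_eq_zero J).mpr hi)
  · have hω : ω = 0 := e.ext_alternating fun v _ => congrFun h0 v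
    have h1 : ω (fun i => Function.surjInv J.mkQ_surjective (B i)) = 1 := by
      change B.det (fun i => J.mkQ _) = 1
      simp only [Function.surjInv_eq]
      exact B.det_self
    rw [hω] at h1
    simp at h1

/-- The relations say that `p` is a multiple of the determinant pulled back along the chart map. The
relation for `τ = σ` makes the determinant at `σ` nonzero, so the chart map is surjective and its
kernel has codimension `d`. -/
lemma isPl_of_mul_pow_eq {p : (Fin d → Fin n) → k} {σ : Fin d → Fin n} (hσ : p σ ≠ 0)
    (h : ∀ τ : Fin d → Fin n, p τ * p σ ^ d =
      p σ * Matrix.det (Matrix.of fun i j => p (Function.update σ i (τ j)))) :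
    Module.finrank k (V ⧸ LinearMap.ker (chartMap e p σ)) = d ∧
      IsPl e (LinearMap.ker (chartMap e p σ)) p := by
  have hdet (v : Fin d → Fin n) : Matrix.det (Matrix.of fun i j => p (Function.update σ i (v j))) =
      Matrix.detRowAlternating fun i => chartMap e p σ (e (v i)) := by
    rw [← Matrix.det_transpose]
    congr 1
    ext i j
    simp
  constructor
  · have hne : (Matrix.of fun i => chartMap e p σ (e (σ i))).det ≠ 0 := by
      intro h0
      have := h σ
      rw [hdet] at this
      rw [show (Matrix.detRowAlternating fun i => chartMap e p σ (e (σ i))) = 0 from h0,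
        mul_zero] at this
      simp [hσ] at this
    have hli : LinearIndependent k fun i => chartMap e p σ (e (σ i)) :=
      Matrix.linearIndependent_rows_of_det_ne_zero hne
    have hsurj : Function.Surjective (chartMap e p σ) := by
      rw [← LinearMap.range_eq_top, eq_top_iff,
        ← hli.span_eq_top_of_card_eq_finrank' (by simp), Submodule.span_le]
      rintro _ ⟨i, rfl⟩
      exact ⟨_, rfl⟩
    rw [(LinearMap.quotKerEquivOfSurjective _ hsurj).finrank_eq]
    simp
  · refine ⟨(p σ / p σ ^ d) • Matrix.detRowAlternating.compLinearMap (chartMap e p σ),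
      fun v ⟨i, hi⟩ => ?_, ?_⟩
    · rw [AlternatingMap.smul_apply, AlternatingMap.compLinearMap_apply,
        AlternatingMap.map_coord_zero (m := fun i => chartMap e p σ (v i)) _ i
          (LinearMap.mem_ker.mp hi), smul_zero]
    · ext τ
      rw [AlternatingMap.smul_apply, AlternatingMap.compLinearMap_apply, ← hdet, smul_eq_mul,
        div_mul_eq_mul_div, ← h, mul_div_cancel_right₀ _ (pow_ne_zero d hσ)]

lemma IsPl.update_basis {p : (Fin d → Fin n) → k} (hp : IsPl e J p) (σ : Fin d → Fin n)
    (i i' : Fin d) : p (Function.update σ i' (σ i)) = if i = i' then p σ else 0 := by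
  obtain ⟨ω, h, rfl⟩ := hp
  split_ifs with hi
  · subst hi; simp
  · refine ω.map_eq_zero_of_eq _ (i := i) (j := i') ?_ hi
    simp [Function.update_of_ne hi]

/-- Expansion of a vector along the spanning vectors of the chart of `σ`. -/
lemma smul_eq_sum_chartSpan (p : (Fin d → Fin n) → k) (σ : Fin d → Fin n) (x : V) :
    p σ • x = ∑ j, e.repr x j • chartSpan e p σ j + ∑ i, chartMap e p σ x i • e (σ i) := by
  simp only [chartMap_eq_sum, chartSpan, smul_sub, Finset.sum_sub_distrib, Finset.sum_smul, Finset.smul_sum]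
  rw [Finset.sum_comm (f := fun i j => (e.repr x j * p (Function.update σ i j)) • e (σ i))]
  simp only [mul_smul, sub_add_cancel]
  conv_lhs => rw [← e.sum_repr x, Finset.smul_sum]
  exact Finset.sum_congr rfl fun j _ => smul_comm _ _ _

lemma IsPl.chartSpan_mem [Module.Finite k (V ⧸ J)] (hJ : Module.finrank k (V ⧸ J) = d)
    {p : (Fin d → Fin n) → k} (hp : IsPl e J p) {σ : Fin d → Fin n} (hσ : p σ ≠ 0) (j : Fin n) :
    chartSpan e p σ j ∈ J := by
  rw [← hp.ker_chartMap hJ hσ, LinearMap.mem_ker]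
  ext i
  rw [chartSpan, map_sub, map_sum]
  simp only [map_smul, Pi.sub_apply, Pi.smul_apply, chartMap_basis, Finset.sum_apply, smul_eq_mul,
    Pi.zero_apply, hp.update_basis]
  simp [mul_comm]

lemma IsPl.span_chartSpan [Module.Finite k (V ⧸ J)] (hJ : Module.finrank k (V ⧸ J) = d)
    {p : (Fin d → Fin n) → k} (hp : IsPl e J p) {σ : Fin d → Fin n} (hσ : p σ ≠ 0) :
    Submodule.span k (Set.range (chartSpan e p σ)) = J := by
  refine le_antisymm (Submodule.span_le.mpr ?_) fun x hx => ?_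
  · rintro _ ⟨j, rfl⟩
    exact hp.chartSpan_mem hJ hσ j
  · have h0 : chartMap e p σ x = 0 := by
      rwa [← hp.ker_chartMap hJ hσ, LinearMap.mem_ker] at hx
    have h1 := smul_eq_sum_chartSpan (e := e) p σ x
    rw [h0] at h1
    simp only [Pi.zero_apply, zero_smul, Finset.sum_const_zero, add_zero] at h1
    rw [← Submodule.smul_mem_iff _ hσ, h1]
    exact Submodule.sum_mem _ fun j _ => Submodule.smul_mem _ _ (Submodule.subset_span ⟨j, rfl⟩)

end Plucker

/-! ### Equations for ideals in Plücker coordinates -/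

section PluckerCone

variable {k : Type u} [Field k] {A : Type u} [CommRing A] [Algebra k A] {d : ℕ}

lemma finrank_quotient_restrictScalars (J : Ideal A) :
    Module.finrank k (A ⧸ J.restrictScalars k) = Module.finrank k (A ⧸ J) :=
  (Submodule.Quotient.restrictScalarsEquiv k J).finrank_eq

lemma mem_pluckerCone [Module.Finite k A] {p : PluckerIndex k A d → k} : p ∈ pluckerCone k A d ↔
    ∃ J : Ideal A, Module.finrank k (A ⧸ J.restrictScalars k) = d ∧
      IsPl (Module.finBasis k A) (J.restrictScalars k) p := by
  simp only [finrank_quotient_restrictScalars]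
  rfl

/-- If multiplication by basis vectors preserves the kernel of the chart map, it is an ideal. -/
lemma mul_mem_ker_chartMap {n : ℕ} {e : Module.Basis (Fin n) k A} {p : (Fin d → Fin n) → k}
    {σ : Fin d → Fin n} (hσ : p σ ≠ 0)
    (h : ∀ l j, chartMap e p σ (e l * chartSpan e p σ j) = 0) (a x : A)
    (hx : chartMap e p σ x = 0) : chartMap e p σ (a * x) = 0 := by
  have h1 := smul_eq_sum_chartSpan (e := e) p σ x
  rw [hx] at h1
  simp only [Pi.zero_apply, zero_smul, Finset.sum_const_zero, add_zero] at h1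
  have h2 : p σ • (a * x) = ∑ l, ∑ j, (e.repr a l * e.repr x j) • (e l * chartSpan e p σ j) := by
    rw [← mul_smul_comm, h1]
    conv_lhs => rw [← e.sum_repr a]
    rw [Finset.sum_mul_sum]
    refine Finset.sum_congr rfl fun l _ => Finset.sum_congr rfl fun j _ => ?_
    rw [smul_mul_smul_comm]
  have h3 : p σ • chartMap e p σ (a * x) = 0 := by
    rw [← map_smul, h2]
    simp [h]
  exact (smul_eq_zero_iff_right hσ).mp h3

/-- Ideals are a Zariski closed condition in Plücker coordinates. -/
theorem isClosedCone_pluckerCone [Module.Finite k A] : IsClosedCone (pluckerCone k A d) where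
  smul_mem p hp c := by
    rw [mem_pluckerCone] at hp ⊢
    obtain ⟨J, hJ, hp⟩ := hp
    exact ⟨J, hJ, hp.smul c⟩
  closed p hp := by
    set e := Module.finBasis k A with he
    by_cases h0 : p = 0
    · subst h0
      -- The zero vector lies in the cone only if some ideal of colength `d` exists. Otherwise the
      -- constant polynomial `1` vanishes on the empty cone but not at zero.
      have : (pluckerCone k A d).Nonempty := by
        by_contra hne
        rw [Set.not_nonempty_iff_eq_empty] at hne
        have := hp 1 (by simp [hne])
        simp at this
      obtain ⟨q, hq⟩ := this
      rw [mem_pluckerCone] at hq ⊢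
      obtain ⟨J, hJ, hq⟩ := hq
      exact ⟨J, hJ, by simpa using hq.smul 0⟩
    obtain ⟨σ, hσ⟩ := Function.ne_iff.mp h0
    have hσ : p σ ≠ 0 := hσ
    have h1 : ∀ τ : PluckerIndex k A d, p τ * p σ ^ d =
        p σ * Matrix.det (Matrix.of fun i j => p (Function.update σ i (τ j))) := by
      intro τ
      -- The leading factor `X σ` makes the equation hold on the whole cone, including vectors
      -- outside the chart of `σ`. It is cancelled at `p`, where the coordinate is nonzero.
      let F : MvPolynomial (PluckerIndex k A d) k := .X σ * (.X τ * .X σ ^ d - .X σ *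
        Matrix.det (Matrix.of fun i j => .X (Function.update σ i (τ j))))
      have hF : ∀ q, MvPolynomial.eval q F = q σ * (q τ * q σ ^ d - q σ *
          Matrix.det (Matrix.of fun i j => q (Function.update σ i (τ j)))) := by
        intro q
        simp only [F, map_mul, map_sub, map_pow, MvPolynomial.eval_X, RingHom.map_det]
        congr 4
        ext i j
        simp
      have := hp F fun q hq => by
        rw [hF]
        by_cases hqσ : q σ = 0
        · rw [hqσ, zero_mul]
        · rw [mem_pluckerCone] at hq
          obtain ⟨J, hJ, hq⟩ := hq
          rw [hq.mul_pow_eq hJ hqσ, sub_self, mul_zero]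
      rw [hF] at this
      exact sub_eq_zero.mp ((mul_eq_zero_iff_left hσ).mp this)
    have h2 : ∀ l j, chartMap e p σ (e l * chartSpan e p σ j) = 0 := by
      intro l j
      ext m
      let M : A → MvPolynomial (PluckerIndex k A d) k := fun y =>
        ∑ r, .C (e.repr y r) * .X (Function.update σ m r)
      have hM : ∀ q y, MvPolynomial.eval q (M y) = chartMap e q σ y m := by
        intro q y
        rw [chartMap_eq_sum]
        simp [M]
      let F : MvPolynomial (PluckerIndex k A d) k := .X σ * (.X σ * M (e l * e j) -
        ∑ i, .X (Function.update σ i j) * M (e l * e (σ i)))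
      have hF : ∀ q, MvPolynomial.eval q F =
          q σ * chartMap e q σ (e l * chartSpan e q σ j) m := by
        intro q
        simp only [F, map_mul, map_sub, map_sum, MvPolynomial.eval_X, hM, chartSpan, mul_sub,
          Finset.mul_sum, mul_smul_comm, map_smul, Pi.sub_apply, Finset.sum_apply, Pi.smul_apply,
          smul_eq_mul]
      have := hp F fun q hq => by
        rw [hF]
        by_cases hqσ : q σ = 0
        · rw [hqσ, zero_mul]
        · rw [mem_pluckerCone] at hq
          obtain ⟨J, hJ, hq⟩ := hq
          have h3 := hq.chartSpan_mem hJ hqσ j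
          have h4 : e l * chartSpan e q σ j ∈ J.restrictScalars k := J.mul_mem_left _ h3
          rw [← hq.ker_chartMap hJ hqσ, LinearMap.mem_ker] at h4
          rw [h4, Pi.zero_apply, mul_zero]
      rw [hF] at this
      exact (mul_eq_zero_iff_left hσ).mp this
    obtain ⟨h3, h4⟩ := isPl_of_mul_pow_eq (e := e) hσ h1
    let J : Ideal A :=
      { carrier := {x | chartMap e p σ x = 0}
        add_mem' := fun {a b} ha hb => by
          change chartMap e p σ (a + b) = 0
          rw [map_add, show chartMap e p σ a = 0 from ha, show chartMap e p σ b = 0 from hb, add_zero]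
        zero_mem' := map_zero _
        smul_mem' := fun a x hx => mul_mem_ker_chartMap hσ h2 a x hx }
    have hJ : J.restrictScalars k = LinearMap.ker (chartMap e p σ) := rfl
    rw [mem_pluckerCone]
    exact ⟨J, by rw [hJ]; exact h3, by rw [hJ]; exact h4⟩

end PluckerCone

/-! ### Families of subspaces given by piecewise regular functions -/

section DetForm

variable {k : Type*} [Field k] {V : Type*} [AddCommGroup V] [Module k V] {r d : ℕ}
  (B : Module.Basis (Fin r ⊕ Fin d) k V)

/-- The form `v ↦ det (w, v)`. -/
def detForm (w : Fin r → V) : V [⋀^Fin d]→ₗ[k] k where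
  toFun v := B.det (Sum.elim w v)
  map_update_add' {inst} v i x y := by
    obtain rfl : inst = instDecidableEqFin d := Subsingleton.elim _ _
    simp only [← Sum.update_elim_inr, B.det.map_update_add]
  map_update_smul' {inst} v i c x := by
    obtain rfl : inst = instDecidableEqFin d := Subsingleton.elim _ _
    simp only [← Sum.update_elim_inr, B.det.map_update_smul]
  map_eq_zero_of_eq' v i j hij hne :=
    B.det.map_eq_zero_of_eq _ (i := Sum.inr i) (j := Sum.inr j) (by simpa using hij) (by simpa)

lemma detForm_apply (w : Fin r → V) (v : Fin d → V) : detForm B w v = B.det (Sum.elim w v) := rfl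

/-- If some `v i` lies in `J`, then it and the `w` are `r + 1` vectors in a space of dimension `r`,
hence dependent. -/
lemma formMod_detForm {J : Submodule k V} [Module.Finite k J] (hJ : Module.finrank k J = r)
    {w : Fin r → V} (hw : ∀ i, w i ∈ J) : FormMod J (detForm B w) := by
  rintro v ⟨i, hi⟩
  rw [detForm_apply]
  refine B.det.map_linearDependent _ fun hli => ?_
  let f : Option (Fin r) → Fin r ⊕ Fin d := fun o => o.elim (Sum.inr i) Sum.inl
  have hf : Function.Injective f := by
    rintro (_ | a) (_ | b) h
    · rfl
    · simp [f] at h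
    · simp [f] at h
    · simpa [f] using h
  have h1 := hli.comp f hf
  let g : Option (Fin r) → J := fun o => o.elim ⟨v i, hi⟩ fun j => ⟨w j, hw j⟩
  have h2 : J.subtype ∘ g = Sum.elim w v ∘ f := by
    ext (_ | a) <;> rfl
  rw [← h2] at h1
  have h3 := (LinearIndependent.of_comp _ h1).fintype_card_le_finrank
  simp [hJ] at h3

/-- The vectors `w`, completed by lifts of a basis of `V ⧸ J`, form a basis of `V`, on which the
determinant is a unit. -/
lemma exists_detForm_ne_zero {J : Submodule k V} [Module.Finite k V]
    (hJ : Module.finrank k (V ⧸ J) = d)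
    {w : Fin r → V} (hw : ∀ i, w i ∈ J) (hli : LinearIndependent k w) :
    detForm B w ≠ 0 := by
  let b := (Module.finBasis k (V ⧸ J)).reindex (finCongr hJ)
  let v : Fin d → V := fun i => Function.surjInv J.mkQ_surjective (b i)
  have hv : (Submodule.Quotient.mk ∘ v : Fin d → V ⧸ J) = b :=
    funext fun i => Function.surjInv_eq J.mkQ_surjective (b i)
  have h1 : LinearIndependent k (fun i => (⟨w i, hw i⟩ : J)) :=
    LinearIndependent.of_comp J.subtype hli
  have h2 := h1.sumElim_of_quotient v (by rw [hv]; exact b.linearIndependent)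
  have h3 : Module.finrank k V = Fintype.card (Fin r ⊕ Fin d) := Module.finrank_eq_card_basis B
  have h4 := h2.span_eq_top_of_card_eq_finrank' h3.symm
  have h5 : IsUnit (B.det (Sum.elim w v)) := (Module.Basis.is_basis_iff_det B).mp ⟨h2, h4⟩
  intro h0
  rw [← detForm_apply, h0] at h5
  simp at h5

end DetForm

/-! ### Vectors and subspaces with coordinates in an algebra closed under inversion -/

section Definable

variable {k : Type u} [Field k] {Ω : Type u} {T : Subalgebra k (Ω → k)}

lemma det_mem {m : Type*} [Fintype m] [DecidableEq m] {M : Ω → Matrix m m k}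
    (hM : ∀ i j, (fun x => M x i j) ∈ T) : (fun x => (M x).det) ∈ T := by
  let N : Matrix m m T := Matrix.of fun i j => ⟨fun x => M x i j, hM i j⟩
  have : (fun x => (M x).det) = N.det.1 := by
    ext x
    have h := RingHom.map_det ((Pi.evalRingHom (fun _ => k) x).comp T.val.toRingHom) N
    exact h.symm
  rw [this]
  exact N.det.2

/-- Go through the finitely many `b` and use the formula for one with `g b ≠ 0`. Each case
distinction stays in `T` because the idempotent `g b * (g b)⁻¹` does. -/
lemma mem_of_piecewise (hT : ∀ f ∈ T, f⁻¹ ∈ T) {β : Type*} [Finite β] {g f' : β → Ω → k}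
    {f : Ω → k} (hg : ∀ b, g b ∈ T) (hf' : ∀ b, f' b ∈ T) (h : ∀ x b, g b x ≠ 0 → f x = f' b x)
    (hex : ∀ x, ∃ b, g b x ≠ 0) : f ∈ T := by
  classical
  have := Fintype.ofFinite β
  have key : ∀ s : Finset β, ∃ F ∈ T, ∀ x, (∃ b ∈ s, g b x ≠ 0) → f x = F x := by
    intro s
    induction s using Finset.induction_on with
    | empty => exact ⟨0, zero_mem T, by simp⟩
    | insert b s _ ih =>
      obtain ⟨F, hF, hF'⟩ := ih
      refine ⟨_, ite_mem hT (hg b) hF (hf' b), fun x hx => ?_⟩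
      by_cases hb : g b x = 0
      · rw [if_pos hb]
        refine hF' x ?_
        obtain ⟨c, hc, hc'⟩ := hx
        rcases Finset.mem_insert.mp hc with rfl | hc
        · exact absurd hb hc'
        · exact ⟨c, hc, hc'⟩
      · rw [if_neg hb]
        exact h x b hb
  obtain ⟨F, hF, hF'⟩ := key Finset.univ
  rw [show f = F from funext fun x => hF' x (by simpa using hex x)]
  exact hF

variable {n n' : ℕ} {V V' : Type*} [AddCommGroup V'] [Module k V'] [AddCommGroup V] [Module k V]

/-- A family of vectors with coordinates in `T`. -/
def DefVec (T : Subalgebra k (Ω → k)) (e : Module.Basis (Fin n) k V) (w : Ω → V) : Prop :=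
  ∀ j, (fun x => e.repr (w x) j) ∈ T

variable {e : Module.Basis (Fin n) k V} {e' : Module.Basis (Fin n') k V'}

lemma DefVec.const (v : V) : DefVec T e fun _ => v := fun j => T.algebraMap_mem (e.repr v j)

lemma DefVec.functional {w : Ω → V} (hw : DefVec T e w) (φ : V →ₗ[k] k) :
    (fun x => φ (w x)) ∈ T := by
  have : (fun x => φ (w x)) =
      ∑ j, (fun x => e.repr (w x) j) * algebraMap k (Ω → k) (φ (e j)) := by
    ext x
    conv_lhs => rw [← e.sum_repr (w x), map_sum]
    simp
  rw [this]
  exact sum_mem fun j _ => mul_mem (hw j) (T.algebraMap_mem _)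

lemma DefVec.map {w : Ω → V} (hw : DefVec T e w) (L : V →ₗ[k] V') :
    DefVec T e' fun x => L (w x) := fun j => hw.functional ((e'.coord j).comp L)

lemma DefVec.add {w w' : Ω → V} (hw : DefVec T e w) (hw' : DefVec T e w') :
    DefVec T e fun x => w x + w' x := fun j => by
  convert add_mem (hw j) (hw' j) using 1
  ext x; simp

lemma DefVec.smul {f : Ω → k} (hf : f ∈ T) {w : Ω → V} (hw : DefVec T e w) :
    DefVec T e fun x => f x • w x := fun j => by
  convert mul_mem hf (hw j) using 1
  ext x; simp

lemma DefVec.sum {α : Type*} (s : Finset α) {w : α → Ω → V} (hw : ∀ a, DefVec T e (w a)) :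
    DefVec T e fun x => ∑ a ∈ s, w a x := fun j => by
  have : (fun x => e.repr (∑ a ∈ s, w a x) j) = ∑ a ∈ s, fun x => e.repr (w a x) j := by
    ext x; simp
  rw [this]
  exact sum_mem fun a _ => hw a j

/-- Subspaces with Plücker coordinates in `T` have spanning vectors with coordinates in `T`. -/
lemma exists_defVec_span [Module.Finite k V] {d : ℕ} {J : Ω → Submodule k V}
    (hJ : ∀ x, Module.finrank k (V ⧸ J x) = d) {p : Ω → (Fin d → Fin n) → k}
    (hp : ∀ x, IsPl e (J x) (p x)) (hp0 : ∀ x, p x ≠ 0) (hpT : ∀ σ, (fun x => p x σ) ∈ T) :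
    ∃ w : (Fin d → Fin n) × Fin n → Ω → V, (∀ a, DefVec T e (w a)) ∧
      ∀ x, Submodule.span k (Set.range fun a => w a x) = J x := by
  -- The factor `p x a.1` removes the vectors of charts that do not contain the subspace, so one
  -- family of vectors serves all charts.
  refine ⟨fun a x => p x a.1 • chartSpan e (p x) a.1 a.2, fun a => ?_, fun x => ?_⟩
  · have : DefVec T e fun x => chartSpan e (p x) a.1 a.2 := by
      have h1 : DefVec T e fun x => p x a.1 • e a.2 := (DefVec.const _).smul (hpT _)
      have h2 : DefVec T e fun x => ∑ i, p x (Function.update a.1 i a.2) • e (a.1 i) :=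
        DefVec.sum _ fun i => (DefVec.const _).smul (hpT _)
      have h3 := h1.add (h2.smul (T.algebraMap_mem (-1)))
      simpa [chartSpan, sub_eq_add_neg] using h3
    exact this.smul (hpT _)
  · refine le_antisymm (Submodule.span_le.mpr ?_) ?_
    · rintro _ ⟨a, rfl⟩
      by_cases ha : p x a.1 = 0
      · simp [ha]
      · exact (J x).smul_mem _ ((hp x).chartSpan_mem (hJ x) ha a.2)
    · obtain ⟨σ, hσ⟩ := Function.ne_iff.mp (hp0 x)
      conv_lhs => rw [← (hp x).span_chartSpan (hJ x) hσ]
      refine Submodule.span_le.mpr ?_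
      rintro _ ⟨j, rfl⟩
      rw [SetLike.mem_coe, ← Submodule.smul_mem_iff _ hσ]
      exact Submodule.subset_span ⟨(σ, j), rfl⟩

/-- Subspaces with spanning vectors in `T` have normalized Plücker coordinates in `T`. -/
lemma normVec_mem_of_span [Module.Finite k V] (hT : ∀ f ∈ T, f⁻¹ ∈ T) {d : ℕ}
    {J : Ω → Submodule k V} (hJ : ∀ x, Module.finrank k (V ⧸ J x) = d)
    {α : Type*} [Finite α] {w : α → Ω → V} (hw : ∀ a, DefVec T e (w a))
    (hspan : ∀ x, Submodule.span k (Set.range fun a => w a x) = J x)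
    {p : Ω → (Fin d → Fin n) → k} (hp : ∀ x, IsPl e (J x) (p x)) (hp0 : ∀ x, p x ≠ 0)
    (l : List (Fin d → Fin n)) (hl : ∀ σ, σ ∈ l) (τ : Fin d → Fin n) :
    (fun x => normVec l (p x) τ) ∈ T := by
  rcases isEmpty_or_nonempty Ω with hΩ | ⟨⟨x₀⟩⟩
  · rw [Subsingleton.elim (fun x => normVec l (p x) τ) 0]
    exact zero_mem T
  have hn : Module.finrank k V = n := by
    rw [Module.finrank_eq_card_basis e, Fintype.card_fin]
  have hr : ∀ x, Module.finrank k (J x) = n - d := fun x => by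
    have := Submodule.finrank_quotient_add_finrank (J x)
    have := hJ x
    omega
  have hdn : n - d + d = n := by
    have := Submodule.finrank_quotient_add_finrank (J x₀)
    have := hJ x₀
    omega
  let B : Module.Basis (Fin (n - d) ⊕ Fin d) k V :=
    e.reindex ((finCongr hdn.symm).trans finSumFinEquiv.symm)
  -- Each choice `S` of `n - d` spanning vectors gives a candidate Plücker vector with determinants
  -- as entries. It is nonzero if the chosen vectors are independent, and a nonzero candidate is
  -- proportional to `p x`, so both have the same normalization.
  let P : (Fin (n - d) → α) → Ω → (Fin d → Fin n) → k := fun S x σ =>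
    detForm B (fun i => w (S i) x) fun i => e (σ i)
  have hwJ : ∀ x a, w a x ∈ J x := fun x a => by
    rw [← hspan]; exact Submodule.subset_span ⟨a, rfl⟩
  have hP : ∀ S x, IsPl e (J x) (P S x) := fun S x =>
    ⟨_, formMod_detForm B (hr x) fun i => hwJ x _, rfl⟩
  have hPT : ∀ S σ, (fun x => P S x σ) ∈ T := by
    intro S σ
    simp only [P, detForm_apply, Module.Basis.det_apply]
    refine det_mem fun i j => ?_
    simp only [Module.Basis.toMatrix_apply, B, Module.Basis.repr_reindex_apply]
    rcases j with j | j
    · exact hw (S j) _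
    · exact T.algebraMap_mem (e.repr (e (σ j)) _)
  refine mem_of_piecewise hT (β := (Fin (n - d) → α) × (Fin d → Fin n))
    (g := fun b x => P b.1 x b.2) (f' := fun b x => normVec l (P b.1 x) τ)
    (fun b => hPT b.1 b.2) (fun b => normVec_mem hT l (hPT b.1) τ) ?_ ?_
  · rintro x ⟨S, σ⟩ hb
    have h0 : P S x ≠ 0 := fun h => hb (congrFun h σ)
    obtain ⟨c, hc, h1⟩ := (hP S x).exists_smul (hJ x) (hp x) h0 (hp0 x)
    obtain ⟨h2, c', hc', h3⟩ := normVec_mem_normSet (l := l) ⟨σ, hl σ, hb⟩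
    have h4 : p x = (c * c'⁻¹) • normVec l (P S x) := by
      rw [h1, h3, smul_smul, mul_assoc, inv_mul_cancel₀ hc', mul_one]
    change normVec l (p x) τ = normVec l (P S x) τ
    conv_lhs => rw [h4]
    rw [normVec_smul_of_mem h2 (mul_ne_zero hc (inv_ne_zero hc'))]
  · intro x
    obtain ⟨f, hf, -, hli⟩ := Submodule.exists_fun_fin_finrank_span_eq k
      (Set.range fun a => w a x)
    have hfr : Module.finrank k (Submodule.span k (Set.range fun a => w a x)) = n - d := by
      rw [hspan, hr]
    let f' : Fin (n - d) → V := f ∘ Fin.cast hfr.symm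
    have hf' : ∀ i, ∃ a, w a x = f' i := fun i => hf _
    choose S hS using hf'
    have hli' : LinearIndependent k fun i => w (S i) x := by
      rw [show (fun i => w (S i) x) = f' from funext hS]
      exact hli.comp _ (Fin.cast_injective _)
    have hne := exists_detForm_ne_zero B (hJ x) (fun i => hwJ x (S i)) hli'
    by_contra! hcon
    exact hne (e.ext_alternating fun σ _ => hcon (S, σ))

/-- The condition `J ≤ K` is constructible. -/
lemma charFn_le_mem (hT : ∀ f ∈ T, f⁻¹ ∈ T) [Module.Finite k V] {J : Ω → Submodule k V}
    {α : Type*} [Finite α] {w : α → Ω → V} (hw : ∀ a, DefVec T e (w a))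
    (hspan : ∀ x, Submodule.span k (Set.range fun a => w a x) = J x) (K : Submodule k V) :
    charFn k {x | J x ≤ K} ∈ T := by
  have := Fintype.ofFinite α
  let b := Module.finBasis k (V ⧸ K)
  have : {x | J x ≤ K} = ⋂ a ∈ (Finset.univ : Finset α), ⋂ j ∈ (Finset.univ : Finset (Fin _)),
      {x | (b.coord j).comp K.mkQ (w a x) = 0} := by
    ext x
    simp only [Finset.mem_univ, Set.iInter_true, Set.mem_iInter, Set.mem_ofPred_eq]
    rw [← hspan, Submodule.span_le, Set.range_subset_iff]
    refine forall_congr' fun a => ?_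
    rw [SetLike.mem_coe, ← Submodule.Quotient.mk_eq_zero, ← b.forall_coord_eq_zero_iff]
    rfl
  rw [this]
  exact charFn_biInter_mem _ fun a _ => charFn_biInter_mem _ fun j _ =>
    charFn_eq_zero_mem hT ((hw a).functional _)

end Definable

/-! ### Classes of families of ideals -/

section ColengthIdeal

variable {k : Type u} [Field k] {A : Type u} [CommRing A] [Algebra k A]

/-- The ideals of colength `d` that contain `N`. -/
abbrev ColengthIdeal (k : Type u) [Field k] {A : Type u} [CommRing A] [Algebra k A]
    (N : Ideal A) (d : ℕ) : Type u :=
  {I : Ideal A // Module.finrank k (A ⧸ I) = d ∧ N ≤ I}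

variable {N : Ideal A} {d : ℕ}

/-- The subspace of `A ⧸ N` defined by an ideal of `A`. -/
def ColengthIdeal.sub (I : ColengthIdeal k N d) : Submodule k (A ⧸ N) :=
  (I.1.map (Ideal.Quotient.mk N)).restrictScalars k

lemma ColengthIdeal.finrank_sub (I : ColengthIdeal k N d) :
    Module.finrank k ((A ⧸ N) ⧸ I.sub) = d := by
  rw [ColengthIdeal.sub, finrank_quotient_restrictScalars]
  exact (DoubleQuot.quotQuotEquivQuotOfLEₐ k I.2.2).toLinearEquiv.finrank_eq.trans I.2.1

lemma ColengthIdeal.sub_eq_map (I : ColengthIdeal k N d) :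
    I.sub = (I.1.restrictScalars k).map (Ideal.Quotient.mkₐ k N).toLinearMap := by
  ext y
  simp only [ColengthIdeal.sub, Submodule.restrictScalars_mem,
    Ideal.mem_map_iff_of_surjective _ Ideal.Quotient.mk_surjective, Submodule.mem_map]
  rfl

lemma ColengthIdeal.comap_sub (I : ColengthIdeal k N d) :
    I.sub.comap (Ideal.Quotient.mkₐ k N).toLinearMap = I.1.restrictScalars k := by
  ext y
  change Ideal.Quotient.mk N y ∈ I.1.map (Ideal.Quotient.mk N) ↔ y ∈ I.1
  rw [← Ideal.mem_comap, Ideal.comap_map_of_surjective _ Ideal.Quotient.mk_surjective,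
    ← RingHom.ker_eq_comap_bot, Ideal.mk_ker, sup_eq_left.mpr I.2.2]

variable [Module.Finite k (A ⧸ N)]

lemma ColengthIdeal.exists_isPl (I : ColengthIdeal k N d) :
    ∃ p, IsPl (d := d) (Module.finBasis k (A ⧸ N)) I.sub p ∧ p ≠ 0 :=
  HilbZeta.exists_isPl I.finrank_sub

/-- All Plücker indices, in some order. -/
def pluckerList (k : Type u) [Field k] (A : Type u) [CommRing A] [Algebra k A]
    (d : ℕ) : List (PluckerIndex k A d) :=
  Finset.univ.toList

lemma mem_pluckerList (k : Type u) [Field k] (A : Type u) [CommRing A] [Algebra k A]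
    {d : ℕ} (σ : PluckerIndex k A d) : σ ∈ pluckerList k A d := by
  simp [pluckerList]

/-- The Plücker vector of an ideal, with first nonzero coordinate `1`. -/
def ColengthIdeal.pl (I : ColengthIdeal k N d) : PluckerIndex k (A ⧸ N) d → k :=
  normVec (pluckerList k (A ⧸ N) d) I.exists_isPl.choose

lemma exists_mem_pluckerList_ne_zero {p : PluckerIndex k A d → k} (hp : p ≠ 0) :
    ∃ σ ∈ pluckerList k A d, p σ ≠ 0 := by
  obtain ⟨σ, hσ⟩ := Function.ne_iff.mp hp
  exact ⟨σ, mem_pluckerList k A σ, hσ⟩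

lemma ColengthIdeal.pl_mem (I : ColengthIdeal k N d) :
    I.pl ∈ normSet k (pluckerList k (A ⧸ N) d) :=
  (normVec_mem_normSet (exists_mem_pluckerList_ne_zero I.exists_isPl.choose_spec.2)).1

lemma ColengthIdeal.isPl_pl (I : ColengthIdeal k N d) :
    IsPl (Module.finBasis k (A ⧸ N)) I.sub I.pl := by
  obtain ⟨c, -, h⟩ :=
    (normVec_mem_normSet (exists_mem_pluckerList_ne_zero I.exists_isPl.choose_spec.2)).2
  rw [ColengthIdeal.pl, h]
  exact I.exists_isPl.choose_spec.1.smul c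

lemma ColengthIdeal.pl_ne_zero (I : ColengthIdeal k N d) : I.pl ≠ 0 :=
  ne_zero_of_mem_normSet I.pl_mem

lemma ColengthIdeal.normVec_pl (I : ColengthIdeal k N d) :
    normVec (pluckerList k (A ⧸ N) d) I.pl = I.pl := by
  simpa using normVec_smul_of_mem I.pl_mem one_ne_zero

/-- The regular functions on the set of ideals of colength `d`. -/
def idealAlg (k : Type u) [Field k] {A : Type u} [CommRing A] [Algebra k A] (N : Ideal A)
    [Module.Finite k (A ⧸ N)] (d : ℕ) : Subalgebra k (ColengthIdeal k N d → k) :=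
  (coordAlg k (PluckerIndex k (A ⧸ N) d)).map (pull ColengthIdeal.pl)

lemma idealAlg_fg : (idealAlg k N d).FG := coordAlg_fg.map _

lemma map_pull_coordAlg_le {Ω : Type u} {ι : Type} {p : Ω → ι → k} {T : Subalgebra k (Ω → k)}
    (h : ∀ i, (fun x => p x i) ∈ T) :
    (coordAlg k ι).map (pull p) ≤ T := by
  rw [coordAlg, MvPolynomial.aeval_range, AlgHom.map_adjoin, Algebra.adjoin_le_iff]
  rintro _ ⟨_, ⟨i, rfl⟩, rfl⟩
  exact h i

lemma ColengthIdeal.pl_coord_mem (σ : PluckerIndex k (A ⧸ N) d) :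
    (fun I : ColengthIdeal k N d => I.pl σ) ∈ idealAlg k N d :=
  ⟨_, coord_mem_coordAlg σ, rfl⟩

/-- Plücker vectors of a quotient are unique up to a scalar, so a normalized point of the cone is
the chosen vector `pl` of its ideal. Ideals thus become the points of the variety. -/
lemma range_pl : Set.range (ColengthIdeal.pl (k := k) (N := N) (d := d)) =
    pluckerCone k (A ⧸ N) d ∩ normSet k (pluckerList k (A ⧸ N) d) := by
  ext p
  constructor
  · rintro ⟨I, rfl⟩
    exact ⟨mem_pluckerCone.mpr ⟨_, I.finrank_sub, I.isPl_pl⟩, I.pl_mem⟩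
  · rintro ⟨hp, hn⟩
    obtain ⟨J, hJ, hp⟩ := mem_pluckerCone.mp hp
    have hle : N ≤ J.comap (Ideal.Quotient.mk N) := by
      intro y hy
      rw [Ideal.mem_comap, Ideal.Quotient.eq_zero_iff_mem.mpr hy]
      exact J.zero_mem
    have hmap : (J.comap (Ideal.Quotient.mk N)).map (Ideal.Quotient.mk N) = J :=
      Ideal.map_comap_of_surjective _ Ideal.Quotient.mk_surjective J
    let I : ColengthIdeal k N d := ⟨J.comap (Ideal.Quotient.mk N), by
      refine (DoubleQuot.quotQuotEquivQuotOfLEₐ k hle).toLinearEquiv.finrank_eq.symm.trans ?_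
      change Module.finrank k (_ ⧸ Ideal.map (Ideal.Quotient.mk N) _) = d
      rw [hmap, ← finrank_quotient_restrictScalars, hJ], hle⟩
    have hI : I.sub = J.restrictScalars k := by rw [ColengthIdeal.sub, hmap]
    refine ⟨I, ?_⟩
    have h1 : IsPl (Module.finBasis k (A ⧸ N)) I.sub p := by rwa [hI]
    obtain ⟨c, hc, h⟩ := h1.exists_smul I.finrank_sub I.isPl_pl (ne_zero_of_mem_normSet hn)
      I.pl_ne_zero
    rw [← I.normVec_pl, h, normVec_smul_of_mem hn hc]

/-- The set of all ideals of colength `d` has the class of `idealVariety`. -/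
theorem hasCls_colengthIdeal [IsAlgClosed k] :
    HasCls (idealAlg k N d) Set.univ (idealVariety k (A ⧸ N) d).cls := by
  have h := hasCls_coneVariety (pluckerList k (A ⧸ N) d)
    (isClosedCone_pluckerCone (k := k) (A := A ⧸ N) (d := d))
    (fun p _ h => funext fun σ => h σ (mem_pluckerList _ _ σ))
  rw [← range_pl] at h
  have h' := h.preimage subset_rfl
  rwa [Set.preimage_range] at h'

lemma exists_defVec_sub {T : Type u} (i : T → ColengthIdeal k N d)
    {S : Subalgebra k (T → k)} (hS : (idealAlg k N d).map (pull i) ≤ S) :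
    ∃ w : PluckerIndex k (A ⧸ N) d × Fin (Module.finrank k (A ⧸ N)) → T → A ⧸ N,
      (∀ a, DefVec S (Module.finBasis k (A ⧸ N)) (w a)) ∧
        ∀ x, Submodule.span k (Set.range fun a => w a x) = (i x).sub :=
  exists_defVec_span (fun x => (i x).finrank_sub) (fun x => (i x).isPl_pl)
    (fun x => (i x).pl_ne_zero)
    fun σ => hS ⟨_, ColengthIdeal.pl_coord_mem σ, rfl⟩

/-- The condition that an ideal is contained in a given subspace is constructible. -/
lemma charFn_ideal_le_mem (K : Submodule k A) :
    charFn k {I : ColengthIdeal k N d | I.1.restrictScalars k ≤ K} ∈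
      invClosure (idealAlg k N d) := by
  by_cases hK : N.restrictScalars k ≤ K
  · obtain ⟨w, hw, hspan⟩ := exists_defVec_sub (k := k) (N := N) (d := d) id
      (S := invClosure (idealAlg k N d)) (by
        rintro _ ⟨f, hf, rfl⟩
        exact le_invClosure _ hf)
    have h := charFn_le_mem (fun f hf => inv_mem_invClosure hf) hw hspan
      (K.map (Ideal.Quotient.mkₐ k N).toLinearMap)
    convert h using 3
    ext I
    change _ ≤ _ ↔ I.sub ≤ _
    rw [I.sub_eq_map]
    refine ⟨fun h => Submodule.map_mono h, fun h y hy => ?_⟩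
    obtain ⟨z, hz, hzy⟩ := h ⟨y, hy, rfl⟩
    have : y - z ∈ N := (Ideal.Quotient.mk_eq_mk_iff_sub_mem y z).mp hzy.symm
    simpa using K.add_mem (hK this) hz
  · have : {I : ColengthIdeal k N d | I.1.restrictScalars k ≤ K} = ∅ := by
      ext I
      simp only [Set.mem_ofPred_eq, Set.mem_empty_iff_false, iff_false]
      exact fun h => hK (le_trans (fun y hy => I.2.2 hy) h)
    rw [this]
    have h0 : charFn k (∅ : Set (ColengthIdeal k N d)) = 0 :=
      funext fun x => charFn_of_notMem (by simp)
    rw [h0]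
    exact zero_mem _

variable {N' : Ideal A} {d' : ℕ} [Module.Finite k (A ⧸ N')]

/-- Spanning vectors of `I` have coordinates in the algebra of the first family. Applying `L` gives
spanning vectors of `I'`, and determinants turn these into normalized Plücker coordinates. -/
lemma map_pull_idealAlg_le_of_map {E : Type u} {i : E → ColengthIdeal k N d}
    {i' : E → ColengthIdeal k N' d'} (L : A →ₗ[k] A)
    (h : ∀ x, (i' x).1.restrictScalars k = ((i x).1.restrictScalars k).map L) :
    (idealAlg k N' d').map (pull i') ≤ invClosure ((idealAlg k N d).map (pull i)) := by
  set T := invClosure ((idealAlg k N d).map (pull i))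
  obtain ⟨w, hw, hspan⟩ := exists_defVec_sub i (le_invClosure _ : _ ≤ T)
  let q : A →ₗ[k] A ⧸ N := (Ideal.Quotient.mkₐ k N).toLinearMap
  let q' : A →ₗ[k] A ⧸ N' := (Ideal.Quotient.mkₐ k N').toLinearMap
  have hq : Function.Surjective q := Ideal.Quotient.mk_surjective
  obtain ⟨s, hs⟩ := q.exists_rightInverse_of_surjective (LinearMap.range_eq_top.mpr hq)
  -- `L` need not map `N` into `N'`. The image of `L N` in `A ⧸ N'` is finite-dimensional and
  -- independent of `x`, so it contributes finitely many constant vectors.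
  obtain ⟨t, ht⟩ := (IsNoetherian.noetherian ((N.restrictScalars k).map (q' ∘ₗ L)) :
    ((N.restrictScalars k).map (q' ∘ₗ L)).FG)
  have hkey : ∀ x, (i x).1.restrictScalars k =
      (i x).sub.map s ⊔ N.restrictScalars k := by
    intro x
    rw [← (i x).comap_sub]
    have hker : LinearMap.ker q = N.restrictScalars k := by
      ext y
      exact Ideal.Quotient.eq_zero_iff_mem
    have h1 : (i x).sub = ((i x).sub.map s).map q := by
      rw [← Submodule.map_comp, hs, Submodule.map_id]
    conv_lhs => rw [h1]
    change Submodule.comap q _ = _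
    rw [Submodule.comap_map_eq, hker]
  have hspan' : ∀ x, Submodule.span k (Set.range fun a : _ ⊕ t =>
      (Sum.elim (fun b x => q' (L (s (w b x)))) (fun c _ => c.1) a : E → A ⧸ N') x) =
        (i' x).sub := by
    intro x
    rw [(i' x).sub_eq_map, h, hkey, Submodule.map_sup, Submodule.map_sup, ← hspan,
      Submodule.map_span, Submodule.map_span, Submodule.map_span,
      ← Submodule.map_comp L, ← ht, ← Submodule.span_union]
    congr 1
    ext y
    simp [q']
  have hpl : ∀ σ, (fun x => (i' x).pl σ) ∈ T := by
    intro σ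
    have := normVec_mem_of_span (T := T) (fun f hf => inv_mem_invClosure hf)
      (fun x => (i' x).finrank_sub) (e := Module.finBasis k (A ⧸ N')) ?_ hspan'
      (fun x => (i' x).isPl_pl) (fun x => (i' x).pl_ne_zero) (pluckerList k (A ⧸ N') d')
      (mem_pluckerList _ _) σ
    · simpa only [ColengthIdeal.normVec_pl] using this
    · rintro (b | c)
      · exact (hw b).map (q' ∘ₗ L ∘ₗ s)
      · exact DefVec.const _
  have h2 : (idealAlg k N' d').map (pull i') =
      (coordAlg k _).map (pull fun x => (i' x).pl) := by
    rw [idealAlg, Subalgebra.map_map]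
    rfl
  rw [h2]
  exact map_pull_coordAlg_le hpl

/-- Linear correspondences between families of ideals preserve the class. -/
theorem HasCls.eq_of_linear [IsAlgClosed k] {E : Type u} {i : E → ColengthIdeal k N d}
    {i' : E → ColengthIdeal k N' d'} {m m' : K0 k}
    (hm : HasCls (idealAlg k N d) (Set.range i) m)
    (hm' : HasCls (idealAlg k N' d') (Set.range i') m') (L L' : A →ₗ[k] A)
    (h : ∀ x, (i' x).1.restrictScalars k = ((i x).1.restrictScalars k).map L)
    (h' : ∀ x, (i x).1.restrictScalars k = ((i' x).1.restrictScalars k).map L') : m = m' :=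
  hm.eq_of_bijection hm' idealAlg_fg idealAlg_fg i i' rfl rfl
    (map_pull_idealAlg_le_of_map L' h') (map_pull_idealAlg_le_of_map L h)

end ColengthIdeal

/-! ### Rationality of generating functions of eventually shift invariant arrays -/

section ShiftArray

variable {ι : Type*} [DecidableEq ι] {M : Type*} [CommRing M]

/-- An array `h a d`, with `a` in an orthant and `d` a natural number, that is supported near the
hyperplane `∑ a = d`, is invariant under the shift in direction `i` where `γ i ≤ a i` if `i ∉ s`,
and is zero where `γ i < a i` if `i ∈ s`. -/
structure IsShiftArray [Fintype ι] (γ : ι → ℕ) (δ G : ℕ) (s : Finset ι) (h : (ι → ℕ) → ℕ → M) : Prop where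
  le_of_ne_zero : ∀ a d, h a d ≠ 0 → ∀ i, a i ≤ d + δ
  le_sum_of_ne_zero : ∀ a d, h a d ≠ 0 → d + δ ≤ ∑ i, a i + G
  zero : ∀ a, a ≠ 0 → h a 0 = 0
  shift : ∀ i ∉ s, ∀ a d, γ i ≤ a i → h (a + Pi.single i 1) (d + 1) = h a d
  eq_zero : ∀ i ∈ s, ∀ a d, γ i < a i → h a d = 0

/-- The finite set of indices that contains the support of `h · d`. -/
def arrayBox (ι : Type*) [Fintype ι] [DecidableEq ι] (δ d : ℕ) : Finset (ι → ℕ) :=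
  Fintype.piFinset fun _ => Finset.range (d + δ + 1)

/-- The generating function of an array. -/
def arraySeries [Fintype ι] (δ : ℕ) (h : (ι → ℕ) → ℕ → M) : PowerSeries M :=
  PowerSeries.mk fun d => ∑ a ∈ arrayBox ι δ d, h a d

/-- The array `h` shifted by one in direction `i`. -/
def arrayShift (i : ι) (h : (ι → ℕ) → ℕ → M) (a : ι → ℕ) (d : ℕ) : M :=
  if a i = 0 ∨ d = 0 then 0 else h (a - Pi.single i 1) (d - 1)

lemma arrayShift_add_single (i : ι) (h : (ι → ℕ) → ℕ → M) (a : ι → ℕ) (d : ℕ) :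
    arrayShift i h (a + Pi.single i 1) (d + 1) = h a d := by
  simp [arrayShift]

lemma sub_single_add_single {i : ι} {a : ι → ℕ} (hi : a i ≠ 0) :
    a - Pi.single i 1 + Pi.single i 1 = a := by
  ext j
  by_cases hj : j = i
  · subst hj; simp; omega
  · simp [hj]

lemma arrayShift_ne_zero {i : ι} {h : (ι → ℕ) → ℕ → M} {a : ι → ℕ} {d : ℕ}
    (hne : arrayShift i h a d ≠ 0) :
    ∃ b e, a = b + Pi.single i 1 ∧ d = e + 1 ∧ h b e ≠ 0 := by
  unfold arrayShift at hne
  split_ifs at hne with hc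
  · exact absurd rfl hne
  · push Not at hc
    exact ⟨_, d - 1, (sub_single_add_single hc.1).symm, by omega, hne⟩

variable [Fintype ι] {γ : ι → ℕ} {δ G : ℕ} {s : Finset ι} {h : (ι → ℕ) → ℕ → M}

/-- Shift invariance in direction `i` makes the difference vanish beyond `γ i`, and shifts in
different directions commute. At the boundary `d = 0`, where `arrayShift` is truncated, the field
`zero` supplies the missing identities. -/
lemma IsShiftArray.sub_arrayShift (H : IsShiftArray γ δ G s h) {i : ι} (hi : i ∉ s) :
    IsShiftArray γ δ G (insert i s) (fun a d => h a d - arrayShift i h a d) := by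
  have key : ∀ a d, h a d - arrayShift i h a d ≠ 0 → h a d ≠ 0 ∨ arrayShift i h a d ≠ 0 := by
    intro a d hne
    by_contra! hc
    simp [hc.1, hc.2] at hne
  refine ⟨fun a d hne j => ?_, fun a d hne => ?_, fun a ha => ?_, fun j hj a d hja => ?_,
    fun j hj a d hja => ?_⟩
  · rcases key a d hne with h1 | h1
    · exact H.le_of_ne_zero a d h1 j
    · obtain ⟨b, e, rfl, rfl, h2⟩ := arrayShift_ne_zero h1
      have h3 := H.le_of_ne_zero b e h2 j
      have : (Pi.single i 1 : ι → ℕ) j ≤ 1 := by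
        by_cases hj : j = i
        · subst hj; simp
        · simp [hj]
      rw [Pi.add_apply]
      omega
  · rcases key a d hne with h1 | h1
    · exact H.le_sum_of_ne_zero a d h1
    · obtain ⟨b, e, rfl, rfl, h2⟩ := arrayShift_ne_zero h1
      have h3 := H.le_sum_of_ne_zero b e h2
      simp only [Pi.add_apply, Finset.sum_add_distrib, Finset.sum_pi_single', Finset.mem_univ,
        if_true]
      omega
  · simp [H.zero a ha, arrayShift]
  · rw [Finset.mem_insert, not_or] at hj
    rw [H.shift j hj.2 a d hja]
    congr 1
    by_cases hai : a i = 0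
    · simp [arrayShift, hai, Ne.symm hj.1]
    obtain ⟨b, rfl⟩ : ∃ b : ι → ℕ, a = b + Pi.single i 1 := ⟨_, (sub_single_add_single hai).symm⟩
    rw [add_right_comm, arrayShift_add_single]
    rcases d with _ | d
    · rw [H.zero _ (Function.ne_iff.mpr ⟨j, by simp⟩)]
      simp [arrayShift]
    · rw [arrayShift_add_single]
      refine H.shift j hj.2 b d ?_
      simpa [hj.1] using hja
  · rcases Finset.mem_insert.mp hj with rfl | hj
    · have haj : a j ≠ 0 := by omega
      obtain ⟨b, rfl⟩ : ∃ b : ι → ℕ, a = b + Pi.single j 1 := ⟨_, (sub_single_add_single haj).symm⟩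
      rcases d with _ | d
      · rw [H.zero _ (Function.ne_iff.mpr ⟨j, by simp⟩)]
        simp [arrayShift]
      · rw [arrayShift_add_single, H.shift j hi b d, sub_self]
        simp at hja
        omega
    · rw [H.eq_zero j hj a d hja]
      by_contra hne
      obtain ⟨b, e, rfl, rfl, h2⟩ := arrayShift_ne_zero (i := i) (h := h) (a := a) (d := d)
        (by simpa using hne)
      refine h2 (H.eq_zero j hj b e ?_)
      have hji : j ≠ i := fun h => hi (h ▸ hj)
      simpa [hji] using hja

/-- Shifting in `d` is multiplication by `X`, and the shift in `a` only reindexes the sum. The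
support bound ensures that the box for `d + 1` contains no terms beyond the shifted ones. -/
lemma IsShiftArray.arraySeries_sub_arrayShift (H : IsShiftArray γ δ G s h) (i : ι) :
    arraySeries δ (fun a d => h a d - arrayShift i h a d) =
      arraySeries δ h * (1 - PowerSeries.X) := by
  rw [mul_sub, mul_one]
  ext d
  rw [map_sub]
  simp only [arraySeries, PowerSeries.coeff_mk, Finset.sum_sub_distrib]
  congr 1
  rcases d with _ | d
  · simp [arrayShift]
  · rw [PowerSeries.coeff_succ_mul_X, PowerSeries.coeff_mk]
    symm
    refine Finset.sum_of_injOn (fun a => a + Pi.single i 1) ?_ ?_ ?_ ?_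
    · intro a _ b _ hab
      exact add_right_cancel hab
    · intro a ha
      simp only [arrayBox, Fintype.coe_piFinset, Finset.coe_range, Set.mem_pi, Set.mem_univ,
        Set.mem_Iio, forall_true_left, Pi.add_apply] at ha ⊢
      intro j
      have h1 := ha j
      have : (Pi.single i 1 : ι → ℕ) j ≤ 1 := by
        by_cases hj : j = i
        · subst hj; simp
        · simp [hj]
      omega
    · intro a _ ha'
      by_contra hne
      obtain ⟨b, e, rfl, he, h2⟩ := arrayShift_ne_zero hne
      obtain rfl : d = e := by omega
      refine ha' ⟨b, ?_, rfl⟩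
      simp only [arrayBox, Fintype.coe_piFinset, Finset.coe_range, Set.mem_pi, Set.mem_univ,
        Set.mem_Iio, forall_true_left]
      intro j
      have := H.le_of_ne_zero b d h2 j
      omega
    · intro a _
      exact (arrayShift_add_single i h a d).symm

lemma exists_isShiftArray_univ (H : IsShiftArray γ δ G ∅ h) (s : Finset ι) :
    ∃ h' : (ι → ℕ) → ℕ → M, IsShiftArray γ δ G s h' ∧
      arraySeries δ h' = arraySeries δ h * (1 - PowerSeries.X) ^ s.card := by
  induction s using Finset.induction_on with
  | empty => exact ⟨h, H, by simp⟩
  | insert i s hi ih =>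
    obtain ⟨h', H', e⟩ := ih
    refine ⟨_, H'.sub_arrayShift hi, ?_⟩
    rw [H'.arraySeries_sub_arrayShift, e, Finset.card_insert_of_notMem hi, pow_succ, mul_assoc]

/-- The generating function of an array that is eventually shift invariant in every direction is
rational with denominator `(1 - t) ^ card ι`. -/
theorem IsShiftArray.exists_polynomial (H : IsShiftArray γ δ G ∅ h) :
    ∃ P : Polynomial M,
      arraySeries δ h * (1 - PowerSeries.X) ^ Fintype.card ι = (P : PowerSeries M) := by
  obtain ⟨h', H', e⟩ := exists_isShiftArray_univ H Finset.univ
  -- After differences in all directions the support has `a ≤ γ`, so `d + δ ≤ ∑ a + G ≤ ∑ γ + G` and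
  -- higher coefficients vanish.
  refine ⟨PowerSeries.trunc (∑ i, γ i + G + 1) (arraySeries δ h'), ?_⟩
  rw [← Finset.card_univ, ← e]
  ext d
  rw [Polynomial.coeff_coe, PowerSeries.coeff_trunc]
  split_ifs with hd
  · rfl
  · rw [arraySeries, PowerSeries.coeff_mk]
    refine Finset.sum_eq_zero fun a _ => ?_
    by_contra hne
    have h1 := H'.le_sum_of_ne_zero a d hne
    have h2 : ∑ i, a i ≤ ∑ i, γ i := Finset.sum_le_sum fun i _ => by
      by_contra! hlt
      exact hne (H'.eq_zero i (Finset.mem_univ i) a d hlt)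
    omega

end ShiftArray

/-! ### Colengths -/

section Length

variable {k : Type*} [Field k] {V W : Type*} [AddCommGroup V] [Module k V] [AddCommGroup W]
  [Module k W]

/-- Additivity of length in `0 → V ⧸ P → W ⧸ φ P → W ⧸ φ V → 0`. Lengths take values in `ℕ∞`, so no
finiteness is required. -/
lemma length_quotient_map (φ : V →ₗ[k] W) (hφ : Function.Injective φ) (P : Submodule k V) :
    Module.length k (W ⧸ P.map φ) = Module.length k (V ⧸ P) + Module.length k (W ⧸ φ.range) := by
  let f : V ⧸ P →ₗ[k] W ⧸ P.map φ := P.mapQ _ φ (Submodule.le_comap_map φ P)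
  let g : W ⧸ P.map φ →ₗ[k] W ⧸ φ.range := Submodule.factor (LinearMap.map_le_range)
  refine Module.length_eq_add_of_exact f g ?_ (Submodule.factor_surjective _) ?_
  · rw [← LinearMap.ker_eq_bot, Submodule.ker_mapQ, Submodule.comap_map_eq_of_injective hφ,
      Submodule.mkQ_map_self]
  · intro y
    obtain ⟨y, rfl⟩ := Submodule.mkQ_surjective _ y
    refine Iff.trans (Submodule.Quotient.mk_eq_zero φ.range (x := y)) ?_
    constructor
    · rintro ⟨x, rfl⟩
      exact ⟨Submodule.Quotient.mk x, rfl⟩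
    · rintro ⟨x, hx⟩
      obtain ⟨x, rfl⟩ := Submodule.mkQ_surjective _ x
      have hx' : φ x - y ∈ P.map φ := (Submodule.Quotient.eq _).mp hx
      have h1 := LinearMap.map_le_range hx'
      have h2 := sub_mem (LinearMap.mem_range_self φ x) h1
      simpa using h2

lemma length_quotient_mono {P Q : Submodule k V} (h : P ≤ Q) :
    Module.length k (V ⧸ Q) ≤ Module.length k (V ⧸ P) :=
  Module.length_le_of_surjective (Submodule.factor h) (Submodule.factor_surjective h)

variable {A : Type*} [CommRing A] [Algebra k A]

lemma length_quotient_restrictScalars (I : Ideal A) :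
    Module.length k (A ⧸ I.restrictScalars k) = Module.length k (A ⧸ I) :=
  (Submodule.Quotient.restrictScalarsEquiv k I).length_eq

/-- An ideal of colength `d` contains the `d`-th power of the maximal ideal. -/
lemma pow_le_of_length_quotient_eq [IsLocalRing A] [IsNoetherianRing A] {I : Ideal A} {d : ℕ}
    (h : Module.length k (A ⧸ I) = d) : IsLocalRing.maximalIdeal A ^ d ≤ I := by
  set m := IsLocalRing.maximalIdeal A
  -- By Nakayama the chain `I + m ^ j` drops strictly as long as `m ^ j` is not contained in `I`. If
  -- `m ^ d` were not contained in `I`, there would be `d + 1` strict steps above `I`, one more than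
  -- the colength allows.
  let S : ℕ → Submodule k A := fun j => (I ⊔ m ^ j).restrictScalars k
  have hS : ∀ j, ¬ m ^ j ≤ I → S (j + 1) < S j := by
    intro j hj
    have hle : I ⊔ m ^ (j + 1) ≤ I ⊔ m ^ j :=
      sup_le_sup_left (Ideal.pow_le_pow_right (Nat.le_succ j)) I
    refine lt_of_le_of_ne hle fun he => hj ?_
    have he' : I ⊔ m ^ (j + 1) = I ⊔ m ^ j := Submodule.restrictScalars_injective k A A he
    refine Submodule.le_of_le_smul_of_le_jacobson_bot (I := m) (IsNoetherian.noetherian _)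
      (IsLocalRing.maximalIdeal_le_jacobson _) ?_
    rw [smul_eq_mul, ← pow_succ', he']
    exact le_sup_right
  have key : ∀ j, ¬ m ^ j ≤ I → ((j + 1 : ℕ) : ℕ∞) ≤ Order.coheight (S (j + 1)) := by
    intro j
    induction j with
    | zero =>
      intro h0
      simpa using le_trans le_add_self (Order.coheight_add_one_le (hS 0 h0))
    | succ j ih =>
      intro hj
      have h1 : ¬ m ^ j ≤ I := fun h => hj (le_trans (Ideal.pow_le_pow_right (Nat.le_succ j)) h)
      refine le_trans ?_ (Order.coheight_add_one_le (hS (j + 1) hj))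
      push_cast
      gcongr
      exact_mod_cast ih h1
  by_contra hd
  have h1 := key d hd
  have h2 : Order.coheight (S (d + 1)) ≤ Order.coheight (I.restrictScalars k) :=
    Order.coheight_anti (show I ≤ I ⊔ m ^ (d + 1) from le_sup_left)
  rw [← Module.length_quotient (N := I.restrictScalars k), length_quotient_restrictScalars, h]
    at h2
  have h3 := h1.trans h2
  norm_cast at h3
  omega

end Length

/-! ### Stratification by the ideal generated in the normalization -/

section Uniformizing

variable {ι : Type*} [Fintype ι]

/-- The monomial `∏ t i ^ a i`. -/
def mono {B : Type*} [CommRing B] (t : ι → B) (a : ι → ℕ) : B := ∏ i, t i ^ a i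

lemma mono_add {B : Type*} [CommRing B] (t : ι → B) (a b : ι → ℕ) :
    mono t (a + b) = mono t a * mono t b := by
  simp [mono, pow_add, Finset.prod_mul_distrib]

lemma mono_single {B : Type*} [CommRing B] [DecidableEq ι] (t : ι → B) (i : ι) (n : ℕ) :
    mono t (Pi.single i n) = t i ^ n := by
  rw [mono, Finset.prod_eq_single i]
  · simp
  · intro j _ hj
    simp [hj]
  · simp

/-- Generators `t i` of the maximal ideals of a semilocal principal ideal ring `B` that contains
`A`, with the properties that relate ideals of `A` to those of `B`: the monomial `mono t γ` lies
in the conductor of `A` in `B`, and `t i` is congruent to `1` modulo the part of `mono t γ` that is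
prime to `t i`. -/
structure IsUniformizing (k A : Type*) {B : Type*} [Field k] [CommRing A] [CommRing B] [Algebra k A]
    [Algebra k B] [Algebra A B] (t : ι → B) (γ : ι → ℕ) : Prop where
  injective : Function.Injective (algebraMap A B)
  regular : ∀ i, t i ∈ nonZeroDivisors B
  length_quotient : ∀ i, Module.length k (B ⧸ Ideal.span {t i}) = 1
  conductor : ∀ b, ∃ a, algebraMap A B a = mono t γ * b
  dvd_sub_one : ∀ i, mono t γ ∣ (t i - 1) * t i ^ γ i
  exists_map_eq : ∀ I : Ideal A, Module.Finite k (A ⧸ I) →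
    ∃ a, I.map (algebraMap A B) = Ideal.span {mono t a}
  le_of_dvd : ∀ a b, mono t a ∣ mono t b → a ≤ b

variable {k A B : Type*} [Field k] [CommRing A] [CommRing B] [Algebra k A]
    [Algebra k B] [Algebra A B] {t : ι → B} {γ : ι → ℕ}

lemma length_quotient_span_mul {x y : B} (hx : x ∈ nonZeroDivisors B) :
    Module.length k (B ⧸ Ideal.span {x * y}) =
      Module.length k (B ⧸ Ideal.span {y}) + Module.length k (B ⧸ Ideal.span {x}) := by
  have hinj : Function.Injective (LinearMap.mulLeft k x) := fun a b hab =>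
    (mul_cancel_left_mem_nonZeroDivisors hx).mp hab
  have h := length_quotient_map (LinearMap.mulLeft k x) hinj ((Ideal.span {y}).restrictScalars k)
  have h1 : ((Ideal.span {y}).restrictScalars k).map (LinearMap.mulLeft k x) =
      (Ideal.span {x * y}).restrictScalars k := by
    ext z
    simp only [Submodule.mem_map, Submodule.restrictScalars_mem, Ideal.mem_span_singleton,
      LinearMap.mulLeft_apply]
    constructor
    · rintro ⟨_, ⟨c, rfl⟩, rfl⟩
      exact ⟨c, by ring⟩
    · rintro ⟨c, rfl⟩
      exact ⟨y * c, ⟨c, rfl⟩, by ring⟩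
  have h2 : (LinearMap.mulLeft k x).range = (Ideal.span {x}).restrictScalars k := by
    ext z
    simp only [LinearMap.mem_range, Submodule.restrictScalars_mem, Ideal.mem_span_singleton,
      LinearMap.mulLeft_apply, Dvd.dvd, eq_comm]
  rw [h1, h2] at h
  simpa only [length_quotient_restrictScalars] using h

namespace IsUniformizing

lemma length_quotient_mono (H : IsUniformizing k A t γ) (a : ι → ℕ) :
    Module.length k (B ⧸ Ideal.span {mono t a}) = (∑ i, a i : ℕ) := by
  have hpow : ∀ i (n : ℕ), Module.length k (B ⧸ Ideal.span {t i ^ n}) = n := by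
    intro i n
    induction n with
    | zero =>
      have : Subsingleton (B ⧸ Ideal.span {t i ^ 0}) := by
        rw [Ideal.Quotient.subsingleton_iff]; simp
      exact Module.length_eq_zero
    | succ n ih =>
      rw [pow_succ', length_quotient_span_mul (H.regular i), ih, H.length_quotient]
      simp
  have : ∀ s : Finset ι, Module.length k (B ⧸ Ideal.span {∏ i ∈ s, t i ^ a i}) =
      (∑ i ∈ s, a i : ℕ) := by
    classical
    intro s
    induction s using Finset.induction_on with
    | empty =>
      have : Subsingleton (B ⧸ Ideal.span {∏ i ∈ (∅ : Finset ι), t i ^ a i}) := by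
        rw [Ideal.Quotient.subsingleton_iff]; simp
      exact Module.length_eq_zero
    | insert i s hi ih =>
      rw [Finset.prod_insert hi, length_quotient_span_mul (pow_mem (H.regular i) _), ih, hpow,
        Finset.sum_insert hi]
      push_cast
      rw [add_comm]
  exact this Finset.univ

/-- Since `γ i ≤ a i`, the monomial `mono t a` supplies `t i ^ γ i` and `t i - 1` supplies the other
factors of `mono t γ`. The product lies in `mono t γ * B`, hence in `A`. -/
lemma sub_one_mul_mem (H : IsUniformizing k A t γ) {a : ι → ℕ} {i : ι} (hi : γ i ≤ a i) (b : B) :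
    ∃ x, algebraMap A B x = (t i - 1) * (mono t a * b) := by
  obtain ⟨c, hc⟩ := H.dvd_sub_one i
  obtain ⟨e, he⟩ : t i ^ γ i ∣ mono t a :=
    (pow_dvd_pow _ hi).trans (Finset.dvd_prod_of_mem _ (Finset.mem_univ i))
  obtain ⟨x, hx⟩ := H.conductor (c * e * b)
  refine ⟨x, ?_⟩
  rw [hx, he]
  linear_combination (- e * b) * hc

end IsUniformizing

variable [IsScalarTower k A B]

/-- An ideal of `A` as a subspace of `B`. -/
def embed (k : Type*) {A : Type*} (B : Type*) [Field k] [CommRing A] [CommRing B] [Algebra k A]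
    [Algebra k B] [Algebra A B] [IsScalarTower k A B] (I : Ideal A) : Submodule k B :=
  (I.restrictScalars k).map (IsScalarTower.toAlgHom k A B).toLinearMap

lemma mem_embed {I : Ideal A} {b : B} : b ∈ embed k B I ↔ ∃ x ∈ I, algebraMap A B x = b := Iff.rfl

lemma span_embed (I : Ideal A) : Ideal.span (embed k B I : Set B) = I.map (algebraMap A B) := rfl

/-- The length of `B ⧸ A`. -/
def delta (k A B : Type*) [Field k] [CommRing A] [CommRing B] [Algebra k A]
    [Algebra k B] [Algebra A B] [IsScalarTower k A B] : ℕ∞ :=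
  Module.length k (B ⧸ (IsScalarTower.toAlgHom k A B).toLinearMap.range)

/-- The relation `I' = c I` for ideals of `A` and `c ∈ B`. -/
def IsMulIdeal (k : Type*) {A B : Type*} [Field k] [CommRing A] [CommRing B] [Algebra k A]
    [Algebra k B] [Algebra A B] [IsScalarTower k A B] (c : B) (I I' : Ideal A) : Prop :=
  embed k B I' = (embed k B I).map (LinearMap.mulLeft k c)

lemma IsMulIdeal.map_eq {c : B} {I I' : Ideal A} (h : IsMulIdeal k c I I') :
    I'.map (algebraMap A B) = Ideal.span {c} * I.map (algebraMap A B) := by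
  rw [← span_embed (k := k), ← span_embed (k := k), h, Ideal.span_mul_span']
  congr 1
  ext b
  simp

namespace IsUniformizing

lemma length_quotient_embed (H : IsUniformizing k A t γ) (I : Ideal A) :
    Module.length k (B ⧸ embed k B I) = Module.length k (A ⧸ I) + delta k A B := by
  rw [embed, length_quotient_map _ H.injective, length_quotient_restrictScalars, delta]

lemma delta_ne_top (H : IsUniformizing k A t γ) : delta k A B ≠ ⊤ := by
  have h : Module.length k (B ⧸ (IsScalarTower.toAlgHom k A B).toLinearMap.range) ≤
      Module.length k (B ⧸ (Ideal.span {mono t γ}).restrictScalars k) :=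
    HilbZeta.length_quotient_mono fun y hy => by
      obtain ⟨b, rfl⟩ := Ideal.mem_span_singleton.mp hy
      exact H.conductor b
  rw [length_quotient_restrictScalars, H.length_quotient_mono] at h
  exact ne_top_of_le_ne_top (ENat.natCast_ne_top _) h

lemma mono_mul_mem_embed (H : IsUniformizing k A t γ) {I : Ideal A} {z : B}
    (hz : z ∈ I.map (algebraMap A B)) : mono t γ * z ∈ embed k B I := by
  -- The claim is strengthened by a multiplier `b`, since the embedded ideal is not stable under
  -- `B`; it is then used at `b = 1`.
  refine Submodule.span_induction ?_ ?_ ?_ ?_ hz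
      (p := fun z _ => ∀ b : B, mono t γ * (b * z) ∈ embed k B I) 1 |> (by simpa using ·)
  · rintro _ ⟨x, hx, rfl⟩ b
    obtain ⟨a, ha⟩ := H.conductor b
    refine ⟨a * x, I.mul_mem_left a hx, ?_⟩
    change algebraMap A B (a * x) = _
    rw [map_mul, ha]
    ring
  · intro b
    simp
  · intro y z _ _ hy hz b
    rw [mul_add, mul_add]
    exact add_mem (hy b) (hz b)
  · intro c z _ hz b
    rw [smul_eq_mul, ← mul_assoc b]
    exact hz _

/-- The inclusion `I ⊆ I B` is compared in terms of colength in `B`, where `I` has colength `d + δ`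
and `I B` has colength `∑ a`. -/
lemma sum_le (H : IsUniformizing k A t γ) {I : Ideal A} {a : ι → ℕ} {d : ℕ}
    (hI : Module.length k (A ⧸ I) = d) (ha : I.map (algebraMap A B) = Ideal.span {mono t a}) :
    ∑ i, a i ≤ d + (delta k A B).toNat := by
  have h : Module.length k (B ⧸ (Ideal.span {mono t a}).restrictScalars k) ≤
      Module.length k (B ⧸ embed k B I) := by
    refine HilbZeta.length_quotient_mono ?_
    rw [← ha]
    rintro _ ⟨x, hx, rfl⟩
    exact Ideal.mem_map_of_mem _ hx
  rw [length_quotient_restrictScalars, H.length_quotient_mono, H.length_quotient_embed, hI,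
    ← ENat.natCast_toNat H.delta_ne_top] at h
  exact_mod_cast h

/-- The conductor gives `t ^ γ I B ⊆ I`, and the smaller ideal has colength `∑ a + ∑ γ` in `B`. -/
lemma le_sum (H : IsUniformizing k A t γ) {I : Ideal A} {a : ι → ℕ} {d : ℕ}
    (hI : Module.length k (A ⧸ I) = d) (ha : I.map (algebraMap A B) = Ideal.span {mono t a}) :
    d + (delta k A B).toNat ≤ ∑ i, a i + ∑ i, γ i := by
  have h : Module.length k (B ⧸ embed k B I) ≤
      Module.length k (B ⧸ (Ideal.span {mono t (a + γ)}).restrictScalars k) := by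
    refine HilbZeta.length_quotient_mono fun y hy => ?_
    obtain ⟨b, rfl⟩ := Ideal.mem_span_singleton.mp hy
    rw [mono_add, mul_comm (mono t a), mul_assoc]
    refine H.mono_mul_mem_embed ?_
    rw [ha]
    exact Ideal.mem_span_singleton.mpr ⟨b, rfl⟩
  rw [length_quotient_restrictScalars, H.length_quotient_mono, H.length_quotient_embed, hI,
    ← ENat.natCast_toNat H.delta_ne_top] at h
  simp only [Pi.add_apply, Finset.sum_add_distrib] at h
  exact_mod_cast h

/-- In `B`, multiplication by `t i` raises the colength by the length of `B / (t i)`, which is one.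
The finite length `δ` of `B / A` cancels. -/
lemma length_of_isMulIdeal (H : IsUniformizing k A t γ) {i : ι} {I I' : Ideal A}
    (h : IsMulIdeal k (t i) I I') :
    Module.length k (A ⧸ I') = Module.length k (A ⧸ I) + 1 := by
  have h1 := H.length_quotient_embed I'
  have hinj : Function.Injective (LinearMap.mulLeft k (t i)) := fun a b hab =>
    (mul_cancel_left_mem_nonZeroDivisors (H.regular i)).mp hab
  have h2 : (LinearMap.mulLeft k (t i)).range = (Ideal.span {t i}).restrictScalars k := by
    ext z
    simp only [LinearMap.mem_range, Submodule.restrictScalars_mem, Ideal.mem_span_singleton,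
      LinearMap.mulLeft_apply, Dvd.dvd, eq_comm]
  rw [h, length_quotient_map _ hinj, H.length_quotient_embed, h2, length_quotient_restrictScalars,
    H.length_quotient, add_right_comm] at h1
  exact (ENat.add_left_injective_of_ne_top H.delta_ne_top h1).symm

/-- The comparison of strata under multiplication by `t i`. -/
lemma exists_isMulIdeal (H : IsUniformizing k A t γ) {i : ι} {I : Ideal A} {a : ι → ℕ}
    (hi : γ i ≤ a i) (ha : I.map (algebraMap A B) = Ideal.span {mono t a}) :
    ∃ I', IsMulIdeal k (t i) I I' := by
  let l := Algebra.linearMap A B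
  refine ⟨((Submodule.map l I).map (LinearMap.mulLeft A (t i))).comap l, ?_⟩
  ext b
  rw [mem_embed]
  constructor
  · rintro ⟨x, ⟨_, ⟨y, hy, rfl⟩, hxy⟩, rfl⟩
    exact ⟨_, ⟨y, hy, rfl⟩, hxy⟩
  · rintro ⟨_, ⟨y, hy, rfl⟩, rfl⟩
    have hy' : algebraMap A B y ∈ Ideal.span {mono t a} := ha ▸ Ideal.mem_map_of_mem _ hy
    obtain ⟨b, hb⟩ := Ideal.mem_span_singleton.mp hy'
    -- Write `t i * y = y + (t i - 1) * y`; the second summand lies in `A` because `y` is a multiple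
    -- of `mono t a`.
    obtain ⟨x, hx⟩ := H.sub_one_mul_mem hi b
    have h1 : algebraMap A B (x + y) = t i * algebraMap A B y := by
      rw [map_add, hx, ← hb]; ring
    exact ⟨x + y, ⟨_, ⟨y, hy, rfl⟩, h1.symm⟩, h1⟩

/-- An element of `I'` has the form `z = t i * mono t a * b`, so its quotient by `t i` is `z - (t i
- 1) * mono t a * b`, which lies in `A`. -/
lemma exists_isMulIdeal_of_dvd [DecidableEq ι] (H : IsUniformizing k A t γ) {i : ι} {I' : Ideal A}
    {a : ι → ℕ} (hi : γ i ≤ a i)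
    (ha : I'.map (algebraMap A B) = Ideal.span {mono t (a + Pi.single i 1)}) :
    ∃ I, IsMulIdeal k (t i) I I' := by
  let l := Algebra.linearMap A B
  refine ⟨((Submodule.map l I').comap (LinearMap.mulLeft A (t i))).comap l, ?_⟩
  ext b
  rw [mem_embed]
  constructor
  · rintro ⟨z, hz, rfl⟩
    have hz' : algebraMap A B z ∈ Ideal.span {mono t (a + Pi.single i 1)} :=
      ha ▸ Ideal.mem_map_of_mem _ hz
    obtain ⟨b, hb⟩ := Ideal.mem_span_singleton.mp hz'
    rw [mono_add, mono_single, pow_one] at hb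
    obtain ⟨x, hx⟩ := H.sub_one_mul_mem hi b
    have h1 : algebraMap A B (z - x) = mono t a * b := by
      rw [map_sub, hx, hb]; ring
    have h2 : t i * algebraMap A B (z - x) = algebraMap A B z := by
      rw [h1, hb]; ring
    exact ⟨_, ⟨z - x, ⟨z, hz, h2.symm⟩, rfl⟩, h2⟩
  · rintro ⟨_, ⟨y, ⟨z, hz, hzy⟩, rfl⟩, rfl⟩
    exact ⟨z, hz, hzy⟩

lemma map_eq_of_isMulIdeal [DecidableEq ι] {i : ι} {I I' : Ideal A}
    {a : ι → ℕ} (h : IsMulIdeal k (t i) I I')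
    (ha : I.map (algebraMap A B) = Ideal.span {mono t a}) :
    I'.map (algebraMap A B) = Ideal.span {mono t (a + Pi.single i 1)} := by
  rw [h.map_eq, ha, Ideal.span_singleton_mul_span_singleton, mono_add, mono_single, pow_one,
    mul_comm]

lemma map_eq_of_isMulIdeal' [DecidableEq ι] (H : IsUniformizing k A t γ) {i : ι} {I I' : Ideal A}
    {a : ι → ℕ} (h : IsMulIdeal k (t i) I I')
    (ha : I'.map (algebraMap A B) = Ideal.span {mono t (a + Pi.single i 1)}) :
    I.map (algebraMap A B) = Ideal.span {mono t a} := by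
  rw [h.map_eq, mono_add, mono_single, pow_one, mul_comm (mono t a),
    ← Ideal.span_singleton_mul_span_singleton] at ha
  have key : ∀ J J' : Ideal B, Ideal.span {t i} * J = Ideal.span {t i} * J' → J ≤ J' := by
    intro J J' hJ x hx
    have h1 : t i * x ∈ Ideal.span {t i} * J' :=
      hJ ▸ Ideal.mul_mem_mul (Ideal.mem_span_singleton_self _) hx
    obtain ⟨z, hz, hzx⟩ := Ideal.mem_span_singleton_mul.mp h1
    rwa [← (mul_cancel_left_mem_nonZeroDivisors (H.regular i)).mp hzx]
  exact le_antisymm (key _ _ ha) (key _ _ ha.symm)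

/-- Compose multiplication by `t i` with a `k`-linear retraction of `B` onto `A`. When `t i I` lies
in `A`, the retraction does not move it, so one linear map serves all ideals. A left inverse of `x ↦
t i * x` on `A` gives the map back. -/
lemma exists_linearMap (H : IsUniformizing k A t γ) (i : ι) : ∃ L L' : A →ₗ[k] A,
    ∀ I I' : Ideal A, IsMulIdeal k (t i) I I' →
      I'.restrictScalars k = (I.restrictScalars k).map L ∧
      I.restrictScalars k = (I'.restrictScalars k).map L' := by
  let l : A →ₗ[k] B := (IsScalarTower.toAlgHom k A B).toLinearMap
  have hl : Function.Injective l := H.injective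
  let l' : A →ₗ[k] B := LinearMap.mulLeft k (t i) ∘ₗ l
  have hl' : Function.Injective l' := fun a b hab =>
    hl ((mul_cancel_left_mem_nonZeroDivisors (H.regular i)).mp hab)
  obtain ⟨ρ, hρ⟩ := l.exists_leftInverse_of_injective (LinearMap.ker_eq_bot.mpr hl)
  obtain ⟨ρ', hρ'⟩ := l'.exists_leftInverse_of_injective (LinearMap.ker_eq_bot.mpr hl')
  have e : ∀ x, ρ (l x) = x := fun x => LinearMap.congr_fun hρ x
  have e' : ∀ x, ρ' (l' x) = x := fun x => LinearMap.congr_fun hρ' x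
  refine ⟨ρ ∘ₗ l', ρ' ∘ₗ l, fun I I' h => ?_⟩
  have h1 : (I'.restrictScalars k).map l = (I.restrictScalars k).map l' := by
    rw [Submodule.map_comp]; exact h
  constructor
  · rw [Submodule.map_comp, ← h1, ← Submodule.map_comp, hρ, Submodule.map_id]
  · rw [Submodule.map_comp, h1, ← Submodule.map_comp, hρ', Submodule.map_id]

end IsUniformizing

end Uniformizing

/-! ### Classes of the strata and their shift invariance -/

section Strata

variable {ι : Type*} [Fintype ι] {k A : Type u} [Field k] [CommRing A] [Algebra k A]
  {B : Type*} [CommRing B] [Algebra k B] [Algebra A B] {t : ι → B}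
  {γ : ι → ℕ}

/-- The ideals of colength `d` that generate the ideal `(mono t a)` of `B`. -/
def stratum (t : ι → B) (N : Ideal A) (d : ℕ) (a : ι → ℕ) : Set (ColengthIdeal k N d) :=
  {I | I.1.map (algebraMap A B) = Ideal.span {mono t a}}

variable {N : Ideal A} [Module.Finite k (A ⧸ N)] {d : ℕ}

lemma ColengthIdeal.finite (I : ColengthIdeal k N d) : Module.Finite k (A ⧸ I.1) :=
  Module.Finite.of_surjective (Ideal.Quotient.factorₐ k I.2.2).toLinearMap
    (Ideal.Quotient.factor_surjective I.2.2)

lemma ColengthIdeal.length_quotient (I : ColengthIdeal k N d) : Module.length k (A ⧸ I.1) = d := by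
  have := I.finite
  rw [Module.length_eq_finrank, I.2.1]

lemma finrank_quotient_of_length {I : Ideal A} (h : Module.length k (A ⧸ I) = d) :
    Module.finrank k (A ⧸ I) = d := by
  have h1 : Module.length k (A ⧸ I) ≠ ⊤ := by rw [h]; exact ENat.natCast_ne_top d
  have := (isFiniteLength_iff_isNoetherian_isArtinian.mp (Module.length_ne_top_iff.mp h1)).1
  rw [Module.length_eq_finrank] at h
  exact_mod_cast h

namespace IsUniformizing

/-- An exponent `b ≥ a` different from `a` satisfies `b ≥ a + e_i` for some `i`. Equality of ideals
is thereby expressed by containments, each of which says that `I` lies in a fixed subspace and is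
constructible. -/
lemma stratum_eq [DecidableEq ι] (H : IsUniformizing k A t γ) (a : ι → ℕ) :
    (stratum t N d a : Set (ColengthIdeal k N d)) =
      {I | I.1.map (algebraMap A B) ≤ Ideal.span {mono t a}} ∩
        ⋂ i ∈ (Finset.univ : Finset ι),
          {I | I.1.map (algebraMap A B) ≤ Ideal.span {mono t (a + Pi.single i 1)}}ᶜ := by
  ext I
  obtain ⟨b, hb⟩ := H.exists_map_eq I.1 I.finite
  simp only [stratum, Set.mem_inter_iff, Set.mem_ofPred_eq, hb, Set.mem_iInter, Set.mem_compl_iff,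
    Ideal.span_singleton_le_span_singleton]
  constructor
  · intro h
    have h1 := Ideal.span_singleton_le_span_singleton.mp h.le
    have h2 := Ideal.span_singleton_le_span_singleton.mp h.ge
    obtain rfl := le_antisymm (H.le_of_dvd _ _ h1) (H.le_of_dvd _ _ h2)
    refine ⟨h1, fun i _ hi => ?_⟩
    simpa using H.le_of_dvd _ _ hi i
  · rintro ⟨h1, h2⟩
    suffices a = b by rw [this]
    have hle := H.le_of_dvd _ _ h1
    by_contra hne
    obtain ⟨i, hi⟩ : ∃ i, a i < b i := by
      by_contra! hc
      exact hne (le_antisymm hle hc)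
    refine h2 i (Finset.mem_univ i) ?_
    have h3 : a + Pi.single i 1 ≤ b := fun j => by
      by_cases hj : j = i
      · subst hj; simpa using hi
      · simpa [hj] using hle j
    obtain ⟨c, rfl⟩ := exists_add_of_le h3
    exact ⟨mono t c, mono_add t _ c⟩

variable [IsScalarTower k A B]

lemma map_le_span_iff (I : Ideal A) (b : B) : I.map (algebraMap A B) ≤ Ideal.span {b} ↔
    I.restrictScalars k ≤ ((Ideal.span {b}).restrictScalars k).comap
      (IsScalarTower.toAlgHom k A B).toLinearMap :=
  Ideal.map_le_iff_le_comap

lemma charFn_stratum_mem (H : IsUniformizing k A t γ) (a : ι → ℕ) :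
    charFn k (stratum t N d a) ∈ invClosure (idealAlg k N d) := by
  classical
  rw [H.stratum_eq]
  have h : ∀ b : B, charFn k {I : ColengthIdeal k N d |
      I.1.map (algebraMap A B) ≤ Ideal.span {b}} ∈ invClosure (idealAlg k N d) := fun b => by
    simp only [map_le_span_iff (k := k)]
    exact charFn_ideal_le_mem _
  refine charFn_inter_mem (h _) (charFn_biInter_mem _ fun i _ => ?_)
  rw [charFn_compl]
  exact sub_mem (one_mem _) (h _)

variable [IsAlgClosed k]

lemma exists_hasCls_stratum (H : IsUniformizing k A t γ) (N : Ideal A) [Module.Finite k (A ⧸ N)]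
    (d : ℕ) (a : ι → ℕ) : ∃ m, HasCls (idealAlg k N d) (stratum t N d a) m := by
  obtain ⟨m, _, h, -, -⟩ := hasCls_colengthIdeal.split (H.charFn_stratum_mem a (N := N) (d := d))
  exact ⟨m, by simpa using h⟩

/-- The class of a stratum. -/
def stratumCls (H : IsUniformizing k A t γ) (N : Ideal A) [Module.Finite k (A ⧸ N)]
    (d : ℕ) (a : ι → ℕ) : K0 k :=
  (H.exists_hasCls_stratum N d a).choose

lemma hasCls_stratumCls (H : IsUniformizing k A t γ) (N : Ideal A) [Module.Finite k (A ⧸ N)]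
    (d : ℕ) (a : ι → ℕ) :
    HasCls (idealAlg k N d) (stratum t N d a) (H.stratumCls N d a) :=
  (H.exists_hasCls_stratum N d a).choose_spec

lemma stratumCls_eq (H : IsUniformizing k A t γ) {m : K0 k} {a : ι → ℕ}
    (h : HasCls (idealAlg k N d) (stratum t N d a) m) : H.stratumCls N d a = m :=
  (H.hasCls_stratumCls N d a).unique h idealAlg_fg idealAlg_fg (le_invClosure _) (le_invClosure _)

lemma stratum_nonempty (H : IsUniformizing k A t γ) {a : ι → ℕ} (h : H.stratumCls N d a ≠ 0) :
    (stratum t N d a : Set (ColengthIdeal k N d)).Nonempty := by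
  by_contra hne
  rw [Set.not_nonempty_iff_eq_empty] at hne
  refine h (H.stratumCls_eq ?_)
  rw [hne]
  exact HasCls.empty _

lemma cls_eq_sum [DecidableEq ι] (H : IsUniformizing k A t γ) (N : Ideal A)
    [Module.Finite k (A ⧸ N)] (d : ℕ) :
    (idealVariety k (A ⧸ N) d).cls =
      ∑ a ∈ arrayBox ι (delta k A B).toNat d, H.stratumCls N d a := by
  have hd : (arrayBox ι (delta k A B).toNat d : Set (ι → ℕ)).PairwiseDisjoint
      (stratum t N d : (ι → ℕ) → Set (ColengthIdeal k N d)) := by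
    intro a _ b _ hab
    refine Set.disjoint_left.mpr fun I ha hb => hab ?_
    have h : Ideal.span {mono t a} = Ideal.span {mono t b} := ha.symm.trans hb
    exact le_antisymm (H.le_of_dvd _ _ (Ideal.span_singleton_le_span_singleton.mp h.ge))
      (H.le_of_dvd _ _ (Ideal.span_singleton_le_span_singleton.mp h.le))
  have hu : (Set.univ : Set (ColengthIdeal k N d)) =
      ⋃ a ∈ arrayBox ι (delta k A B).toNat d, stratum t N d a := by
    symm
    refine Set.eq_univ_of_forall fun I => ?_
    obtain ⟨a, ha⟩ := H.exists_map_eq I.1 I.finite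
    refine Set.mem_biUnion (x := a) ?_ ha
    simp only [arrayBox, Fintype.coe_piFinset, Finset.coe_range, Set.mem_pi, Set.mem_univ,
      Set.mem_Iio, forall_true_left]
    intro i
    have h1 := H.sum_le I.length_quotient ha
    have h2 := Finset.single_le_sum (f := a) (fun _ _ => Nat.zero_le _) (Finset.mem_univ i)
    omega
  obtain ⟨c, hc, h⟩ := hasCls_colengthIdeal.sum_partition _ _
    (fun a _ => H.charFn_stratum_mem a) hd hu
  rw [h]
  exact Finset.sum_congr rfl fun a ha => (H.stratumCls_eq (hc a ha)).symm

variable [IsLocalRing A] [IsNoetherianRing A]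

/-- The pairs `(I, t i I)` project onto both strata: forwards by `exists_isMulIdeal`, backwards by
`exists_isMulIdeal_of_dvd`. The two projections are related by fixed linear maps. -/
lemma stratumCls_add_single [DecidableEq ι] (H : IsUniformizing k A t γ)
    [∀ d, Module.Finite k (A ⧸ IsLocalRing.maximalIdeal A ^ d)]
    {i : ι} {a : ι → ℕ} (hi : γ i ≤ a i) (d : ℕ) :
    H.stratumCls (IsLocalRing.maximalIdeal A ^ (d + 1)) (d + 1) (a + Pi.single i 1) =
      H.stratumCls (IsLocalRing.maximalIdeal A ^ d) d a := by
  set m := IsLocalRing.maximalIdeal A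
  let E := {p : ColengthIdeal k (m ^ d) d × ColengthIdeal k (m ^ (d + 1)) (d + 1) //
    IsMulIdeal k (t i) p.1.1 p.2.1 ∧ p.1 ∈ stratum t (m ^ d) d a}
  let j : E → ColengthIdeal k (m ^ d) d := fun p => p.1.1
  let j' : E → ColengthIdeal k (m ^ (d + 1)) (d + 1) := fun p => p.1.2
  have hj : Set.range j = stratum t (m ^ d) d a := by
    ext I
    constructor
    · rintro ⟨p, rfl⟩
      exact p.2.2
    · intro hI
      obtain ⟨I', hI'⟩ := H.exists_isMulIdeal hi hI
      have hlen := H.length_of_isMulIdeal hI'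
      rw [I.length_quotient] at hlen
      exact ⟨⟨⟨I, I', finrank_quotient_of_length hlen, pow_le_of_length_quotient_eq hlen⟩,
        hI', hI⟩, rfl⟩
  have hj' : Set.range j' = stratum t (m ^ (d + 1)) (d + 1) (a + Pi.single i 1) := by
    ext I'
    constructor
    · rintro ⟨p, rfl⟩
      exact map_eq_of_isMulIdeal p.2.1 p.2.2
    · intro hI'
      obtain ⟨I, hI⟩ := H.exists_isMulIdeal_of_dvd hi hI'
      have hlen := H.length_of_isMulIdeal hI
      rw [I'.length_quotient, Nat.cast_add, Nat.cast_one] at hlen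
      have hlen' := (ENat.add_left_injective_of_ne_top ENat.one_ne_top hlen).symm
      exact ⟨⟨⟨⟨I, finrank_quotient_of_length hlen', pow_le_of_length_quotient_eq hlen'⟩, I'⟩,
        hI, H.map_eq_of_isMulIdeal' hI hI'⟩, rfl⟩
  obtain ⟨L, L', hL⟩ := H.exists_linearMap i
  have h1 := H.hasCls_stratumCls (m ^ d) d a
  have h2 := H.hasCls_stratumCls (m ^ (d + 1)) (d + 1) (a + Pi.single i 1)
  rw [← hj] at h1
  rw [← hj'] at h2
  exact (h1.eq_of_linear h2 L L' (fun p => (hL _ _ p.2.1).1) fun p => (hL _ _ p.2.1).2).symm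

lemma isShiftArray [DecidableEq ι] (H : IsUniformizing k A t γ)
    [∀ d, Module.Finite k (A ⧸ IsLocalRing.maximalIdeal A ^ d)] :
    IsShiftArray γ (delta k A B).toNat (∑ i, γ i) ∅
      (fun a d => H.stratumCls (IsLocalRing.maximalIdeal A ^ d) d a) where
  le_of_ne_zero a d h i := by
    obtain ⟨I, hI⟩ := H.stratum_nonempty h
    exact (Finset.single_le_sum (f := a) (fun _ _ => Nat.zero_le _) (Finset.mem_univ i)).trans
      (H.sum_le I.length_quotient hI)
  le_sum_of_ne_zero a d h := by
    obtain ⟨I, hI⟩ := H.stratum_nonempty h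
    exact H.le_sum I.length_quotient hI
  zero a ha := by
    by_contra h
    obtain ⟨I, hI⟩ := H.stratum_nonempty h
    have h1 : I.1 = ⊤ := top_le_iff.mp (by
      simpa [pow_zero, Ideal.one_eq_top] using I.2.2)
    have h2 : I.1.map (algebraMap A B) = Ideal.span {mono t a} := hI
    rw [h1, Ideal.map_top] at h2
    have h3 : mono t a ∣ mono t 0 := by
      rw [← Ideal.span_singleton_le_span_singleton, ← h2]
      exact le_top
    exact ha (le_antisymm (H.le_of_dvd _ _ h3) zero_le)
  shift i _ a d hi := H.stratumCls_add_single hi d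
  eq_zero i hi := by simp at hi

/-- The generating function of the varieties of ideals is rational. -/
theorem exists_polynomial (H : IsUniformizing k A t γ)
    [∀ d, Module.Finite k (A ⧸ IsLocalRing.maximalIdeal A ^ d)] :
    ∃ P : Polynomial (K0 k),
      (PowerSeries.mk fun d => (idealVariety k (A ⧸ IsLocalRing.maximalIdeal A ^ d) d).cls) *
        (1 - PowerSeries.X) ^ Fintype.card ι = (P : PowerSeries (K0 k)) := by
  classical
  obtain ⟨P, hP⟩ := H.isShiftArray.exists_polynomial
  refine ⟨P, ?_⟩
  rw [← hP]
  congr 2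
  ext d
  exact H.cls_eq_sum _ d

end IsUniformizing

end Strata

/-! ### Uniformizing parameters of the normalization of a curve singularity -/

section Generator

variable {B : Type*} [CommRing B]

/-- A maximal ideal `n` of a Noetherian ring that is principal up to an element outside `n` is
generated by an element congruent to `1` modulo a given ideal that is prime to `n`. -/
lemma exists_eq_span_of_mul_mem [IsNoetherianRing B] {n J : Ideal B} (hn : n.IsMaximal)
    {y z : B} (hz : z ∈ n) (hy : y ∉ n) (h : ∀ w ∈ n, z ∣ y * w)
    (hJ : n ⊔ J = ⊤) (hJ' : ∀ n' : Ideal B, n'.IsMaximal → n' ≠ n → J ≤ n') :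
    ∃ t, n = Ideal.span {t} ∧ t - 1 ∈ J := by
  have hJ2 : n ^ 2 ⊔ J = ⊤ := Ideal.pow_sup_eq_top hJ
  -- With `e + e' = 1`, `e ∈ J` and `e' ∈ n ^ 2`, the element `e * z + e'` is congruent to `z`
  -- modulo `n ^ 2` and to `1` modulo `J`.
  obtain ⟨e', he', e, he, hee⟩ := Submodule.mem_sup.mp ((Ideal.eq_top_iff_one _).mp hJ2)
  have he'n : e' ∈ n := Ideal.pow_le_self two_ne_zero he'
  set t := e * z + e' with ht
  have htn : t ∈ n := add_mem (n.mul_mem_left e hz) he'n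
  have htJ : t - 1 ∈ J := by
    have : t - 1 = (z - 1) * e := by rw [ht]; linear_combination hee
    rw [this]
    exact J.mul_mem_left _ he
  refine ⟨t, le_antisymm ?_ ((Ideal.span_singleton_le_iff_mem n).mpr htn), htJ⟩
  have hle : n ≤ Ideal.span {t} ⊔ n • n := by
    obtain ⟨α, ν, hν, hαν⟩ := hn.exists_inv hy
    intro w hw
    obtain ⟨v, hv⟩ := h w hw
    have h1 : w = t * (α * v) + (e' * (z * (α * v)) - e' * (α * v) + ν * w) := by
      rw [ht]
      linear_combination (-w) * hαν + α * hv + (- z * α * v) * hee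
    rw [h1]
    refine Submodule.add_mem_sup (Ideal.mul_mem_right _ _ (Ideal.mem_span_singleton_self t)) ?_
    rw [smul_eq_mul, ← pow_two]
    refine add_mem (sub_mem (Ideal.mul_mem_right _ _ he') (Ideal.mul_mem_right _ _ he')) ?_
    rw [pow_two]
    exact Ideal.mul_mem_mul hν hw
  obtain ⟨r, hr, hrn⟩ := Submodule.exists_sub_one_mem_and_smul_le_of_fg_of_le_sup
    (IsNoetherian.noetherian n) le_rfl hle
  -- It contains an `r` congruent to `1` modulo `n`, by Nakayama, and it contains `t`, which is
  -- congruent to `1` modulo every other maximal ideal. It therefore lies in no maximal ideal.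
  let S : Ideal B := (Ideal.span {t}).colon (n : Set B)
  have hS : S = ⊤ := by
    by_contra hne
    obtain ⟨n', hn', hSn⟩ := Ideal.exists_le_maximal S hne
    have htS : t ∈ S := Submodule.mem_colon.mpr fun p _ =>
      Ideal.mul_mem_right _ _ (Ideal.mem_span_singleton_self t)
    have hrS : r ∈ S := Submodule.mem_colon.mpr fun p hp => hrn ⟨p, hp, rfl⟩
    by_cases hnn : n' = n
    · subst hnn
      refine hn.ne_top ((Ideal.eq_top_iff_one _).mpr ?_)
      simpa using sub_mem (hSn hrS) hr
    · refine hn'.ne_top ((Ideal.eq_top_iff_one _).mpr ?_)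
      simpa using sub_mem (hSn htS) (hJ' n' hn' hnn htJ)
  intro w hw
  have h1 : (1 : B) ∈ S := hS ▸ Submodule.mem_top
  simpa using Submodule.mem_colon.mp h1 w hw

end Generator

/-! ### Maximal ideals of the normalization -/

section Normalization

variable {k A B : Type*} [Field k] [CommRing A] [Algebra k A] [CommRing B] [Algebra A B]

/-- The properties of the normalization `B` of the local ring `A` of a curve singularity that
determine its structure: `c` is a regular element of the conductor, and `B` is closed under
fractions with denominator `c` that stabilize an ideal containing `c`. -/
structure IsNormalization (k : Type*) {A : Type*} (B : Type*) [Field k] [CommRing A] [Algebra k A]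
    [CommRing B] [Algebra A B] [IsLocalRing A] (c : A) : Prop where
  injective : Function.Injective (algebraMap A B)
  mem : c ∈ IsLocalRing.maximalIdeal A
  regular : algebraMap A B c ∈ nonZeroDivisors B
  conductor : ∀ b, ∃ a, algebraMap A B a = algebraMap A B c * b
  finite_quotient : Module.Finite k (A ⧸ Ideal.span {c})
  dvd : ∀ (b : B) (J : Ideal B), algebraMap A B c ∈ J →
    (∀ x ∈ J, ∃ y ∈ J, b * x = algebraMap A B c * y) → algebraMap A B c ∣ b

lemma IsNormalization.mem_of_isMaximal [IsLocalRing A] [Module.Finite A B] {c : A}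
    (H : IsNormalization k B c) {n : Ideal B} (hn : n.IsMaximal) : algebraMap A B c ∈ n := by
  have h1 := Ideal.isMaximal_comap_of_isIntegral_of_isMaximal (R := A) n
  have h2 := H.mem
  rw [← IsLocalRing.eq_maximalIdeal h1] at h2
  exact h2

variable [Algebra k B] [IsScalarTower k A B]

lemma finite_quotient_map [Module.Finite A B] (I : Ideal A) [Module.Finite k (A ⧸ I)] :
    Module.Finite k (B ⧸ I.map (algebraMap A B)) := by
  have h : Module.Finite (A ⧸ I) (B ⧸ I.map (algebraMap A B)) :=
    Module.Finite.of_restrictScalars_finite A _ _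
  have : IsScalarTower k (A ⧸ I) (B ⧸ I.map (algebraMap A B)) :=
    IsScalarTower.of_algebraMap_eq fun x =>
      congrArg (Ideal.Quotient.mk _) (IsScalarTower.algebraMap_apply k A B x)
  exact Module.Finite.trans (A ⧸ I) _

namespace IsNormalization

variable [IsLocalRing A] [Module.Finite A B] {c : A}

lemma finite_quotient_span (H : IsNormalization k B c) :
    Module.Finite k (B ⧸ Ideal.span {algebraMap A B c}) := by
  have := H.finite_quotient
  rw [← Set.image_singleton, ← Ideal.map_span]
  exact finite_quotient_map _

/-- All maximal ideals contain `c`, so they inject into the finite maximal spectrum of the Artinian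
ring `B / c`. -/
lemma finite_maximalSpectrum (H : IsNormalization k B c) : Finite (MaximalSpectrum B) := by
  have := H.finite_quotient_span
  have : IsArtinianRing (B ⧸ Ideal.span {algebraMap A B c}) := .of_finite k _
  let q := Ideal.Quotient.mk (Ideal.span {algebraMap A B c})
  have hq : Function.Surjective q := Ideal.Quotient.mk_surjective
  have hle : ∀ n : MaximalSpectrum B, RingHom.ker q ≤ n.asIdeal := fun n => by
    rw [Ideal.mk_ker, Ideal.span_singleton_le_iff_mem]
    exact H.mem_of_isMaximal n.isMaximal
  have hcm : ∀ n : MaximalSpectrum B, (n.asIdeal.map q).comap q = n.asIdeal := fun n => by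
    rw [Ideal.comap_map_of_surjective q hq, ← RingHom.ker_eq_comap_bot, sup_eq_left.mpr (hle n)]
  let f : MaximalSpectrum B → MaximalSpectrum (B ⧸ Ideal.span {algebraMap A B c}) := fun n =>
    ⟨n.asIdeal.map q, by
      have := n.isMaximal
      refine (Ideal.map_eq_top_or_isMaximal_of_surjective q hq this).resolve_left fun h => ?_
      have := hcm n
      rw [h, Ideal.comap_top] at this
      exact n.isMaximal.ne_top this.symm⟩
  refine Finite.of_injective f fun n n' h => ?_
  have h1 : n.asIdeal.map q = n'.asIdeal.map q := congrArg MaximalSpectrum.asIdeal h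
  ext1
  rw [← hcm n, ← hcm n', h1]

lemma length_quotient [IsAlgClosed k] (H : IsNormalization k B c) {n : Ideal B}
    (hn : n.IsMaximal) : Module.length k (B ⧸ n) = 1 := by
  have := H.finite_quotient_span
  have hle : Ideal.span {algebraMap A B c} ≤ n :=
    (Ideal.span_singleton_le_iff_mem n).mpr (H.mem_of_isMaximal hn)
  have : Module.Finite k (B ⧸ n) := Module.Finite.of_surjective
    (Ideal.Quotient.factorₐ k hle).toLinearMap (Ideal.Quotient.factor_surjective hle)
  have hb := IsAlgClosed.algebraMap_bijective_of_isIntegral (k := k) (K := B ⧸ n)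
  have e := LinearEquiv.ofBijective (Algebra.linearMap k (B ⧸ n)) hb
  rw [← e.length_eq, Module.length_eq_one]

/-- In the Artinian ring `B / c` the image of `n` consists of zero divisors, so some `b ∉ c B`
satisfies `b n ⊆ c B`. If `b n ⊆ c n`, normality would give `c ∣ b`; hence `b z = c y` with `z ∈ n`
and `y ∉ n`. For `w ∈ n` with `b w = c v`, cancelling `c` gives `y w = z v`. -/
lemma exists_mul_mem [IsNoetherianRing B] (H : IsNormalization k B c) {n : Ideal B}
    (hn : n.IsMaximal) : ∃ z ∈ n, ∃ y ∉ n, ∀ w ∈ n, z ∣ y * w := by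
  set c' := algebraMap A B c
  have hcn : c' ∈ n := H.mem_of_isMaximal hn
  have := H.finite_quotient_span
  have : IsArtinianRing (B ⧸ Ideal.span {c'}) := .of_finite k _
  have hle : RingHom.ker (Ideal.Quotient.mk (Ideal.span {c'})) ≤ n := by
    rwa [Ideal.mk_ker, Ideal.span_singleton_le_iff_mem]
  have hdisj : Disjoint (n.map (Ideal.Quotient.mk (Ideal.span {c'})) : Set (B ⧸ Ideal.span {c'}))
      (nonZeroDivisors (B ⧸ Ideal.span {c'}) : Set (B ⧸ Ideal.span {c'})) := by
    refine Set.disjoint_left.mpr fun x hx hx' => ?_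
    have h1 := Ideal.eq_top_of_isUnit_mem _ hx (IsArtinianRing.isUnit_of_mem_nonZeroDivisors hx')
    have h2 := congrArg (Ideal.comap (Ideal.Quotient.mk (Ideal.span {c'}))) h1
    rw [Ideal.comap_map_of_surjective _ Ideal.Quotient.mk_surjective, ← RingHom.ker_eq_comap_bot,
      sup_eq_left.mpr hle, Ideal.comap_top] at h2
    exact hn.ne_top h2
  obtain ⟨b, hb, hb0⟩ := SetLike.exists_of_lt
    (Ideal.bot_lt_annihilator_of_disjoint_nonZeroDivisors hdisj)
  obtain ⟨b, rfl⟩ := Ideal.Quotient.mk_surjective b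
  have hbn : ∀ w ∈ n, ∃ v, b * w = c' * v := by
    intro w hw
    have h1 := Submodule.mem_annihilator.mp hb _ (Ideal.mem_map_of_mem _ hw)
    rw [smul_eq_mul, ← map_mul, Ideal.Quotient.eq_zero_iff_mem, Ideal.mem_span_singleton] at h1
    exact h1
  have hbc : ¬ c' ∣ b := by
    rwa [Ideal.mem_bot, Ideal.Quotient.eq_zero_iff_mem, Ideal.mem_span_singleton] at hb0
  obtain ⟨z, hz, y, hy, hzy⟩ : ∃ z ∈ n, ∃ y ∉ n, b * z = c' * y := by
    by_contra! hcon
    refine hbc (H.dvd b n hcn fun x hx => ?_)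
    obtain ⟨y, hy⟩ := hbn x hx
    by_contra! h
    exact hcon x hx y (fun hyn => h y hyn hy) hy
  refine ⟨z, hz, y, hy, fun w hw => ?_⟩
  obtain ⟨v, hv⟩ := hbn w hw
  refine ⟨v, (mul_cancel_left_mem_nonZeroDivisors H.regular).mp ?_⟩
  linear_combination (- w) * hzy + z * hv

end IsNormalization

end Normalization

/-! ### Choice of uniformizing parameters -/

section Uniformizers

variable {k A B : Type*} [Field k] [CommRing A] [Algebra k A] [CommRing B] [Algebra A B]

lemma span_mono {ι : Type*} [Fintype ι] (t : ι → B) (a : ι → ℕ) :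
    Ideal.span {mono t a} = ∏ i, Ideal.span {t i} ^ a i := by
  simp only [mono, Ideal.span_singleton_pow, Ideal.prod_span_singleton]

lemma le_of_mono_dvd [Fintype (MaximalSpectrum B)] {t : MaximalSpectrum B → B}
    (ht : ∀ i, i.asIdeal = Ideal.span {t i}) (hreg : ∀ i, t i ∈ nonZeroDivisors B)
    (a b : MaximalSpectrum B → ℕ) (h : mono t a ∣ mono t b) : a ≤ b := by
  classical
  intro i
  by_contra! hlt
  have h1 : t i ^ (b i + 1) ∣ mono t b :=
    ((pow_dvd_pow _ hlt).trans (Finset.dvd_prod_of_mem (fun i => t i ^ a i)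
      (Finset.mem_univ i))).trans h
  rw [mono, ← Finset.mul_prod_erase _ _ (Finset.mem_univ i), pow_succ] at h1
  have h2 : t i ∣ ∏ j ∈ Finset.univ.erase i, t j ^ b j := by
    obtain ⟨c, hc⟩ := h1
    rw [mul_assoc] at hc
    exact ⟨c, (mul_cancel_left_mem_nonZeroDivisors (pow_mem (hreg i) _)).mp hc⟩
  have hp : i.asIdeal.IsPrime := i.isMaximal.isPrime
  rw [← Ideal.mem_span_singleton, ← ht, hp.prod_mem_iff] at h2
  obtain ⟨j, hj, hji⟩ := h2
  have h3 : t j ∈ i.asIdeal := hp.mem_of_pow_mem _ hji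
  have h4 : j.asIdeal ≤ i.asIdeal := by rwa [ht j, Ideal.span_singleton_le_iff_mem]
  exact Finset.ne_of_mem_erase hj
    (MaximalSpectrum.ext (j.isMaximal.eq_of_le i.isMaximal.ne_top h4))

variable [IsLocalRing A] [Module.Finite A B] {c : A}

lemma IsNormalization.regular_of_eq_span (H : IsNormalization k B c) {n : Ideal B}
    (hn : n.IsMaximal) {t : B} (ht : n = Ideal.span {t}) : t ∈ nonZeroDivisors B := by
  have h := H.mem_of_isMaximal hn
  rw [ht, Ideal.mem_span_singleton] at h
  obtain ⟨s, hs⟩ := h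
  have h1 := H.regular
  rw [hs, mul_mem_nonZeroDivisors] at h1
  exact h1.1

variable [Algebra k B] [IsScalarTower k A B]

namespace IsNormalization

variable [Fintype (MaximalSpectrum B)]

/-- A proper ideal lies in some `n = (t i)`, so it equals `t i J'`, and `J'` has colength one less
because `B ⧸ n` has length one. -/
lemma exists_eq_span_mono [IsAlgClosed k] (H : IsNormalization k B c) {t : MaximalSpectrum B → B}
    (ht : ∀ i, i.asIdeal = Ideal.span {t i}) (d : ℕ) (J : Ideal B)
    (hJ : Module.length k (B ⧸ J) = d) : ∃ a, J = Ideal.span {mono t a} := by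
  classical
  induction d generalizing J with
  | zero =>
    refine ⟨0, ?_⟩
    rw [Nat.cast_zero, Module.length_eq_zero_iff, Ideal.Quotient.subsingleton_iff] at hJ
    simp [hJ, mono]
  | succ d ih =>
    have hne : J ≠ ⊤ := by
      rintro rfl
      rw [Module.length_eq_zero_iff.mpr
        (Ideal.Quotient.subsingleton_iff.mpr rfl)] at hJ
      exact absurd hJ.symm (by simp)
    obtain ⟨n, hn, hJn⟩ := Ideal.exists_le_maximal J hne
    let i : MaximalSpectrum B := ⟨n, hn⟩
    have hreg := H.regular_of_eq_span hn (ht i)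
    let J' : Ideal B := Submodule.comap (LinearMap.mulLeft B (t i)) J
    have hJJ' : (J'.restrictScalars k).map (LinearMap.mulLeft k (t i)) = J.restrictScalars k := by
      ext x
      constructor
      · rintro ⟨y, hy, rfl⟩
        exact hy
      · intro hx
        have hx' : x ∈ Ideal.span {t i} := ht i ▸ hJn hx
        obtain ⟨y, rfl⟩ := Ideal.mem_span_singleton.mp hx'
        exact ⟨y, hx, rfl⟩
    have hinj : Function.Injective (LinearMap.mulLeft k (t i)) := fun a b hab =>
      (mul_cancel_left_mem_nonZeroDivisors hreg).mp hab
    have hrange : (LinearMap.mulLeft k (t i)).range = n.restrictScalars k := by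
      ext z
      rw [Submodule.restrictScalars_mem, show n = Ideal.span {t i} from ht i,
        Ideal.mem_span_singleton]
      simp only [LinearMap.mem_range, LinearMap.mulLeft_apply, Dvd.dvd, eq_comm]
    have hlen := length_quotient_map (LinearMap.mulLeft k (t i)) hinj (J'.restrictScalars k)
    rw [hJJ', hrange, length_quotient_restrictScalars, length_quotient_restrictScalars,
      length_quotient_restrictScalars, hJ, H.length_quotient hn, Nat.cast_add, Nat.cast_one]
      at hlen
    obtain ⟨a, ha⟩ := ih J' (ENat.add_left_injective_of_ne_top ENat.one_ne_top hlen).symm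
    refine ⟨a + Pi.single i 1, ?_⟩
    rw [mono_add, mono_single, pow_one, mul_comm]
    ext x
    have hx := SetLike.ext_iff.mp hJJ' x
    rw [Submodule.restrictScalars_mem] at hx
    rw [← hx, ha, Ideal.mem_span_singleton]
    constructor
    · rintro ⟨y, hy, rfl⟩
      obtain ⟨e, rfl⟩ := Ideal.mem_span_singleton.mp hy
      exact ⟨e, by simp [mul_assoc]⟩
    · rintro ⟨e, rfl⟩
      exact ⟨mono t a * e, Ideal.mem_span_singleton.mpr ⟨e, rfl⟩, by simp [mul_assoc]⟩

lemma exists_generators [IsNoetherianRing B] [DecidableEq (MaximalSpectrum B)]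
    (H : IsNormalization k B c)
    {γ : MaximalSpectrum B → ℕ} (hγ : ∀ i, γ i ≠ 0) : ∃ t : MaximalSpectrum B → B,
      (∀ i, i.asIdeal = Ideal.span {t i}) ∧
        ∀ i, t i - 1 ∈ ∏ j ∈ Finset.univ.erase i, j.asIdeal ^ γ j := by
  have key : ∀ i : MaximalSpectrum B, ∃ t, i.asIdeal = Ideal.span {t} ∧
      t - 1 ∈ ∏ j ∈ Finset.univ.erase i, j.asIdeal ^ γ j := by
    intro i
    obtain ⟨z, hz, y, hy, h⟩ := H.exists_mul_mem i.isMaximal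
    refine exists_eq_span_of_mul_mem i.isMaximal hz hy h ?_ ?_
    · refine Ideal.sup_prod_eq_top fun j hj => Ideal.sup_pow_eq_top ?_
      exact i.isMaximal.coprime_of_ne j.isMaximal fun he =>
        Finset.ne_of_mem_erase hj (MaximalSpectrum.ext he.symm)
    · intro n' hn' hne
      have hmem : (⟨n', hn'⟩ : MaximalSpectrum B) ∈ Finset.univ.erase i :=
        Finset.mem_erase.mpr ⟨fun he => hne (congrArg MaximalSpectrum.asIdeal he),
          Finset.mem_univ _⟩
      exact (Ideal.le_of_dvd (Finset.dvd_prod_of_mem _ hmem)).trans (Ideal.pow_le_self (hγ _))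
  choose t ht using key
  exact ⟨t, fun i => (ht i).1, fun i => (ht i).2⟩

/-- The normalization of a curve singularity has uniformizing parameters. -/
theorem exists_isUniformizing [IsAlgClosed k] [IsNoetherianRing B] (H : IsNormalization k B c) :
    ∃ (t : MaximalSpectrum B → B) (γ : MaximalSpectrum B → ℕ), IsUniformizing k A t γ := by
  classical
  -- A first choice of generators serves only to factor `(c)`, since the exponents must be known
  -- before congruences modulo them can be imposed. The second choice uses exponents `γ' i + 1`,
  -- which are nonzero as `exists_generators` demands; the surplus factor keeps the monomial in the
  -- conductor.
  obtain ⟨τ, hτ, -⟩ := H.exists_generators (γ := fun _ => 1) fun _ => one_ne_zero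
  have hfin := H.finite_quotient_span
  obtain ⟨γ', hγ'⟩ := H.exists_eq_span_mono hτ _ (Ideal.span {algebraMap A B c})
    (Module.length_eq_finrank k _)
  obtain ⟨t, ht, ht1⟩ := H.exists_generators (γ := fun i => γ' i + 1) fun _ => Nat.succ_ne_zero _
  have hreg : ∀ i, t i ∈ nonZeroDivisors B := fun i => H.regular_of_eq_span i.isMaximal (ht i)
  refine ⟨t, fun i => γ' i + 1, H.injective, hreg, fun i => ?_, fun b => ?_, fun i => ?_,
    fun I hI => ?_, le_of_mono_dvd ht hreg⟩
  · rw [← ht]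
    exact H.length_quotient i.isMaximal
  · have h1 : mono t γ' ∈ Ideal.span {algebraMap A B c} := by
      rw [hγ', span_mono]
      simp only [← hτ, ht]
      rw [← span_mono]
      exact Ideal.mem_span_singleton_self _
    obtain ⟨e, he⟩ := Ideal.mem_span_singleton.mp h1
    obtain ⟨a, ha⟩ := H.conductor (e * mono t (fun _ => 1) * b)
    refine ⟨a, ?_⟩
    rw [ha, show (fun i => γ' i + 1) = γ' + fun _ => 1 from rfl, mono_add, he]
    ring
  · have h1 := ht1 i
    simp only [ht, Ideal.span_singleton_pow, Ideal.prod_span_singleton] at h1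
    rw [mono, ← Finset.mul_prod_erase _ _ (Finset.mem_univ i), mul_comm]
    exact mul_dvd_mul_right (Ideal.mem_span_singleton.mp h1) _
  · have := finite_quotient_map (k := k) (B := B) I
    exact H.exists_eq_span_mono ht _ _ (Module.length_eq_finrank k _)

end IsNormalization

end Uniformizers

/-! ### Conductor and normality of the integral closure -/

section IntegralClosure

/-- An element that stabilizes a finitely generated module containing a unit is integral. -/
lemma isIntegral_of_mul_mem {R K : Type*} [CommRing R] [CommRing K] [Algebra R K]
    (N : Submodule R K) [IsNoetherian R N] {u : K} (hu : IsUnit u) (huN : u ∈ N) {x : K}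
    (hx : ∀ y ∈ N, x * y ∈ N) : IsIntegral R x := by
  let S : Subalgebra R K :=
    { carrier := {x | ∀ y ∈ N, x * y ∈ N}
      mul_mem' := fun {a b} ha hb y hy => by rw [mul_assoc]; exact ha _ (hb _ hy)
      add_mem' := fun {a b} ha hb y hy => by rw [add_mul]; exact N.add_mem (ha _ hy) (hb _ hy)
      algebraMap_mem' := fun r y hy => by rw [← Algebra.smul_def]; exact N.smul_mem r hy }
  -- Multiplication by the unit `u` embeds the stabilizer of `N` into `N`, so the stabilizer is a
  -- Noetherian module and its elements are integral.
  let φ : Subalgebra.toSubmodule S →ₗ[R] N :=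
    LinearMap.codRestrict N ((LinearMap.mulRight R u) ∘ₗ (Subalgebra.toSubmodule S).subtype)
      fun s => s.2 u huN
  have hφ : Function.Injective φ := fun a b hab =>
    Subtype.ext (hu.mul_left_injective (congrArg Subtype.val hab))
  exact isIntegral_of_submodule_noetherian S (isNoetherian_of_injective φ hφ) x hx

variable {A : Type*} [CommRing A]

/-- Otherwise a nonzero `x` annihilates the maximal ideal. If `x` belongs to it, then `x ^ 2 = 0`
contradicts reducedness; if `x` is a unit, then `A` is a field of dimension zero. -/
lemma exists_mem_nonZeroDivisors [IsLocalRing A] [IsNoetherianRing A] [IsReduced A]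
    (hdim : ringKrullDim A = 1) : ∃ c ∈ IsLocalRing.maximalIdeal A, c ∈ nonZeroDivisors A := by
  by_contra! h
  have hdisj : Disjoint (IsLocalRing.maximalIdeal A : Set A) (nonZeroDivisors A : Set A) :=
    Set.disjoint_left.mpr h
  obtain ⟨x, hx, hx0⟩ := SetLike.exists_of_lt
    (Ideal.bot_lt_annihilator_of_disjoint_nonZeroDivisors hdisj)
  have hx' : ∀ y ∈ IsLocalRing.maximalIdeal A, x * y = 0 := Submodule.mem_annihilator.mp hx
  by_cases hxm : x ∈ IsLocalRing.maximalIdeal A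
  · have h1 := hx' x hxm
    exact hx0 (IsReduced.eq_zero x ⟨2, by rw [pow_two, h1]⟩)
  · have hu : IsUnit x := by
      by_contra hu
      exact hxm ((IsLocalRing.mem_maximalIdeal x).mpr hu)
    have hbot : IsLocalRing.maximalIdeal A = ⊥ := by
      rw [eq_bot_iff]
      intro y hy
      exact (hu.mul_right_eq_zero).mp (hx' y hy)
    let := (IsLocalRing.isField_iff_maximalIdeal_eq.mpr hbot).toField
    rw [ringKrullDim_eq_zero_of_field] at hdim
    exact zero_ne_one hdim

/-- Finitely many module generators have a common denominator, which then lies in the conductor. -/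
lemma exists_mul_integralClosure_mem
    [Module.Finite A (integralClosure A (FractionRing A))] :
    ∃ d ∈ nonZeroDivisors A, ∀ b : integralClosure A (FractionRing A), ∃ a,
      algebraMap A (integralClosure A (FractionRing A)) a =
        algebraMap A (integralClosure A (FractionRing A)) d * b := by
  obtain ⟨n, s, hs⟩ := Module.Finite.exists_fin (R := A)
    (M := integralClosure A (FractionRing A))
  obtain ⟨d, hd⟩ := IsLocalization.exist_integer_multiples (nonZeroDivisors A) Finset.univ
    fun i => (s i : FractionRing A)
  refine ⟨d.1, d.2, fun b => ?_⟩
  have hb : b ∈ Submodule.span A (Set.range s) := hs ▸ Submodule.mem_top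
  induction hb using Submodule.span_induction with
  | mem x hx =>
    obtain ⟨i, rfl⟩ := hx
    obtain ⟨a, ha⟩ := hd i (Finset.mem_univ i)
    refine ⟨a, Subtype.ext ?_⟩
    rw [Algebra.smul_def] at ha
    exact ha
  | zero => exact ⟨0, by simp⟩
  | add x y _ _ hx hy =>
    obtain ⟨a, ha⟩ := hx
    obtain ⟨b, hb⟩ := hy
    exact ⟨a + b, by rw [map_add, ha, hb, mul_add]⟩
  | smul r x _ hx =>
    obtain ⟨a, ha⟩ := hx
    exact ⟨r * a, by rw [map_mul, ha, Algebra.smul_def]; ring⟩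

lemma exists_pow_le_span [IsLocalRing A] [IsNoetherianRing A] (hdim : ringKrullDim A = 1)
    {c : A} (hc : c ∈ nonZeroDivisors A) :
    ∃ d, IsLocalRing.maximalIdeal A ^ d ≤ Ideal.span {c} := by
  have h := ringKrullDim_quotient_succ_le_of_nonZeroDivisor hc
  rw [hdim] at h
  have : Ring.KrullDimLE 0 (A ⧸ Ideal.span {c}) := by
    rw [Ring.krullDimLE_iff]
    rw [show (1 : WithBot ℕ∞) = 0 + 1 from (zero_add 1).symm] at h
    exact ENat.WithBot.add_le_add_one_right_iff.mp h
  have : IsArtinianRing (A ⧸ Ideal.span {c}) := isArtinianRing_iff_krullDimLE_zero.mpr this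
  exact IsLocalRing.exists_maximalIdeal_pow_le_of_isArtinianRing_quotient _

/-- The integral closure of a one-dimensional reduced local ring satisfies `IsNormalization`. -/
theorem exists_isNormalization {k : Type*} [Field k] [Algebra k A] [IsLocalRing A]
    [IsNoetherianRing A] [IsReduced A] (hdim : ringKrullDim A = 1)
    [∀ d, Module.Finite k (A ⧸ IsLocalRing.maximalIdeal A ^ d)]
    [Module.Finite A (integralClosure A (FractionRing A))] :
    ∃ c : A, IsNormalization k (integralClosure A (FractionRing A)) c := by
  obtain ⟨c₁, hc₁, hreg₁⟩ := exists_mem_nonZeroDivisors hdim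
  obtain ⟨c₂, hreg₂, hcond⟩ := exists_mul_integralClosure_mem (A := A)
  have hreg : c₁ * c₂ ∈ nonZeroDivisors A := mul_mem hreg₁ hreg₂
  have hunit : IsUnit (algebraMap A (FractionRing A) (c₁ * c₂)) :=
    IsLocalization.map_units (FractionRing A) (⟨_, hreg⟩ : nonZeroDivisors A)
  refine ⟨c₁ * c₂, ?_, Ideal.mul_mem_right _ _ hc₁, ?_, fun b => ?_, ?_, fun b J hJ h => ?_⟩
  · intro a b hab
    exact IsFractionRing.injective A (FractionRing A) (congrArg Subtype.val hab)
  · rw [mem_nonZeroDivisors_iff_right]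
    intro x hx
    exact Subtype.ext ((hunit.mul_left_eq_zero).mp (congrArg Subtype.val hx))
  · obtain ⟨a, ha⟩ := hcond b
    exact ⟨c₁ * a, by rw [map_mul, map_mul, ha, mul_assoc]⟩
  · obtain ⟨d, hd⟩ := exists_pow_le_span hdim hreg
    exact Module.Finite.of_surjective (Ideal.Quotient.factorₐ k hd).toLinearMap
      (Ideal.Quotient.factor_surjective hd)
  · set u := algebraMap A (FractionRing A) (c₁ * c₂)
    obtain ⟨v, hv⟩ := hunit.exists_right_inv
    let N : Submodule A (FractionRing A) :=
      (J.restrictScalars A).map (integralClosure A (FractionRing A)).val.toLinearMap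
    -- The fraction `b / c` stabilizes the image of `J`, a finite `A`-module that contains the unit
    -- `c` of the total ring of fractions.
    have hv_int : IsIntegral A (v * (b : FractionRing A)) := by
      refine isIntegral_of_mul_mem N hunit ⟨_, hJ, rfl⟩ ?_
      rintro _ ⟨x, hx, rfl⟩
      obtain ⟨y, hy, hxy⟩ := h x hx
      refine ⟨y, hy, ?_⟩
      have h1 : (b : FractionRing A) * x = u * y := congrArg Subtype.val hxy
      change (y : FractionRing A) = v * b * x
      linear_combination (-v) * h1 + (-(y : FractionRing A)) * hv
    refine ⟨⟨v * b, hv_int⟩, Subtype.ext ?_⟩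
    change (b : FractionRing A) = u * (v * b)
    linear_combination (-(b : FractionRing A)) * hv

end IntegralClosure

/-! ### Finiteness of the integral closure -/

section Japanese

/-- Through `f`, the ring `T` is a finite `P`-module, and `C` embeds into it as a submodule. The
application has `f` twisted by a power of Frobenius, which makes a semilinear embedding linear. -/
lemma finite_of_injective_of_comp_eq {P C T : Type*} [CommRing P] [IsNoetherianRing P] [CommRing C]
    [Algebra P C] [CommRing T] {f : P →+* T} (hf : f.Finite) {φ : C →+* T}
    (hφ : Function.Injective φ) (h : φ.comp (algebraMap P C) = f) : Module.Finite P C := by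
  let := f.toAlgebra
  have hT : Module.Finite P T := hf
  let ψ : C →ₗ[P] T :=
    { toFun := φ
      map_add' := map_add φ
      map_smul' := fun a x => by
        rw [Algebra.smul_def, map_mul, ← RingHom.comp_apply, h, RingHom.id_apply,
          Algebra.smul_def]
        rfl }
  have : IsNoetherian P C := isNoetherian_of_injective ψ hφ
  infer_instance

/-- Frobenius is finite on polynomial rings over perfect fields. -/
lemma finite_iterateFrobenius_mvPolynomial {k : Type*} [Field k] (p : ℕ) [ExpChar k p]
    [PerfectRing k p] {σ : Type*} [Finite σ] [ExpChar (MvPolynomial σ k) p] (n : ℕ) :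
    (iterateFrobenius (MvPolynomial σ k) p n).Finite := by
  refine RingHom.IsIntegral.to_finite ?_ ?_
  · intro x
    refine ⟨Polynomial.X ^ p ^ n - Polynomial.C x,
      Polynomial.monic_X_pow_sub_C x (pow_ne_zero _ (expChar_pos k p).ne'), ?_⟩
    simp [iterateFrobenius_def]
  · have h1 : (MvPolynomial.C (σ := σ)).comp (iterateFrobenius k p n) =
        (iterateFrobenius (MvPolynomial σ k) p n).comp MvPolynomial.C := by
      ext1 a
      simp [iterateFrobenius_def]
    have h2 : (iterateFrobenius k p n).FiniteType :=
      RingHom.FiniteType.of_surjective _ (bijective_iterateFrobenius k p n).2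
    have h3 : (MvPolynomial.C (R := k) (σ := σ)).FiniteType :=
      RingHom.finiteType_algebraMap.mpr inferInstance
    exact (h1 ▸ h3.comp h2 : RingHom.FiniteType _).of_comp_finiteType

/-- The integral closure of a polynomial ring over a perfect field in a finite extension of its
field of fractions is finite. -/
theorem finite_integralClosure_mvPolynomial {k : Type*} [Field k] [PerfectField k] {σ : Type*}
    [Finite σ] (L : Type*) [Field L] [Algebra (MvPolynomial σ k) L]
    [Algebra (FractionRing (MvPolynomial σ k)) L]
    [IsScalarTower (MvPolynomial σ k) (FractionRing (MvPolynomial σ k)) L]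
    [FiniteDimensional (FractionRing (MvPolynomial σ k)) L] :
    Module.Finite (MvPolynomial σ k) (integralClosure (MvPolynomial σ k) L) := by
  set P := MvPolynomial σ k
  set K := FractionRing P
  obtain ⟨p, hp⟩ := ExpChar.exists k
  have : PerfectRing k p := inferInstance
  have : ExpChar P p := expChar_of_injective_algebraMap (algebraMap k P).injective p
  have : ExpChar K p := expChar_of_injective_algebraMap (IsFractionRing.injective P K) p
  let Ls := separableClosure K L
  have : ExpChar Ls p := expChar_of_injective_algebraMap (algebraMap K Ls).injective p
  have : ExpChar L p := expChar_of_injective_algebraMap (algebraMap K L).injective p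
  have : IsPurelyInseparable Ls L := inferInstance
  have : FiniteDimensional Ls L := inferInstance
  have : IsScalarTower P Ls L := IsScalarTower.of_algebraMap_eq fun x => by
    rw [IsScalarTower.algebraMap_apply P K L, IsScalarTower.algebraMap_apply P K Ls]
    rfl
  let Cs := integralClosure P Ls
  have : Module.Finite P Cs := IsIntegralClosure.finite P K Ls Cs
  let n := IsPurelyInseparable.exponent Ls L
  -- Over the separable closure `Ls` the extension is purely inseparable, so a power of Frobenius
  -- maps `L` into `Ls`. It embeds the integral closure into that of the separable part, whose
  -- finiteness is classical.
  let F : L →+* Ls := IsPurelyInseparable.iterateFrobenius Ls L p (le_refl n)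
  have hF : ∀ x, algebraMap Ls L (F x) = x ^ p ^ n := fun x => by
    exact IsPurelyInseparable.algebraMap_iterateFrobenius Ls p (le_refl n) x
  let C := integralClosure P L
  let φ : C →+* Cs := (F.comp C.val.toRingHom).codRestrict Cs fun x => by
    have h1 : IsIntegral P (algebraMap Ls L (F x)) := by
      rw [hF]
      exact x.2.pow _
    exact (isIntegral_algebraMap_iff (algebraMap Ls L).injective).mp h1
  have hφ : Function.Injective φ := fun x y hxy =>
    Subtype.ext (F.injective (congrArg Subtype.val hxy))
  refine finite_of_injective_of_comp_eq (P := P) (C := C) (T := Cs)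
    (f := (algebraMap P Cs).comp (iterateFrobenius P p n)) ?_ hφ ?_
  · exact RingHom.Finite.comp (RingHom.finite_algebraMap.mpr inferInstance)
      (finite_iterateFrobenius_mvPolynomial p n)
  · refine RingHom.ext fun a => ?_
    refine Subtype.ext ((algebraMap Ls L).injective ?_)
    change algebraMap Ls L (F (algebraMap P L a)) = algebraMap Ls L (algebraMap P Ls _)
    rw [hF, ← IsScalarTower.algebraMap_apply, iterateFrobenius_def, map_pow]

/-- The integral closure of a finitely generated domain over a perfect field in its field of
fractions is finite over a polynomial ring. -/
lemma exists_span_integral_of_finiteType {k : Type*} [Field k] [PerfectField k] {D L : Type*}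
    [CommRing D] [IsDomain D] [Algebra k D] [Algebra.FiniteType k D] [Field L] [Algebra D L]
    [IsFractionRing D L] :
    ∃ s : Finset L, ∀ x : L, IsIntegral D x → x ∈ Submodule.span D (s : Set L) := by
  -- Noether normalization reduces the claim to a polynomial ring; generators over it also generate
  -- over the larger ring `D`.
  obtain ⟨r, g, hg, hgfin⟩ := exists_finite_inj_algHom_of_fg k D
  let P := MvPolynomial (Fin r) k
  let : Algebra P D := g.toRingHom.toAlgebra
  have : Module.Finite P D := hgfin
  have : FaithfulSMul P D := (faithfulSMul_iff_algebraMap_injective P D).mpr hg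
  let : Algebra P L := ((algebraMap D L).comp (algebraMap P D)).toAlgebra
  have : IsScalarTower P D L := IsScalarTower.of_algebraMap_eq fun _ => rfl
  have : FaithfulSMul P L := (faithfulSMul_iff_algebraMap_injective P L).mpr
    ((IsFractionRing.injective D L).comp hg)
  let : Algebra (FractionRing P) L := FractionRing.liftAlgebra P L
  have : IsScalarTower P (FractionRing P) L := FractionRing.isScalarTower_liftAlgebra P L
  have : FiniteDimensional (FractionRing P) L := .of_isLocalization P D (nonZeroDivisors P)
  have hfin : Module.Finite P (integralClosure P L) := finite_integralClosure_mvPolynomial L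
  obtain ⟨n, c, hc⟩ := Module.Finite.exists_fin (R := P) (M := integralClosure P L)
  classical
  refine ⟨Finset.univ.image fun i => (c i : L), fun x hx => ?_⟩
  have hxP : IsIntegral P x := isIntegral_trans x hx
  have hmem : (⟨x, hxP⟩ : integralClosure P L) ∈ Submodule.span P (Set.range c) :=
    hc ▸ Submodule.mem_top
  obtain ⟨a, ha⟩ := (Submodule.mem_span_range_iff_exists_fun P).mp hmem
  have hx' : x = ∑ i, a i • (c i : L) := by
    have := congrArg (integralClosure P L).val ha
    rw [map_sum] at this
    exact this.symm
  rw [hx']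
  refine sum_mem fun i _ => ?_
  rw [← algebraMap_smul D (a i) (c i : L)]
  exact Submodule.smul_mem _ _ (Submodule.subset_span (by simp))

/-- Elements of a field that are integral over a ring essentially of finite type over a perfect
field lie in a finitely generated module, if the field consists of fractions of this ring. -/
lemma exists_span_integral_of_essFiniteType (k : Type*) [Field k] [PerfectField k] {A L : Type*}
    [CommRing A] [Algebra k A] [Algebra.EssFiniteType k A] [Field L] [Algebra A L]
    (hL : ∀ x : L, ∃ a b : A, algebraMap A L b ≠ 0 ∧ x * algebraMap A L b = algebraMap A L a) :
    ∃ s : Finset L, ∀ x : L, IsIntegral A x → x ∈ Submodule.span A (s : Set L) := by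
  let : Algebra k L := ((algebraMap A L).comp (algebraMap k A)).toAlgebra
  have : IsScalarTower k A L := IsScalarTower.of_algebraMap_eq fun _ => rfl
  let D := Algebra.EssFiniteType.subalgebra k A
  let M := Algebra.EssFiniteType.submonoid k A
  let φ : D →ₐ[k] L := (IsScalarTower.toAlgHom k A L).comp D.val
  have hu : ∀ m : M, φ m ≠ 0 := fun m =>
    ((IsLocalization.map_units A m).map (algebraMap A L)).ne_zero
  have hφ : ∀ a : A, ∃ d : D, ∃ m : M, algebraMap A L a * φ m = φ d := by
    intro a
    obtain ⟨⟨d, m⟩, h⟩ := IsLocalization.surj M a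
    exact ⟨d, m, by simpa [φ] using congrArg (algebraMap A L) h⟩
  have : Algebra.FiniteType k φ.range := Algebra.FiniteType.of_surjective φ.rangeRestrict
    φ.rangeRestrict_surjective
  have hfr : IsFractionRing φ.range L := by
    refine IsFractionRing.of_field _ _ fun z => ?_
    obtain ⟨a, b, hb, hz⟩ := hL z
    obtain ⟨d, m, ha⟩ := hφ a
    obtain ⟨d', m', hb'⟩ := hφ b
    refine ⟨⟨φ (d * m'), _, rfl⟩, ⟨φ (d' * m), _, rfl⟩, ?_⟩
    have hd' : φ d' ≠ 0 := by rw [← hb']; exact mul_ne_zero hb (hu m')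
    change z = φ (d * m') / φ (d' * m)
    rw [eq_div_iff (by rw [map_mul]; exact mul_ne_zero hd' (hu m)), map_mul, map_mul, ← ha, ← hb',
      ← hz]
    ring
  obtain ⟨s, hs⟩ := exists_span_integral_of_finiteType (k := k) (D := φ.range) (L := L)
  refine ⟨s, fun x hx => ?_⟩
  -- `A` is a localization of the finitely generated algebra `D` at `M`. A multiple `m • x` is
  -- integral over `D`, hence over its image in `L`, and `m` is invertible in `A`.
  obtain ⟨m, hm⟩ := IsIntegral.exists_multiple_integral_of_isLocalization M x hx
  let : Algebra D φ.range := φ.rangeRestrict.toRingHom.toAlgebra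
  have : IsScalarTower D φ.range L := IsScalarTower.of_algebraMap_eq fun _ => rfl
  have hspan : Submodule.span φ.range (s : Set L) ≤
      (Submodule.span A (s : Set L) : Set L) := by
    intro y hy
    induction hy using Submodule.span_induction with
    | mem y hy => exact Submodule.subset_span hy
    | zero => exact zero_mem _
    | add y z _ _ hy hz => exact add_mem hy hz
    | smul r y _ hy =>
      obtain ⟨d, hd⟩ := φ.mem_range.mp r.2
      have : r • y = (d : A) • y := by
        rw [Subalgebra.smul_def, smul_eq_mul, ← hd, Algebra.smul_def]; rfl
      rw [this]
      exact Submodule.smul_mem _ _ hy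
  have h1 : m • x ∈ Submodule.span A (s : Set L) := hspan (hs _ hm.tower_top)
  obtain ⟨v, hv⟩ := (IsLocalization.map_units A m).exists_left_inv
  have h2 : x = v • (m • x) := by
    rw [Submonoid.smul_def, ← algebraMap_smul A (m : D) x, smul_smul, hv, one_smul]
  rw [h2]
  exact Submodule.smul_mem _ _ h1

/-- The integral closure of a reduced ring essentially of finite type over a perfect field in its
total ring of fractions is finite. -/
theorem finite_integralClosure_fractionRing (k : Type*) [Field k] [PerfectField k] (A : Type*)
    [CommRing A] [Algebra k A] [Algebra.EssFiniteType k A] [IsNoetherianRing A] [IsReduced A] :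
    Module.Finite A (integralClosure A (FractionRing A)) := by
  have : Finite (minimalPrimes A) := minimalPrimes.finite_of_isNoetherianRing A
  have hprime : ∀ p : minimalPrimes A, p.1.IsPrime := fun p => p.2.1.1
  let L : minimalPrimes A → Type _ := fun p => FractionRing (A ⧸ p.1)
  let hker : ∀ (p : minimalPrimes A) (a : A), algebraMap A (L p) a = 0 ↔ a ∈ p.1 := by
    intro p a
    rw [IsScalarTower.algebraMap_apply A (A ⧸ p.1) (L p),
      IsFractionRing.to_map_eq_zero_iff (R := A ⧸ p.1)]
    exact Ideal.Quotient.eq_zero_iff_mem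
  -- Nonzerodivisors avoid the minimal primes, so the total ring of fractions maps to each field `L
  -- p`. These maps are jointly injective because `A` is reduced, which reduces finiteness to the
  -- fields.
  let Φ : ∀ p : minimalPrimes A, FractionRing A →ₐ[A] L p := fun p =>
    IsLocalization.liftAlgHom (M := nonZeroDivisors A) (f := Algebra.ofId A (L p)) fun y =>
      isUnit_iff_ne_zero.mpr fun h => Set.disjoint_left.mp
        (Ideal.disjoint_nonZeroDivisors_of_mem_minimalPrimes p.2) ((hker p _).mp h) y.2
  have hinj : ∀ x : FractionRing A, (∀ p, Φ p x = 0) → x = 0 := by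
    intro x hx
    obtain ⟨a, s, rfl⟩ := IsLocalization.exists_mk'_eq (nonZeroDivisors A) x
    have ha : a ∈ sInf (minimalPrimes A) := by
      refine Ideal.mem_sInf.mpr fun {p} hp => (hker ⟨p, hp⟩ a).mp ?_
      have h1 := congrArg (Φ ⟨p, hp⟩) (IsLocalization.mk'_spec (FractionRing A) a s)
      rw [map_mul, hx, zero_mul, AlgHom.commutes] at h1
      exact h1.symm
    rw [minimalPrimes, Ideal.sInf_minimalPrimes] at ha
    have ha0 : a = 0 := by
      have : IsNilpotent a := ha
      exact this.eq_zero
    rw [ha0, IsLocalization.mk'_zero]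
  have hspan : ∀ p : minimalPrimes A, ∃ s : Finset (L p), ∀ x : L p, IsIntegral A x →
      x ∈ Submodule.span A (s : Set (L p)) := by
    intro p
    refine exists_span_integral_of_essFiniteType k fun x => ?_
    obtain ⟨a, b, hb, rfl⟩ := IsFractionRing.div_surjective (A ⧸ p.1) x
    obtain ⟨a, rfl⟩ := Ideal.Quotient.mk_surjective a
    obtain ⟨b, rfl⟩ := Ideal.Quotient.mk_surjective b
    have hb' : algebraMap A (L p) b ≠ 0 := fun h =>
      nonZeroDivisors.ne_zero hb (Ideal.Quotient.eq_zero_iff_mem.mpr ((hker p b).mp h))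
    exact ⟨a, b, hb', div_mul_cancel₀ _ hb'⟩
  choose s hs using hspan
  let ψ : integralClosure A (FractionRing A) →ₗ[A]
      ∀ p, Submodule.span A (s p : Set (L p)) := LinearMap.pi fun p =>
    ((Φ p).toLinearMap ∘ₗ (integralClosure A (FractionRing A)).val.toLinearMap).codRestrict _
      fun b => hs p _ (b.2.map (Φ p))
  have hψ : Function.Injective ψ := by
    rw [injective_iff_map_eq_zero]
    intro b hb
    exact Subtype.ext (hinj b fun p => congrArg Subtype.val (congrFun hb p))
  have : ∀ p, Module.Finite A (Submodule.span A (s p : Set (L p))) := fun p =>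
    Module.Finite.span_finset A (s p)
  have : IsNoetherian A (integralClosure A (FractionRing A)) := isNoetherian_of_injective ψ hψ
  infer_instance

end Japanese

/-! ### The local ring of a curve at a closed point -/

section Germ

variable {k : Type u} [Field k] {X : Scheme.{u}} (f : X ⟶ Spec (CommRingCat.of k)) (x : X)

lemma essFiniteType_stalk (R : Type u) [CommRing R] (p : PrimeSpectrum R) :
    Algebra.EssFiniteType R ((Spec.structureSheaf R).presheaf.stalk p) :=
  Algebra.EssFiniteType.of_isLocalization _ p.asIdeal.primeCompl

lemma essFiniteType_preimage_fromSpecStalk (R : CommRingCat.{u}) (y : Spec R) :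
    (Spec.preimage ((Spec R).fromSpecStalk y)).hom.EssFiniteType := by
  rw [show Spec.preimage ((Spec R).fromSpecStalk y) = StructureSheaf.toStalk R y from
    Spec.map_injective ((Spec.map_preimage _).trans (Spec.fromSpecStalk_eq' _ _))]
  exact essFiniteType_stalk R y

/-- The structure map factors through the local ring of `Spec k` at the image point. Both the
localization and the stalk map of `f` are essentially of finite type. -/
lemma essFiniteType_localRingAt [LocallyOfFiniteType f] :
    Algebra.EssFiniteType k (LocalRingAt f x) := by
  have h : Spec.preimage (X.fromSpecStalk x ≫ f) =
      Spec.preimage ((Spec (CommRingCat.of k)).fromSpecStalk (f x)) ≫ f.stalkMap x := by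
    apply Spec.map_injective
    rw [Spec.map_comp, Spec.map_preimage, Spec.map_preimage,
      Scheme.SpecMap_stalkMap_fromSpecStalk]
  have h₂ : (Spec.preimage (X.fromSpecStalk x ≫ f)).hom.EssFiniteType := by
    rw [h]
    exact (essFiniteType_preimage_fromSpecStalk _ _).comp (LocallyOfFiniteType.stalkMap f x)
  exact h₂

/-- The local ring of a reduced curve over an algebraically closed field has a rational generating
function of classes of varieties of ideals. -/
theorem exists_polynomial_of_ringKrullDim_eq_one [IsAlgClosed k] [LocallyOfFiniteType f]
    [IsReduced X] (hx : IsClosed {x}) (hdim : ringKrullDim (X.presheaf.stalk x) = 1) :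
    ∃ P : Polynomial (K0 k),
      punctualHilbertZeta f x hx * (1 - PowerSeries.X) ^ numBranches x =
        (P : PowerSeries (K0 k)) := by
  have : IsLocallyNoetherian X := LocallyOfFiniteType.isLocallyNoetherian f
  have : IsNoetherianRing (LocalRingAt f x) :=
    inferInstanceAs (IsNoetherianRing (X.presheaf.stalk x))
  have : _root_.IsReduced (LocalRingAt f x) :=
    inferInstanceAs (_root_.IsReduced (X.presheaf.stalk x))
  have hdim' : ringKrullDim (LocalRingAt f x) = 1 := hdim
  have : Algebra.EssFiniteType k (LocalRingAt f x) := essFiniteType_localRingAt f x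
  have : ∀ d, Module.Finite k
      (LocalRingAt f x ⧸ IsLocalRing.maximalIdeal (LocalRingAt f x) ^ d) :=
    finite_neighbourhood f x hx
  have : Module.Finite (LocalRingAt f x)
      (integralClosure (LocalRingAt f x) (FractionRing (LocalRingAt f x))) :=
    finite_integralClosure_fractionRing k (LocalRingAt f x)
  have : IsNoetherianRing (integralClosure (LocalRingAt f x) (FractionRing (LocalRingAt f x))) :=
    IsNoetherianRing.of_finite (LocalRingAt f x) _
  obtain ⟨c, hc⟩ := exists_isNormalization (k := k) hdim'
  have : Finite (MaximalSpectrum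
    (integralClosure (LocalRingAt f x) (FractionRing (LocalRingAt f x)))) :=
    hc.finite_maximalSpectrum
  let : Fintype (MaximalSpectrum
    (integralClosure (LocalRingAt f x) (FractionRing (LocalRingAt f x)))) := Fintype.ofFinite _
  obtain ⟨t, γ, H⟩ := hc.exists_isUniformizing
  obtain ⟨P, hP⟩ := H.exists_polynomial
  refine ⟨P, ?_⟩
  rw [← hP, ← Nat.card_eq_fintype_card]
  rfl

end Germ

end HilbZeta

end

theorem theorem2p3 {k : Type u} [Field k] [IsAlgClosed k] {X : Scheme.{u}}
    (f : X ⟶ Spec (CommRingCat.of k)) [LocallyOfFiniteType f] [IsReduced X]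
    (x : X) (hx : IsClosed {x}) (hdim : ringKrullDim (X.presheaf.stalk x) = 1) :
    ∃ P : Polynomial (HilbZeta.K0 k),
      HilbZeta.punctualHilbertZeta f x hx * (1 - PowerSeries.X) ^ HilbZeta.numBranches x =
        (P : PowerSeries (HilbZeta.K0 k)) :=
  HilbZeta.exists_polynomial_of_ringKrullDim_eq_one f x hx hdim
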